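/- **Form rings.** Let $(R,M,\psi,\Phi)$ be a form ring with $R$ a finite ring: $M$ is a right $R\otimes R$-module, $\psi:R_R\to M_{1\otimes R}$ an isomorphism of right $R$-modules, $\tau:M\to M$ an additive involution with $\tau(m)(s\otimes r)=\tau(m(r\otimes s))$ such that $\psi^{-1}(\tau(\psi(1)))\in R^\times$, and $\Phi$ an $R$-qmodule (an abelian group with a pointed quadratic map $[\,]:R\to \mathrm{End}(\Phi)$, $[1]=1$, $\phi[rs]=\phi[r][s]$) with qmodule homomorphisms $\{\!\{\,\}\!\}:M\to\Phi$, $\lambda:\Phi\to M$ (where $m[r]=m(r\otimes r)$) satisfying $\{\!\{\tau(m)\}\!\}=\{\!\{m\}\!\}$, $\tau(\lambda(\phi))=\lambda(\phi)$, $\lambda(\{\!\{m\}\!\})=m+\tau(m)$, $\{\!\{\lambda(\phi)(r\otimes s)\}\!\}=\phi[r+s]-\phi[r]-\phi[s]$. Put $r^J=\psi^{-1}(\psi(1)(r\otimes 1))$. An idempotent $\iota\in R$ is symmetric if there are $u\in\iota R\iota^J$, $v\in\iota^JR\iota$ with $uv=\iota$, $vu=\iota^J$. **Representations.** A finite representation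 $\rho=(V,\rho_M,\rho_\Phi,\beta)$ consists of a finite left $R$-module $V$, an additive map $\rho_M$ from $M$ to the biadditive maps $V\times V\to\mathbb Q/\mathbb Z$ with $\rho_M(m(r\otimes s))(x,y)=\rho_M(m)(rx,sy)$ and $\rho_M(\tau(m))(x,y)=\rho_M(m)(y,x)$ such that $\beta=\rho_M(\psi(1))$ is non-singular, and an additive map $\rho_\Phi$ from $\Phi$ to the quadratic maps $V\to\mathbb Q/\mathbb Z$ with $\rho_\Phi(\phi[r])(x)=\rho_\Phi(\phi)(rx)$, $\rho_\Phi(\{\!\{m\}\!\})(x)=\rho_M(m)(x,x)$, $\rho_M(\lambda(\phi))(x,y)=\rho_\Phi(\phi)(x+y)-\rho_\Phi(\phi)(x)-\rho_\Phi(\phi)(y)$. A code of Type $\rho$ is an $R$-submodule $C\le V$ with $C=\{x:\beta(x,c)=0\ \forall c\in C\}$ and $\rho_\Phi(\phi)(C)=0$ for all $\phi\in\Phi$. The conductor $f$ of $\rho$ is the order of the subgroup of $\mathbb Q/\mathbb Z$ generated by all values of $\beta$ and of the $\rho_\Phi(\phi)$. For $\mathbf a=(a_1,\dots,a_N)\in\mathbb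 Z^N$ with all $a_i$ prime to $f$ put $\rho^{\mathbf a}=(V^N,\ a_1\rho_M\perp\dots\perp a_N\rho_M,\ a_1\rho_\Phi\perp\dots\perp a_N\rho_\Phi,\ a_1\beta\perp\dots\perp a_N\beta)$. **Clifford-Weil groups.** $\mathcal C(\rho)$ is the group of linear operators on $\mathbb CV=\bigoplus_{w\in V}\mathbb Cb_w$ generated by $m_r:b_w\mapsto b_{rw}$ ($r\in R^\times$), $d_\phi:b_w\mapsto e^{2\pi i\rho_\Phi(\phi)(w)}b_w$ ($\phi\in\Phi$) and $h_{\iota,u,v}:b_w\mapsto|\iota V|^{-1/2}\sum_{x\in\iota V}e^{2\pi i\beta(x,vw)}b_{x+(1-\iota)w}$ ($\iota=uv$ a symmetric idempotent, $u,v$ as above). The Weight Enumerator Conjecture for $\rho$ says that the fixed space of $\mathcal C(\rho)$ in $\mathbb CV$ is spanned by the full weight enumerators $\sum_{c\in C}b_c$ of the codes $C$ of Type $\rho$. For $m\ge1$, the matrix ring of the form ring is $(\mathrm{Mat}_m(R),\mathrm{Mat}_m(M),\psi,\Phi_m)$ ($\psi$ entrywise, $\tau(X)_{ij}=\tau(X_{ji})$),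 where $\Phi_m$ consists of families of $\phi_i\in\Phi$ ($1\le i\le m$) and $n_{ij}\in M$ ($1\le i<j\le m$), and $R^m\otimes\rho$ is its representation on $V^m$ with $X\in\mathrm{Mat}_m(M)$ acting as $(x,y)\mapsto\sum_{i,j}\rho_M(X_{ij})(x_i,y_j)$ and $(\phi,n)\in\Phi_m$ as $x\mapsto\sum_i\rho_\Phi(\phi_i)(x_i)+\sum_{i<j}\rho_M(n_{ij})(x_i,x_j)$. The genus-$m$ Clifford-Weil group is $\mathcal C_m(\rho)=\mathcal C(R^m\otimes\rho)$. **Galois group and sign condition.** Let $\zeta_f=e^{2\pi i/f}$, $F_1=\mathbb Q(\sqrt{|\iota V|}:\iota\in R\text{ a symmetric idempotent})$, $K=K(\rho)=\mathbb Q(\zeta_f)F_1$, let $F$ be a complement of $F_1\cap\mathbb Q(\zeta_f)$ in $F_1$ (that is, $F\,(F_1\cap\mathbb Q(\zeta_f))=F_1$ and $F\cap\mathbb Q(\zeta_f)=\mathbb Q$), and $\Gamma=\mathrm{Gal}(K/F)$. For $a$ prime to $f$ let $\gamma_a\in\Gamma$ be the element with $\gamma_a(\zeta_f)=\zeta_f^a$,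 and let $\epsilon(\iota,a)\in\{\pm1\}$ be given by $\gamma_a(\sqrt{|\iota V|})=\epsilon(\iota,a)\sqrt{|\iota V|}$. The tuple $\mathbf a$ satisfies the sign condition if $\prod_{i=1}^N\epsilon(\iota,a_i)=1$ for all symmetric idempotents $\iota\in R$. Let $\mathbf d=(d_\alpha)_{\alpha\in\Gamma}$, $d_\alpha=|\{i:\gamma_{a_i}=\alpha\}|$. **Conjugate polynomials.** $K[\mathbf x^{(m)}\circ\Gamma]_{\mathbf d}$ is the $K$-space of functions on $K^{V^m}$ spanned by the monomials $\prod_{\alpha\in\Gamma}\prod_{w\in V^m}(x_w\circ\alpha)^{e_{w\alpha}}$ with $\sum_we_{w\alpha}=d_\alpha$ for all $\alpha$, where $(x_w\circ\alpha)(k)=\alpha(k_w)$. A matrix $g\in\mathcal C_m(\rho)\le\mathrm{GL}_{V^m}(K)$ acts by $(p\cdot g)(k)=p(kg^{-1})$. The genus-$m$ $\Gamma$-conjugate complete weight enumerator of a code $C\le V^N$ is $\mathrm{ccwe}_m(C)=\sum_{c\in C^m}\prod_{i=1}^Nx_{c_i}\circ\gamma_{a_i}$, where $c_i\in V^m$ is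 the $i$-th column of $c\in V^{m\times N}$. **Corollary.** Let $m\ge1$, $N\ge 0$, and let $\mathbf a\in\mathbb Z^N$ with all $a_i$ prime to $f$ satisfy the sign condition. Assume that the Weight Enumerator Conjecture holds for the representation $R^m\otimes\rho^{\mathbf a}$. Then the space of invariants of $\mathcal C_m(\rho)$ in $K[\mathbf x^{(m)}\circ\Gamma]_{\mathbf d}$ is equal to the $K$-span of the genus-$m$ $\Gamma$-conjugate complete weight enumerators $\mathrm{ccwe}_m(C)$ of the codes $C$ of Type $\rho^{\mathbf a}$. -/

import Mathlib

open scoped BigOperators Matrix.Module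

noncomputable section

namespace CliffordWeil

/-- The group `ℚ/ℤ`. -/
abbrev QZ : Type := AddCircle (1 : ℚ)

theorem exp_periodic :
    Function.Periodic (fun q : ℚ => Complex.exp (2 * Real.pi * Complex.I * (q : ℂ))) 1 := by
  intro q
  simp only [Rat.cast_add, Rat.cast_one, mul_add, mul_one]
  exact Complex.exp_periodic _

/-- The map `ℚ/ℤ → ℂ`, `q + ℤ ↦ exp (2 π i q)`. -/
def expQZ : QZ → ℂ := exp_periodic.lift

/-! ### Form rings -/

/-- A form ring `(R, M, ψ, Φ)`.  The right `R ⊗ R`-module structure of `M` is given by the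
biadditive map `act`, where `act r s m` stands for `m (r ⊗ s)`.  The `R`-qmodule structure of `Φ`
is given by `q`, where `q r φ` stands for `φ[r]`.  The maps `quad` and `lam` are
`{{ }} : M → Φ` and `λ : Φ → M`; they are qmodule homomorphisms, where `m[r] = m (r ⊗ r)`.
(That `r ↦ [r]` is a pointed quadratic map follows from `quad_lam`, as
`(r, s) ↦ {{λ(φ)(r ⊗ s)}}` is biadditive.) -/
structure FormRing (R : Type*) (M : Type*) (Φ : Type*)
    [Ring R] [AddCommGroup M] [AddCommGroup Φ] where
  act : R →+ R →+ M →+ M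
  act_one : ∀ m, act 1 1 m = m
  act_mul : ∀ r s r' s' m, act (r * r') (s * s') m = act r' s' (act r s m)
  psi : R ≃+ M
  psi_mul : ∀ r s, psi (r * s) = act 1 s (psi r)
  tau : M →+ M
  tau_tau : ∀ m, tau (tau m) = m
  tau_act : ∀ r s m, act s r (tau m) = tau (act r s m)
  isUnit_eps : IsUnit (psi.symm (tau (psi 1)))
  q : R → Φ →+ Φ
  q_one : ∀ φ, q 1 φ = φ
  q_mul : ∀ r s φ, q (r * s) φ = q s (q r φ)
  quad : M →+ Φ
  lam : Φ →+ M
  quad_act : ∀ r m, quad (act r r m) = q r (quad m)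
  lam_q : ∀ r φ, lam (q r φ) = act r r (lam φ)
  quad_tau : ∀ m, quad (tau m) = quad m
  tau_lam : ∀ φ, tau (lam φ) = lam φ
  lam_quad : ∀ m, lam (quad m) = m + tau m
  quad_lam : ∀ r s φ, quad (act r s (lam φ)) = q (r + s) φ - q r φ - q s φ

variable {R M Φ : Type*} [Ring R] [AddCommGroup M] [AddCommGroup Φ]

/-- The anti-automorphism `J` of `R`, `r^J = ψ⁻¹ (ψ(1) (r ⊗ 1))`. -/
def FormRing.J (𝓡 : FormRing R M Φ) (r : R) : R := 𝓡.psi.symm (𝓡.act r 1 (𝓡.psi 1))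

/-- `ι` is a symmetric idempotent of `R` with `v ∈ ι^J R ι` and `u ∈ ι R ι^J` such that
`u v = ι` and `v u = ι^J`, i.e. left multiplication with `v` is an isomorphism
`ι R ≅ ι^J R` of right modules with inverse given by `u`. -/
structure FormRing.IsSymIdem (𝓡 : FormRing R M Φ) (ι u v : R) : Prop where
  idem : ι * ι = ι
  u_mem : ∃ x, u = ι * x * 𝓡.J ι
  v_mem : ∃ x, v = 𝓡.J ι * x * ι
  u_mul_v : u * v = ι
  v_mul_u : v * u = 𝓡.J ι

/-- `ι` is a symmetric idempotent. -/
def FormRing.IsSymmetricIdempotent (𝓡 : FormRing R M Φ) (ι : R) : Prop :=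
  ∃ u v, 𝓡.IsSymIdem ι u v

/-! ### Finite representations -/

/-- A representation `(V, ρ_M, ρ_Φ, β)` of a form ring; it is called finite if `V` is finite. -/
structure Rep (𝓡 : FormRing R M Φ) (V : Type*) [AddCommGroup V] [Module R V] where
  rhoM : M →+ V →+ V →+ QZ
  rhoM_act : ∀ r s m x y, rhoM (𝓡.act r s m) x y = rhoM m (r • x) (s • y)
  rhoM_tau : ∀ m x y, rhoM (𝓡.tau m) x y = rhoM m y x
  nondeg_left : ∀ x, (∀ y, rhoM (𝓡.psi 1) x y = 0) → x = 0
  nondeg_right : ∀ y, (∀ x, rhoM (𝓡.psi 1) x y = 0) → y = 0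
  rhoPhi : Φ →+ (V → QZ)
  rhoPhi_q : ∀ r φ x, rhoPhi (𝓡.q r φ) x = rhoPhi φ (r • x)
  rhoPhi_quad : ∀ m x, rhoPhi (𝓡.quad m) x = rhoM m x x
  rhoM_lam : ∀ φ x y, rhoM (𝓡.lam φ) x y = rhoPhi φ (x + y) - rhoPhi φ x - rhoPhi φ y

namespace Rep

variable {𝓡 : FormRing R M Φ} {V : Type*} [AddCommGroup V] [Module R V]

/-- The non-singular form `β = ρ_M(ψ(1))`. -/
def beta (ρ : Rep 𝓡 V) : V →+ V →+ QZ := ρ.rhoM (𝓡.psi 1)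

/-- `C` is a code of Type `ρ`: a submodule with `C = C^⊥` on which all `ρ_Φ(φ)` vanish. -/
structure IsCodeOfType (ρ : Rep 𝓡 V) (C : Submodule R V) : Prop where
  selfDual : ∀ x, x ∈ C ↔ ∀ c ∈ C, ρ.beta x c = 0
  isotropic : ∀ φ, ∀ c ∈ C, ρ.rhoPhi φ c = 0

/-- The value group `ν(ρ) ≤ ℚ/ℤ`. -/
def valueGroup (ρ : Rep 𝓡 V) : AddSubgroup QZ :=
  AddSubgroup.closure ({z | ∃ x y, z = ρ.beta x y} ∪ {z | ∃ φ x, z = ρ.rhoPhi φ x})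

/-- The conductor `f(ρ) = |ν(ρ)|`. -/
def conductor (ρ : Rep 𝓡 V) : ℕ := Nat.card ρ.valueGroup

theorem eq_zero_of_coprime (ρ : Rep 𝓡 V) {a : ℤ} (ha : IsCoprime a (ρ.conductor : ℤ))
    {x y : V} (h : a • ρ.beta x y = 0) : ρ.beta x y = 0 := by
  obtain ⟨u, w, huw⟩ := ha
  have hm : ρ.beta x y ∈ ρ.valueGroup := AddSubgroup.subset_closure (Or.inl ⟨x, y, rfl⟩)
  have hf : (ρ.conductor : ℤ) • ρ.beta x y = 0 := by
    have := card_nsmul_eq_zero' (x := (⟨_, hm⟩ : ρ.valueGroup))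
    rw [natCast_zsmul]
    exact congrArg Subtype.val this
  rw [← one_zsmul (ρ.beta x y), ← huw, add_zsmul, mul_zsmul, mul_zsmul, h, hf]
  simp

/-- The representation `ρ^𝐚 = (V^N, a₁ρ_M ⊥ … ⊥ a_Nρ_M, a₁ρ_Φ ⊥ … ⊥ a_Nρ_Φ)` for integers
`a₁, …, a_N` prime to the conductor. -/
def twist (ρ : Rep 𝓡 V) {N : ℕ} (a : Fin N → ℤ)
    (ha : ∀ i, IsCoprime (a i) (ρ.conductor : ℤ)) : Rep 𝓡 (Fin N → V) where
  rhoM := AddMonoidHom.mk' (fun m => AddMonoidHom.mk' (fun x => AddMonoidHom.mk'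
      (fun y => ∑ i, a i • ρ.rhoM m (x i) (y i))
      (fun _ _ => by simp [Finset.sum_add_distrib]))
      (fun _ _ => by ext; simp [Finset.sum_add_distrib]))
      (fun _ _ => by ext; simp [Finset.sum_add_distrib])
  rhoM_act r s m x y := by simp [ρ.rhoM_act]
  rhoM_tau m x y := by simp [ρ.rhoM_tau]
  nondeg_left x h := by
    funext i
    refine ρ.nondeg_left _ fun y => ρ.eq_zero_of_coprime (ha i) ?_
    have := h (Pi.single i y)
    simp only [AddMonoidHom.mk'_apply] at this
    rw [Finset.sum_eq_single i (fun j _ hj => by simp [Pi.single_eq_of_ne hj]) (by simp)] at this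
    simpa [beta] using this
  nondeg_right y h := by
    funext i
    refine ρ.nondeg_right _ fun x => ρ.eq_zero_of_coprime (ha i) ?_
    have := h (Pi.single i x)
    simp only [AddMonoidHom.mk'_apply] at this
    rw [Finset.sum_eq_single i (fun j _ hj => by simp [Pi.single_eq_of_ne hj]) (by simp)] at this
    simpa [beta] using this
  rhoPhi := AddMonoidHom.mk' (fun φ x => ∑ i, a i • ρ.rhoPhi φ (x i))
      (fun _ _ => by ext; simp [Finset.sum_add_distrib])
  rhoPhi_q r φ x := by simp [ρ.rhoPhi_q]
  rhoPhi_quad m x := by simp [ρ.rhoPhi_quad]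
  rhoM_lam φ x y := by simp [ρ.rhoM_lam, smul_sub, Finset.sum_sub_distrib]

end Rep

/-! ### Matrix rings of form rings -/

/-- A map with biadditive polarisation, evaluated at a sum. -/
theorem quadratic_sum {X A : Type*} [AddCommGroup X] [AddCommGroup A] (Q : X → A)
    (B : X →+ X →+ A) (h : ∀ x y, Q (x + y) = Q x + Q y + B x y) {n : ℕ} (x : Fin n → X) :
    Q (∑ j, x j) = ∑ j, Q (x j) + ∑ j, ∑ k, if j < k then B (x j) (x k) else 0 := by
  have h0 : Q 0 = 0 := by simpa using h 0 0
  induction n with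
  | zero => simp [h0]
  | succ n ih =>
    rw [Fin.sum_univ_castSucc, h, ih, Fin.sum_univ_castSucc (fun j => Q (x j)),
      Fin.sum_univ_castSucc (fun j => ∑ k, if j < k then B (x j) (x k) else 0)]
    have h1 : ∑ k, (if Fin.last n < k then B (x (Fin.last n)) (x k) else 0) = 0 :=
      Finset.sum_eq_zero fun k _ => by simp [not_lt.2 (Fin.le_last k)]
    rw [h1]
    simp only [Fin.sum_univ_castSucc, Finset.sum_add_distrib, Fin.castSucc_lt_castSucc_iff,
      Fin.castSucc_lt_last, if_true, map_sum, AddMonoidHom.finsetSum_apply]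
    abel

namespace FormRing

variable (𝓡 : FormRing R M Φ) (m : ℕ)

/-- The action of `Mat_m(R) ⊗ Mat_m(R)` on `Mat_m(M)`:
`(X (A ⊗ B))_{kl} = ∑_{i,j} X_{ij} (A_{ik} ⊗ B_{jl})`. -/
def matAct : Matrix (Fin m) (Fin m) R →+ Matrix (Fin m) (Fin m) R →+
    Matrix (Fin m) (Fin m) M →+ Matrix (Fin m) (Fin m) M :=
  AddMonoidHom.mk' (fun A => AddMonoidHom.mk' (fun B => AddMonoidHom.mk'
    (fun X => Matrix.of fun k l => ∑ i, ∑ j, 𝓡.act (A i k) (B j l) (X i j))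
    (fun _ _ => by ext; simp [Finset.sum_add_distrib]))
    (fun _ _ => by ext; simp [Finset.sum_add_distrib]))
    (fun _ _ => by ext; simp [Finset.sum_add_distrib])

theorem matAct_apply (A B : Matrix (Fin m) (Fin m) R) (X : Matrix (Fin m) (Fin m) M)
    (k l : Fin m) :
    𝓡.matAct m A B X k l = ∑ i, ∑ j, 𝓡.act (A i k) (B j l) (X i j) := rfl

/-- The group `Φ_m` belonging to `Mat_m(R)`.  An element consists of diagonal entries
`φ_i ∈ Φ` and off-diagonal entries `n_{ij} ∈ M` with `n_{ji} = τ(n_{ij})`; the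
diagonal of the matrix `n` is `n_{ii} = λ(φ_i)`. -/
def matPhi : AddSubgroup ((Fin m → Φ) × Matrix (Fin m) (Fin m) M) where
  carrier := {p | (∀ i, p.2 i i = 𝓡.lam (p.1 i)) ∧ ∀ i j, p.2 j i = 𝓡.tau (p.2 i j)}
  add_mem' hp hq := ⟨fun i => by simp [hp.1 i, hq.1 i],
    fun i j => by simp [hp.2 i j, hq.2 i j]⟩
  zero_mem' := ⟨fun i => by simp, fun i j => by simp⟩
  neg_mem' hp := ⟨fun i => by simp [hp.1 i], fun i j => by simp [hp.2 i j]⟩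

variable {m}

/-- `∑ᵢ φ_i[x_i] + ∑_{i<k} {{n_{ik} (x_i ⊗ x_k)}}`. -/
def qVec (p : 𝓡.matPhi m) (x : Fin m → R) : Φ :=
  ∑ i, 𝓡.q (x i) (p.1.1 i) +
    ∑ i, ∑ k, if i < k then 𝓡.quad (𝓡.act (x i) (x k) (p.1.2 i k)) else 0

/-- `n(x ⊗ y) = ∑_{i,k} n_{ik} (x_i ⊗ y_k)`. -/
def bVec (p : 𝓡.matPhi m) : (Fin m → R) →+ (Fin m → R) →+ M :=
  AddMonoidHom.mk' (fun x => AddMonoidHom.mk'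
    (fun y => ∑ i, ∑ k, 𝓡.act (x i) (y k) (p.1.2 i k))
    (fun _ _ => by simp [Finset.sum_add_distrib]))
    (fun _ _ => by ext; simp [Finset.sum_add_distrib])

theorem bVec_apply (p : 𝓡.matPhi m) (x y : Fin m → R) :
    𝓡.bVec p x y = ∑ i, ∑ k, 𝓡.act (x i) (y k) (p.1.2 i k) := rfl

theorem sum_split {A : Type*} [AddCommGroup A] (g : Fin m → Fin m → A) :
    ∑ i, ∑ k, g i k = ∑ i, g i i + ∑ i, ∑ k, if i < k then g i k + g k i else 0 := by
  have h1 : ∀ i k, g i k = (if i = k then g i i else 0) + ((if i < k then g i k else 0) +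
      (if k < i then g i k else 0)) := by
    intro i k
    rcases lt_trichotomy i k with h | h | h
    · simp [h, h.ne, h.not_gt]
    · subst h; simp
    · simp [h, h.ne', h.not_gt]
  have h2 : ∀ i k, (if i < k then g i k + g k i else 0) =
      (if i < k then g i k else 0) + (if i < k then g k i else 0) := by
    intro i k; split_ifs <;> simp
  calc ∑ i, ∑ k, g i k = ∑ i, ∑ k, ((if i = k then g i i else 0) +
        ((if i < k then g i k else 0) + (if k < i then g i k else 0))) :=
        Finset.sum_congr rfl fun i _ => Finset.sum_congr rfl fun k _ => h1 i k
    _ = _ := by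
      simp only [h2, Finset.sum_add_distrib, Finset.sum_ite_eq, Finset.mem_univ, if_true]
      rw [Finset.sum_comm (f := fun i k => if k < i then g i k else 0)]

theorem qVec_add (p : 𝓡.matPhi m) (x y : Fin m → R) :
    𝓡.qVec p (x + y) = 𝓡.qVec p x + 𝓡.qVec p y + 𝓡.quad (𝓡.bVec p x y) := by
  have hd : ∀ i, 𝓡.q (x i + y i) (p.1.1 i) = 𝓡.q (x i) (p.1.1 i) + 𝓡.q (y i) (p.1.1 i) +
      𝓡.quad (𝓡.act (x i) (y i) (p.1.2 i i)) := by
    intro i; rw [p.2.1 i, 𝓡.quad_lam]; abel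
  have ho : ∀ i k, 𝓡.quad (𝓡.act (x i + y i) (x k + y k) (p.1.2 i k)) =
      𝓡.quad (𝓡.act (x i) (x k) (p.1.2 i k)) + 𝓡.quad (𝓡.act (y i) (y k) (p.1.2 i k)) +
      (𝓡.quad (𝓡.act (x i) (y k) (p.1.2 i k)) + 𝓡.quad (𝓡.act (x k) (y i) (p.1.2 k i))) := by
    intro i k
    rw [p.2.2 i k, 𝓡.tau_act, 𝓡.quad_tau]
    simp only [map_add, AddMonoidHom.add_apply]
    abel
  rw [bVec_apply]
  simp only [map_sum]
  rw [sum_split (fun i k => 𝓡.quad (𝓡.act (x i) (y k) (p.1.2 i k)))]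
  simp only [qVec, Pi.add_apply, hd, ho, Finset.sum_add_distrib]
  have h3 : ∀ i k (a b c : Φ), (if i < k then a + b + c else 0 : Φ) = (if i < k then a else 0) +
      (if i < k then b else 0) + (if (i : Fin m) < k then c else 0) := by
    intro i k a b c; split_ifs <;> simp
  simp only [h3, Finset.sum_add_distrib]
  abel

theorem qVec_smul (p : 𝓡.matPhi m) (x : Fin m → R) (b : R) :
    𝓡.qVec p (fun i => x i * b) = 𝓡.q b (𝓡.qVec p x) := by
  simp only [qVec, map_add, map_sum, 𝓡.q_mul, 𝓡.act_mul, 𝓡.quad_act]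
  simp only [apply_ite (𝓡.q b), map_zero]

theorem bVec_smul (p : 𝓡.matPhi m) (x y : Fin m → R) (b c : R) :
    𝓡.bVec p (fun i => x i * b) (fun i => y i * c) = 𝓡.act b c (𝓡.bVec p x y) := by
  simp only [bVec_apply, map_sum, 𝓡.act_mul]

theorem tau_bVec (p : 𝓡.matPhi m) (x y : Fin m → R) :
    𝓡.tau (𝓡.bVec p x y) = 𝓡.bVec p y x := by
  simp only [bVec_apply, map_sum]
  rw [Finset.sum_comm]
  refine Finset.sum_congr rfl fun i _ => Finset.sum_congr rfl fun k _ => ?_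
  rw [p.2.2 k i, 𝓡.tau_act]

theorem lam_qVec (p : 𝓡.matPhi m) (x : Fin m → R) :
    𝓡.lam (𝓡.qVec p x) = 𝓡.bVec p x x := by
  rw [bVec_apply, sum_split]
  simp only [qVec, map_add, map_sum, apply_ite 𝓡.lam, map_zero, 𝓡.lam_q, 𝓡.lam_quad]
  congr 1
  · exact Finset.sum_congr rfl fun i _ => by rw [p.2.1 i]
  · refine Finset.sum_congr rfl fun i _ => Finset.sum_congr rfl fun k _ => ?_
    rw [p.2.2 i k, 𝓡.tau_act]

/-- `(φ, n)[A]`: the diagonal entries are `∑ᵢ φ_i[a_{ij}] + ∑_{i<k} {{n_{ik}(a_{ij} ⊗ a_{kj})}}`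
and the matrix is `n (A ⊗ A)`. -/
def matQ (A : Matrix (Fin m) (Fin m) R) : 𝓡.matPhi m →+ 𝓡.matPhi m :=
  AddMonoidHom.mk' (fun p => ⟨(fun j => 𝓡.qVec p (fun i => A i j), 𝓡.matAct m A A p.1.2),
    fun j => (𝓡.lam_qVec p (fun i => A i j)).symm,
    fun j l => (𝓡.tau_bVec p (fun i => A i j) (fun i => A i l)).symm⟩)
    (fun p p' => by
      have h : ∀ i k (a b : Φ), (if i < k then a + b else 0 : Φ) =
          (if i < k then a else 0) + (if (i : Fin m) < k then b else 0) := by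
        intro i k a b; split_ifs <;> simp
      refine Subtype.ext (Prod.ext (funext fun j => ?_) ?_)
      · simp only [qVec, AddSubgroup.coe_add, Prod.fst_add, Prod.snd_add, Pi.add_apply,
          Matrix.add_apply, map_add, h, Finset.sum_add_distrib]
        abel
      · simp)

theorem matQ_fst (A : Matrix (Fin m) (Fin m) R) (p : 𝓡.matPhi m) (j : Fin m) :
    (𝓡.matQ A p).1.1 j = 𝓡.qVec p (fun i => A i j) := rfl

theorem matQ_snd (A : Matrix (Fin m) (Fin m) R) (p : 𝓡.matPhi m) :
    (𝓡.matQ A p).1.2 = 𝓡.matAct m A A p.1.2 := rfl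

theorem matQ_mul (A B : Matrix (Fin m) (Fin m) R) (p : 𝓡.matPhi m) :
    𝓡.matQ (A * B) p = 𝓡.matQ B (𝓡.matQ A p) := by
  have hcol : ∀ l, (fun i => (A * B) i l) = ∑ j, (fun i => A i j * B j l) := by
    intro l; funext i; simp [Matrix.mul_apply]
  refine Subtype.ext (Prod.ext (funext fun l => ?_) (Matrix.ext fun k l => ?_))
  · rw [matQ_fst, matQ_fst, hcol]
    rw [quadratic_sum (𝓡.qVec p) ((AddMonoidHom.compHom 𝓡.quad).comp (𝓡.bVec p))
      (fun x y => 𝓡.qVec_add p x y)]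
    simp only [AddMonoidHom.comp_apply, AddMonoidHom.compHom_apply_apply, qVec_smul, bVec_smul]
    rfl
  · change 𝓡.bVec p (fun i => (A * B) i k) (fun i => (A * B) i l) =
      ∑ i, ∑ j, 𝓡.act (B i k) (B j l) (𝓡.bVec p (fun i' => A i' i) (fun i' => A i' j))
    simp only [hcol, map_sum, AddMonoidHom.finsetSum_apply, bVec_smul]
    rw [Finset.sum_comm]

theorem matQ_one (p : 𝓡.matPhi m) : 𝓡.matQ 1 p = p := by
  have hz : ∀ (i k j : Fin m), i < k →
      𝓡.act ((1 : Matrix (Fin m) (Fin m) R) i j) ((1 : Matrix (Fin m) (Fin m) R) k j)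
        (p.1.2 i k) = 0 := by
    intro i k j h
    rcases eq_or_ne i j with rfl | hij
    · simp [Matrix.one_apply_ne h.ne']
    · simp [Matrix.one_apply_ne hij]
  have hq0 : ∀ φ, 𝓡.q 0 φ = 0 := by
    intro φ
    have := 𝓡.quad_lam 0 0 φ
    simpa using this.symm
  refine Subtype.ext (Prod.ext (funext fun j => ?_) (Matrix.ext fun k l => ?_))
  · rw [matQ_fst, qVec]
    have h2 : ∑ i, ∑ k, (if i < k then
        𝓡.quad (𝓡.act ((1 : Matrix (Fin m) (Fin m) R) i j) ((1 : Matrix (Fin m) (Fin m) R) k j)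
          (p.1.2 i k)) else 0) = 0 :=
      Finset.sum_eq_zero fun i _ => Finset.sum_eq_zero fun k _ => by
        split_ifs with h
        · rw [hz i k j h, map_zero]
        · rfl
    rw [h2, add_zero, Finset.sum_eq_single j]
    · rw [Matrix.one_apply_eq, 𝓡.q_one]
    · intro i _ hi; rw [Matrix.one_apply_ne hi, hq0]
    · simp
  · rw [matQ_snd, matAct_apply, Finset.sum_eq_single k, Finset.sum_eq_single l]
    · rw [Matrix.one_apply_eq, Matrix.one_apply_eq, 𝓡.act_one]
    · intro i _ hi; simp [Matrix.one_apply_ne hi]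
    · simp
    · intro i _ hi; simp [Matrix.one_apply_ne hi]
    · simp

variable (m)

/-- `τ` on `Mat_m(M)`: `τ(X)_{ij} = τ(X_{ji})`. -/
def matTau : Matrix (Fin m) (Fin m) M →+ Matrix (Fin m) (Fin m) M :=
  AddMonoidHom.mk' (fun X => Matrix.of fun i j => 𝓡.tau (X j i)) (fun _ _ => by ext; simp)

theorem matTau_apply (X : Matrix (Fin m) (Fin m) M) (i j : Fin m) :
    𝓡.matTau m X i j = 𝓡.tau (X j i) := rfl

/-- `{{X}}` for `X ∈ Mat_m(M)`: diagonal entries `{{X_{ii}}}` and matrix `X + τ(X)`. -/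
def matQuad : Matrix (Fin m) (Fin m) M →+ 𝓡.matPhi m :=
  AddMonoidHom.mk' (fun X => ⟨(fun i => 𝓡.quad (X i i), X + 𝓡.matTau m X),
    fun i => by simp [matTau_apply, 𝓡.lam_quad],
    fun i j => by simp [matTau_apply, 𝓡.tau_tau, add_comm]⟩)
    (fun X Y => by
      refine Subtype.ext (Prod.ext (funext fun j => ?_) ?_)
      · simp
      · simp only [AddSubgroup.coe_add, Prod.snd_add, map_add]; abel)

/-- The inclusion of `Mat_m(R)` into `Mat_m(M)` by `ψ` in each entry. -/
def matPsi : Matrix (Fin m) (Fin m) R ≃+ Matrix (Fin m) (Fin m) M := 𝓡.psi.mapMatrix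

theorem matPsi_apply (A : Matrix (Fin m) (Fin m) R) (i j : Fin m) :
    𝓡.matPsi m A i j = 𝓡.psi (A i j) := rfl

theorem matTau_matAct (A B : Matrix (Fin m) (Fin m) R) (X : Matrix (Fin m) (Fin m) M) :
    𝓡.matAct m B A (𝓡.matTau m X) = 𝓡.matTau m (𝓡.matAct m A B X) := by
  ext k l
  simp only [matAct_apply, matTau_apply, map_sum, 𝓡.tau_act]
  rw [Finset.sum_comm]

/-- The matrix ring `Mat_m(R, Φ)` of a form ring. -/
def matrix : FormRing (Matrix (Fin m) (Fin m) R) (Matrix (Fin m) (Fin m) M) (𝓡.matPhi m) where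
  act := 𝓡.matAct m
  act_one X := by
    ext k l
    rw [matAct_apply, Finset.sum_eq_single k, Finset.sum_eq_single l]
    · rw [Matrix.one_apply_eq, Matrix.one_apply_eq, 𝓡.act_one]
    · intro i _ hi; simp [Matrix.one_apply_ne hi]
    · simp
    · intro i _ hi; simp [Matrix.one_apply_ne hi]
    · simp
  act_mul A B A' B' X := by
    ext k l
    simp only [matAct_apply, Matrix.mul_apply, map_sum, AddMonoidHom.finsetSum_apply, 𝓡.act_mul]
    calc ∑ i, ∑ j, ∑ t, ∑ s, 𝓡.act (A' s k) (B' t l) (𝓡.act (A i s) (B j t) (X i j))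
        = ∑ i, ∑ j, ∑ s, ∑ t, 𝓡.act (A' s k) (B' t l) (𝓡.act (A i s) (B j t) (X i j)) :=
          Finset.sum_congr rfl fun i _ => Finset.sum_congr rfl fun j _ => Finset.sum_comm
      _ = ∑ i, ∑ s, ∑ j, ∑ t, 𝓡.act (A' s k) (B' t l) (𝓡.act (A i s) (B j t) (X i j)) :=
          Finset.sum_congr rfl fun i _ => Finset.sum_comm
      _ = ∑ s, ∑ i, ∑ t, ∑ j, 𝓡.act (A' s k) (B' t l) (𝓡.act (A i s) (B j t) (X i j)) := by
          rw [Finset.sum_comm]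
          exact Finset.sum_congr rfl fun i _ => Finset.sum_congr rfl fun j _ => Finset.sum_comm
      _ = _ := Finset.sum_congr rfl fun i _ => Finset.sum_comm
  psi := 𝓡.matPsi m
  psi_mul A B := by
    ext k l
    rw [matAct_apply, Finset.sum_eq_single k]
    · simp [matPsi_apply, Matrix.mul_apply, 𝓡.psi_mul, Matrix.one_apply_eq]
    · intro i _ hi; simp [Matrix.one_apply_ne hi]
    · simp
  tau := 𝓡.matTau m
  tau_tau X := by ext i j; simp [matTau_apply, 𝓡.tau_tau]
  tau_act A B X := 𝓡.matTau_matAct m A B X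
  isUnit_eps := by
    have h : (𝓡.matPsi m).symm (𝓡.matTau m (𝓡.matPsi m 1)) =
        Matrix.scalar (Fin m) (𝓡.psi.symm (𝓡.tau (𝓡.psi 1))) := by
      rw [AddEquiv.symm_apply_eq]
      ext i j
      rcases eq_or_ne i j with rfl | h
      · simp [matTau_apply, matPsi_apply]
      · simp [matTau_apply, matPsi_apply, Matrix.one_apply_ne h.symm, Matrix.diagonal_apply_ne _ h]
    rw [h]
    exact 𝓡.isUnit_eps.map (Matrix.scalar (Fin m))
  q := 𝓡.matQ
  q_one p := 𝓡.matQ_one p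
  q_mul A B p := 𝓡.matQ_mul A B p
  quad := 𝓡.matQuad m
  lam := (AddMonoidHom.snd _ _).comp (𝓡.matPhi m).subtype
  quad_act A X := by
    refine Subtype.ext (Prod.ext (funext fun j => ?_) ?_)
    · change 𝓡.quad (∑ i, ∑ k, 𝓡.act (A i j) (A k j) (X i k)) =
        ∑ i, 𝓡.q (A i j) (𝓡.quad (X i i)) + ∑ i, ∑ k, if i < k then
          𝓡.quad (𝓡.act (A i j) (A k j) (X i k + 𝓡.tau (X k i))) else 0
      rw [sum_split]
      simp only [map_add, map_sum, apply_ite 𝓡.quad, map_zero, 𝓡.quad_act, 𝓡.tau_act, 𝓡.quad_tau]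
    · change 𝓡.matAct m A A X + 𝓡.matTau m (𝓡.matAct m A A X) =
        𝓡.matAct m A A (X + 𝓡.matTau m X)
      rw [map_add, matTau_matAct]
  lam_q A p := rfl
  quad_tau X := by
    refine Subtype.ext (Prod.ext (funext fun j => ?_) (Matrix.ext fun k l => ?_))
    · change 𝓡.quad (𝓡.tau (X j j)) = 𝓡.quad (X j j)
      rw [𝓡.quad_tau]
    · change 𝓡.tau (X l k) + 𝓡.tau (𝓡.tau (X k l)) = X k l + 𝓡.tau (X l k)
      rw [𝓡.tau_tau, add_comm]
  tau_lam p := Matrix.ext fun k l => (p.2.2 l k).symm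
  lam_quad X := rfl
  quad_lam A B p := by
    refine Subtype.ext (Prod.ext (funext fun j => ?_) (Matrix.ext fun k l => ?_))
    · change 𝓡.quad (𝓡.bVec p (fun i => A i j) (fun i => B i j)) =
        𝓡.qVec p ((fun i => A i j) + fun i => B i j) - 𝓡.qVec p (fun i => A i j) -
          𝓡.qVec p (fun i => B i j)
      rw [qVec_add]; abel
    · change 𝓡.bVec p (fun i => A i k) (fun i => B i l) +
          𝓡.tau (𝓡.bVec p (fun i => A i l) (fun i => B i k)) =
        𝓡.bVec p ((fun i => A i k) + fun i => B i k) ((fun i => A i l) + fun i => B i l) -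
          𝓡.bVec p (fun i => A i k) (fun i => A i l) - 𝓡.bVec p (fun i => B i k) (fun i => B i l)
      rw [tau_bVec]
      simp only [map_add, AddMonoidHom.add_apply]
      abel

end FormRing

namespace Rep

variable {𝓡 : FormRing R M Φ} {V : Type*} [AddCommGroup V] [Module R V] {m : ℕ}

/-- `(φ, n) ∈ Φ_m` as a quadratic map: `v ↦ ∑ᵢ φ_i(v_i) + ∑_{i<k} n_{ik}(v_i, v_k)`. -/
def qVec (ρ : Rep 𝓡 V) (p : 𝓡.matPhi m) (v : Fin m → V) : QZ :=
  ∑ i, ρ.rhoPhi (p.1.1 i) (v i) +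
    ∑ i, ∑ k, if i < k then ρ.rhoM (p.1.2 i k) (v i) (v k) else 0

/-- `X ∈ Mat_m(M)` as a biadditive map: `(x, y) ↦ ∑_{i,k} X_{ik}(x_i, y_k)`. -/
def matRhoM (ρ : Rep 𝓡 V) (m : ℕ) :
    Matrix (Fin m) (Fin m) M →+ (Fin m → V) →+ (Fin m → V) →+ QZ :=
  AddMonoidHom.mk' (fun X => AddMonoidHom.mk' (fun x => AddMonoidHom.mk'
    (fun y => ∑ i, ∑ k, ρ.rhoM (X i k) (x i) (y k))
    (fun _ _ => by simp [Finset.sum_add_distrib]))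
    (fun _ _ => by ext; simp [Finset.sum_add_distrib]))
    (fun _ _ => by ext; simp [Finset.sum_add_distrib])

theorem matRhoM_apply (ρ : Rep 𝓡 V) (X : Matrix (Fin m) (Fin m) M) (x y : Fin m → V) :
    ρ.matRhoM m X x y = ∑ i, ∑ k, ρ.rhoM (X i k) (x i) (y k) := rfl

theorem qVec_add (ρ : Rep 𝓡 V) (p : 𝓡.matPhi m) (x y : Fin m → V) :
    ρ.qVec p (x + y) = ρ.qVec p x + ρ.qVec p y + ρ.matRhoM m p.1.2 x y := by
  have hd : ∀ i, ρ.rhoPhi (p.1.1 i) (x i + y i) = ρ.rhoPhi (p.1.1 i) (x i) +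
      ρ.rhoPhi (p.1.1 i) (y i) + ρ.rhoM (p.1.2 i i) (x i) (y i) := by
    intro i; rw [p.2.1 i, ρ.rhoM_lam]; abel
  have ho : ∀ i k, ρ.rhoM (p.1.2 i k) (x i + y i) (x k + y k) =
      ρ.rhoM (p.1.2 i k) (x i) (x k) + ρ.rhoM (p.1.2 i k) (y i) (y k) +
      (ρ.rhoM (p.1.2 i k) (x i) (y k) + ρ.rhoM (p.1.2 k i) (x k) (y i)) := by
    intro i k
    rw [p.2.2 i k, ρ.rhoM_tau]
    simp only [map_add, AddMonoidHom.add_apply]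
    abel
  rw [matRhoM_apply, FormRing.sum_split (fun i k => ρ.rhoM (p.1.2 i k) (x i) (y k))]
  simp only [qVec, Pi.add_apply, hd, ho, Finset.sum_add_distrib]
  have h3 : ∀ i k (a b c : QZ), (if i < k then a + b + c else 0 : QZ) =
      (if i < k then a else 0) + (if i < k then b else 0) +
        (if (i : Fin m) < k then c else 0) := by
    intro i k a b c; split_ifs <;> simp
  simp only [h3, Finset.sum_add_distrib]
  abel

theorem rhoPhi_qVec (ρ : Rep 𝓡 V) (p : 𝓡.matPhi m) (x : Fin m → R) (v : V) :
    ρ.rhoPhi (𝓡.qVec p x) v = ρ.qVec p (fun i => x i • v) := by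
  have h : ∀ (P : Prop) [Decidable P] (φ : Φ), ρ.rhoPhi (if P then φ else 0) v =
      if P then ρ.rhoPhi φ v else 0 := by
    intro P _ φ; split_ifs <;> simp
  simp only [qVec, FormRing.qVec, map_add, map_sum, Pi.add_apply, Finset.sum_apply, h,
    ρ.rhoPhi_q, ρ.rhoPhi_quad, ρ.rhoM_act]

theorem matRhoM_psi_one (ρ : Rep 𝓡 V) (x y : Fin m → V) :
    ρ.matRhoM m (𝓡.matPsi m 1) x y = ∑ i, ρ.rhoM (𝓡.psi 1) (x i) (y i) := by
  rw [matRhoM_apply]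
  refine Finset.sum_congr rfl fun i _ => ?_
  rw [Finset.sum_eq_single i]
  · rw [FormRing.matPsi_apply, Matrix.one_apply_eq]
  · intro k _ hk; simp [FormRing.matPsi_apply, Matrix.one_apply_ne hk.symm]
  · simp

theorem matRhoM_act (ρ : Rep 𝓡 V) (A B : Matrix (Fin m) (Fin m) R)
    (X : Matrix (Fin m) (Fin m) M) (x y : Fin m → V) :
    ρ.matRhoM m (𝓡.matAct m A B X) x y = ρ.matRhoM m X (A • x) (B • y) := by
  simp only [matRhoM_apply, FormRing.matAct_apply, Matrix.Module.smul_apply, map_sum,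
    AddMonoidHom.finsetSum_apply, ρ.rhoM_act]
  calc ∑ k, ∑ l, ∑ i, ∑ j, ρ.rhoM (X i j) (A i k • x k) (B j l • y l)
      = ∑ k, ∑ i, ∑ l, ∑ j, ρ.rhoM (X i j) (A i k • x k) (B j l • y l) :=
        Finset.sum_congr rfl fun k _ => Finset.sum_comm
    _ = ∑ i, ∑ k, ∑ j, ∑ l, ρ.rhoM (X i j) (A i k • x k) (B j l • y l) := by
        rw [Finset.sum_comm]
        exact Finset.sum_congr rfl fun i _ => Finset.sum_congr rfl fun k _ => Finset.sum_comm
    _ = ∑ i, ∑ j, ∑ k, ∑ l, ρ.rhoM (X i j) (A i k • x k) (B j l • y l) :=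
        Finset.sum_congr rfl fun i _ => Finset.sum_comm
    _ = _ := Finset.sum_congr rfl fun i _ => Finset.sum_congr rfl fun k _ => Finset.sum_comm

/-- The representation `R^m ⊗ ρ` of `Mat_m(R, Φ)` on `V^m`. -/
def matrix (ρ : Rep 𝓡 V) (m : ℕ) : Rep (𝓡.matrix m) (Fin m → V) where
  rhoM := ρ.matRhoM m
  rhoM_act A B X x y := ρ.matRhoM_act A B X x y
  rhoM_tau X x y := by
    change ρ.matRhoM m (𝓡.matTau m X) x y = _
    simp only [matRhoM_apply, FormRing.matTau_apply, ρ.rhoM_tau]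
    rw [Finset.sum_comm]
  nondeg_left x h := by
    funext i
    refine ρ.nondeg_left _ fun y => ?_
    have := h (Pi.single i y)
    change ρ.matRhoM m (𝓡.matPsi m 1) _ _ = 0 at this
    rw [matRhoM_psi_one,
      Finset.sum_eq_single i (fun j _ hj => by simp [Pi.single_eq_of_ne hj]) (by simp)] at this
    simpa using this
  nondeg_right y h := by
    funext i
    refine ρ.nondeg_right _ fun x => ?_
    have := h (Pi.single i x)
    change ρ.matRhoM m (𝓡.matPsi m 1) _ _ = 0 at this
    rw [matRhoM_psi_one,
      Finset.sum_eq_single i (fun j _ hj => by simp [Pi.single_eq_of_ne hj]) (by simp)] at this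
    simpa using this
  rhoPhi := AddMonoidHom.mk' (fun p v => ρ.qVec p v) (fun p p' => by
    have h : ∀ i k (a b : QZ), (if i < k then a + b else 0 : QZ) =
        (if i < k then a else 0) + (if (i : Fin m) < k then b else 0) := by
      intro i k a b; split_ifs <;> simp
    funext v
    simp only [qVec, AddSubgroup.coe_add, Prod.fst_add, Prod.snd_add, Pi.add_apply,
      Matrix.add_apply, map_add, AddMonoidHom.add_apply, h, Finset.sum_add_distrib]
    abel)
  rhoPhi_q A p v := by
    change ρ.qVec (𝓡.matQ A p) v = ρ.qVec p (A • v)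
    have hcol : A • v = ∑ j, (fun i => A i j • v j) := by
      funext i; simp [Matrix.Module.smul_apply]
    rw [hcol, quadratic_sum (ρ.qVec p) (ρ.matRhoM m p.1.2) (fun x y => ρ.qVec_add p x y), qVec]
    simp only [FormRing.matQ_fst, rhoPhi_qVec]
    congr 1
    refine Finset.sum_congr rfl fun j _ => Finset.sum_congr rfl fun k _ => ?_
    split_ifs
    · rw [FormRing.matQ_snd, FormRing.matAct_apply, matRhoM_apply]
      simp only [map_sum, AddMonoidHom.finsetSum_apply, ρ.rhoM_act]
    · rfl
  rhoPhi_quad X v := by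
    change ∑ i, ρ.rhoPhi (𝓡.quad (X i i)) (v i) + ∑ i, ∑ k, (if i < k then
      ρ.rhoM (X i k + 𝓡.tau (X k i)) (v i) (v k) else 0) = _
    rw [matRhoM_apply, FormRing.sum_split (fun i k => ρ.rhoM (X i k) (v i) (v k))]
    simp only [ρ.rhoPhi_quad, map_add, AddMonoidHom.add_apply, ρ.rhoM_tau]
  rhoM_lam p x y := by
    change ρ.matRhoM m p.1.2 x y = ρ.qVec p (x + y) - ρ.qVec p x - ρ.qVec p y
    rw [qVec_add]; abel

/-! ### Clifford-Weil groups and full weight enumerators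

The group algebra `ℂV` is `V → ℂ`, with basis `b_w = Pi.single w 1`, and a linear operator `g` on
`ℂV` is the matrix with `g b_w = ∑_y g_{yw} b_y`. -/

section Group

variable [Fintype V] [DecidableEq V]

/-- The set `ιV`. -/
def idemImage (_ : Rep 𝓡 V) (ι : R) : Finset V := Finset.univ.image fun x : V => ι • x

/-- `m_r : b_w ↦ b_{rw}`. -/
def opM (_ : Rep 𝓡 V) (r : Rˣ) : Matrix V V ℂ :=
  Matrix.of fun y w => if y = (r : R) • w then 1 else 0

/-- `d_φ : b_w ↦ exp (2 π i ρ_Φ(φ)(w)) b_w`. -/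
def opD (ρ : Rep 𝓡 V) (φ : Φ) : Matrix V V ℂ :=
  Matrix.diagonal fun w => expQZ (ρ.rhoPhi φ w)

/-- `h_{ι,u,v} : b_w ↦ |ιV|^{-1/2} ∑_{x ∈ ιV} exp (2 π i β(x, v w)) b_{x + (1 - ι) w}`
(the operator depends on `u` only through the condition that `ι = u v`). -/
def opH (ρ : Rep 𝓡 V) (ι v : R) : Matrix V V ℂ :=
  Matrix.of fun y w => ((Real.sqrt (ρ.idemImage ι).card : ℝ) : ℂ)⁻¹ *
    ∑ x ∈ ρ.idemImage ι, if y = x + (1 - ι) • w then expQZ (ρ.beta x (v • w)) else 0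

/-- The Clifford-Weil group `𝒞(ρ)`.  All symmetric idempotents `ι` with all choices of
`u, v` are used; this gives the same group as one choice of `u, v` for one representative `ι` of
each `Rˣ`-conjugacy class, as the other operators `h` differ by operators `m_r`. -/
def cliffordWeil (ρ : Rep 𝓡 V) : Subgroup (GL V ℂ) :=
  Subgroup.closure {g | (∃ r, (g : Matrix V V ℂ) = ρ.opM r) ∨
    (∃ φ, (g : Matrix V V ℂ) = ρ.opD φ) ∨
    ∃ ι u v, 𝓡.IsSymIdem ι u v ∧ (g : Matrix V V ℂ) = ρ.opH ι v}

/-- The Clifford-Weil group as a group of matrices over a subfield `K` of `ℂ` (containing the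
entries of its elements). -/
def cliffordWeilOver (ρ : Rep 𝓡 V) (K : IntermediateField ℚ ℂ) : Subgroup (GL V K) :=
  ρ.cliffordWeil.comap (Matrix.GeneralLinearGroup.map (algebraMap K ℂ))

/-- The full weight enumerator `fwe(C) = ∑_{c ∈ C} b_c ∈ ℂV`. -/
def fwe (_ : Rep 𝓡 V) (C : Submodule R V) : V → ℂ := (C : Set V).indicator 1

/-- The Weight Enumerator Conjecture for `ρ`: the fixed space of `𝒞(ρ)` in `ℂV` is spanned by
the full weight enumerators of the codes of Type `ρ`. -/
def WeightEnumeratorConjecture (ρ : Rep 𝓡 V) : Prop :=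
  {x : V → ℂ | ∀ g ∈ ρ.cliffordWeil, (g : Matrix V V ℂ).mulVec x = x} =
    (Submodule.span ℂ {x | ∃ C : Submodule R V, ρ.IsCodeOfType C ∧ x = ρ.fwe C} : Set (V → ℂ))

/-! ### The field `K(ρ)`, the Galois group `Γ` and the sign condition -/

/-- `ζ_f = exp (2 π i / f)`, where `f` is the conductor. -/
def zeta (ρ : Rep 𝓡 V) : ℂ := Complex.exp (2 * Real.pi * Complex.I / (ρ.conductor : ℂ))

/-- `√|ιV|`. -/
def sqrtCard (ρ : Rep 𝓡 V) (ι : R) : ℂ := ((Real.sqrt (ρ.idemImage ι).card : ℝ) : ℂ)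

/-- `ℚ(ζ_f)`. -/
def cyclotomicField (ρ : Rep 𝓡 V) : IntermediateField ℚ ℂ := IntermediateField.adjoin ℚ {ρ.zeta}

/-- `F₁ = ℚ(√|ιV| : ι symmetric idempotent)`. -/
def rootField (ρ : Rep 𝓡 V) : IntermediateField ℚ ℂ :=
  IntermediateField.adjoin ℚ {z | ∃ ι, 𝓡.IsSymmetricIdempotent ι ∧ z = ρ.sqrtCard ι}

/-- `K(ρ) = ℚ(ζ_f) F₁`. -/
def fieldK (ρ : Rep 𝓡 V) : IntermediateField ℚ ℂ := ρ.cyclotomicField ⊔ ρ.rootField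

/-- `F` is a complement of `F₁ ∩ ℚ(ζ_f)` in `F₁`. -/
structure IsComplement (ρ : Rep 𝓡 V) (F : IntermediateField ℚ ℂ) : Prop where
  sup_eq : F ⊔ (ρ.rootField ⊓ ρ.cyclotomicField) = ρ.rootField
  inf_eq : F ⊓ (ρ.rootField ⊓ ρ.cyclotomicField) = ⊥

/-- `ζ_f` as an element of `K(ρ)`. -/
def zetaK (ρ : Rep 𝓡 V) : ρ.fieldK :=
  ⟨ρ.zeta, (le_sup_left : ρ.cyclotomicField ≤ ρ.fieldK)
    (IntermediateField.subset_adjoin ℚ _ rfl)⟩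

/-- `√|ιV|` as an element of `K(ρ)`, for a symmetric idempotent `ι`. -/
def sqrtCardK (ρ : Rep 𝓡 V) (ι : R) (hι : 𝓡.IsSymmetricIdempotent ι) : ρ.fieldK :=
  ⟨ρ.sqrtCard ι, (le_sup_right : ρ.rootField ≤ ρ.fieldK)
    (IntermediateField.subset_adjoin ℚ _ ⟨ι, hι, rfl⟩)⟩

/-- `Γ = Gal(K(ρ)/F)`. -/
def galGroup (ρ : Rep 𝓡 V) (F : IntermediateField ℚ ℂ) : Subgroup (RingAut ρ.fieldK) where
  carrier := {σ | ∀ x : ρ.fieldK, (x : ℂ) ∈ F → σ x = x}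
  mul_mem' hσ hτ x hx := by rw [RingAut.mul_apply, hτ x hx, hσ x hx]
  one_mem' _ _ := rfl
  inv_mem' {σ} hσ x hx := by
    conv_lhs => rw [← hσ x hx]
    exact RingEquiv.symm_apply_apply σ x

/-- `γ_a`, for `a` prime to the conductor: the unique element of `Γ` that
raises `ζ_f` to the `a`-th power. -/
def gal (ρ : Rep 𝓡 V) (F : IntermediateField ℚ ℂ) (a : ℤ) : ρ.galGroup F :=
  Classical.epsilon fun σ : ρ.galGroup F => (σ : RingAut ρ.fieldK) ρ.zetaK = ρ.zetaK ^ a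

open Classical in
/-- The sign `ε(ι, a)` with `γ_a(√|ιV|) = ε(ι, a) √|ιV|`. -/
def sign (ρ : Rep 𝓡 V) (F : IntermediateField ℚ ℂ) (ι : R) (hι : 𝓡.IsSymmetricIdempotent ι)
    (a : ℤ) : ℤ :=
  if (ρ.gal F a : RingAut ρ.fieldK) (ρ.sqrtCardK ι hι) = ρ.sqrtCardK ι hι then 1 else -1

/-- The sign condition on `𝐚`. -/
def SignCondition (ρ : Rep 𝓡 V) (F : IntermediateField ℚ ℂ) {N : ℕ} (a : Fin N → ℤ) : Prop :=
  ∀ ι (hι : 𝓡.IsSymmetricIdempotent ι), ∏ i, ρ.sign F ι hι (a i) = 1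

/-- The degree `𝐝`: `d_α` is the number of `i` with `γ_{a_i} = α`, for `α ∈ Γ`. -/
def degree (ρ : Rep 𝓡 V) (F : IntermediateField ℚ ℂ) {N : ℕ} (a : Fin N → ℤ)
    (α : ρ.galGroup F) : ℕ :=
  Nat.card {i : Fin N // ρ.gal F (a i) = α}

open Classical in
/-- The `Γ`-conjugate complete weight enumerator of genus `m` of `C ≤ V^N`, a function on
`K^(V^m)`: the sum over all `c ∈ C^m` of the products `∏_{i=1}^N x_{c_i} ∘ γ_{a_i}`, where
`c_i ∈ V^m` is the `i`-th column of `c`, seen as an `m × N`-matrix. -/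
def ccwe (ρ : Rep 𝓡 V) (F : IntermediateField ℚ ℂ) {N : ℕ} (a : Fin N → ℤ) (m : ℕ)
    (C : Submodule R (Fin N → V)) : ((Fin m → V) → ρ.fieldK) → ρ.fieldK := fun k =>
  ∑ c : Fin m → Fin N → V with ∀ j, c j ∈ C,
    ∏ i, (ρ.gal F (a i) : RingAut ρ.fieldK) (k fun j => c j i)

end Group

end Rep

/-! ### Conjugate polynomials -/

section Conjugate

variable {K : Type*} [Field K] (Γ : Subgroup (RingAut K)) {X : Type*}

/-- The monomial function `∏_{α ∈ Γ} ∏_{i ∈ X} (x_i ∘ α)^{e_{iα}}` on `K^X`. -/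
def conjMonomial (e : X × Γ →₀ ℕ) : (X → K) → K := fun k =>
  e.prod fun p n => ((p.2 : RingAut K) (k p.1)) ^ n

variable [Fintype X]

/-- `K[𝐱 ∘ Γ]_𝐝`, the space of homogeneous `Γ`-conjugate polynomials of degree `𝐝` in the
variables `x_i`, `i ∈ X`, spanned by the monomials with `∑ᵢ e_{iα} = d_α` for all `α ∈ Γ`. -/
def conjHomogeneous (X : Type*) [Fintype X] (d : Γ → ℕ) : Submodule K ((X → K) → K) :=
  Submodule.span K {p | ∃ e : X × Γ →₀ ℕ, (∀ α, ∑ i, e (i, α) = d α) ∧ p = conjMonomial Γ e}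

/-- The `G`-invariants in `K[𝐱 ∘ Γ]_𝐝`, where `G` acts by `(f · g)(k) = f(k g⁻¹)`. -/
def conjInvariants [DecidableEq X] (G : Subgroup (GL X K)) (d : Γ → ℕ) :
    Submodule K ((X → K) → K) where
  carrier := {f | f ∈ conjHomogeneous Γ X d ∧
    ∀ g ∈ G, ∀ k, f (Matrix.vecMul k ((g⁻¹ : GL X K) : Matrix X X K)) = f k}
  add_mem' hf hf' := ⟨add_mem hf.1 hf'.1, fun g hg k => by
    simp only [Pi.add_apply, hf.2 g hg k, hf'.2 g hg k]⟩
  zero_mem' := ⟨zero_mem _, fun _ _ _ => rfl⟩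
  smul_mem' c _ hf := ⟨Submodule.smul_mem _ c hf.1, fun g hg k => by
    simp only [Pi.smul_apply, hf.2 g hg k]⟩

end Conjugate

end CliffordWeil

end

noncomputable section
namespace CliffordWeil

/-! ### Idempotents of finite rings -/

section Idempotents

variable {S : Type*} [Ring S]

/-! Put `X = V^m`, `g_i = γ_{a_i}`, and send the basis vector of a word `y ∈ X^N` to the function `∏
x_{y_i} ∘ g_i`. This linear map `conjEval` from tensors over `K` has image `K[𝐱 ∘ Γ]_𝐝`. Monomials
with different exponents are different multiplicative functions (`conjMonomial_injective`), hence
linearly independent by Dedekind, so the only relations come from permuting positions with equal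
`g_i`. Averaging over these permutations, in characteristic zero, shows that the invariants of a
group `G` are exactly the images of the tensors fixed by all `⨂ g_i(A)`, `A ∈ G`
(`conjInvariants_eq_map`).

The operation `A ↦ ⨂ γ_{a_i}(A)` turns the generators of `𝒞_m(ρ)` into those of `𝒞(R^m ⊗ ρ^𝐚)`:
`γ_a` multiplies the arguments of the characters by `a`, which is the twist by `𝐚`. For the
operators `h` the factors `√|ιV^m|` must also match, that is, the product of their conjugates has to
be the plain `N`-th power. The sign condition gives this only for symmetric idempotents of `R`. It
extends to those of `Mat_m(R)` because, up to squares, `|ιV^m|` is a product of numbers `|eV|` with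
`e ∈ R` symmetric (`exists_card_matrix_idemImage_eq_sq_mul`). That is a Krull-Schmidt argument: a
primitive `e` below `ι` is either isomorphic to `e^J` and splits off, or is paired with a copy of
`e^J`, and the pair contributes the square `|eV|²`.

Hence a tensor over `K` is fixed by the conjugate tensors of `𝒞_m(ρ)` if and only if it is fixed by
`𝒞(R^m ⊗ ρ^𝐚)` (`forall_conjTensor_mulVec_eq_iff`). By the Weight Enumerator Conjecture such tensors
lie in the `ℂ`-span of the indicators of codes over `Mat_m(R)`. These codes are the powers `C^m`
(`exists_eq_powCode`), the span descends to `K` (`mem_span_of_map_mem_span`), and `conjEval` maps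
the indicator of `C^m` to `ccwe_m(C)`. -/

/-- The right ideals `e S` and `f S` generated by idempotents are isomorphic. -/
def IdemIso (e f : S) : Prop :=
  ∃ a b, a * b = e ∧ b * a = f ∧ e * a = a ∧ a * f = a ∧ f * b = b ∧ b * e = b

theorem IdemIso.symm {e f : S} : IdemIso e f → IdemIso f e := by
  rintro ⟨a, b, h1, h2, h3, h4, h5, h6⟩
  exact ⟨b, a, h2, h1, h5, h6, h3, h4⟩

theorem IdemIso.trans {e f g : S} : IdemIso e f → IdemIso f g → IdemIso e g := by
  rintro ⟨a, b, h1, h2, h3, h4, h5, h6⟩ ⟨c, d, k1, k2, k3, k4, k5, k6⟩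
  refine ⟨a * c, d * b, ?_, ?_, ?_, ?_, ?_, ?_⟩
  · rw [mul_assoc, ← mul_assoc c, k1, h5, h1]
  · rw [mul_assoc, ← mul_assoc b, h2, k3, k2]
  · rw [← mul_assoc, h3]
  · rw [mul_assoc, k4]
  · rw [← mul_assoc, k5]
  · rw [mul_assoc, h6]

/-- The element `a b a`, read in two ways, gives `e a = a f`, so cutting `a` and `b` down to the
corners preserves both products. -/
theorem IdemIso.of_mul {e f a b : S} (he : e * e = e) (hf : f * f = f) (h1 : a * b = e)
    (h2 : b * a = f) : IdemIso e f := by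
  have hea : e * a = a * f := by rw [← h1, ← h2, mul_assoc]
  have hfb : f * b = b * e := by rw [← h1, ← h2, mul_assoc]
  refine ⟨e * a, f * b, ?_, ?_, ?_, ?_, ?_, ?_⟩
  · rw [hfb, mul_assoc, ← mul_assoc a, h1, he, he]
  · rw [hea, mul_assoc, ← mul_assoc b, h2, hf, hf]
  · rw [← mul_assoc, he]
  · rw [hea, mul_assoc, hf]
  · rw [← mul_assoc, hf]
  · rw [hfb, mul_assoc, he]

/-- Primitive idempotents. -/
structure IsPrimitiveIdem (e : S) : Prop where
  idem : e * e = e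
  ne_zero : e ≠ 0
  eq_of_le : ∀ f, f * f = f → e * f = f → f * e = f → f ≠ 0 → f = e

/-- The map `g ↦ a g b` carries idempotents below `f` to idempotents below `e`, with inverse `x ↦ b
x a`. -/
theorem IsPrimitiveIdem.of_idemIso {e f : S} (he : IsPrimitiveIdem e) (h : IdemIso e f)
    (hf : f * f = f) : IsPrimitiveIdem f := by
  obtain ⟨a, b, h1, h2, h3, h4, h5, h6⟩ := h
  refine ⟨hf, ?_, fun g hg hfg hgf hg0 => ?_⟩
  · rintro rfl
    exact he.ne_zero (by rw [← h1, ← h4]; simp)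
  · have key : b * (a * g * b) * a = g := by
      simp only [← mul_assoc]; rw [h2, mul_assoc, h2, hfg, hgf]
    have := he.eq_of_le (a * g * b) ?_ ?_ ?_ ?_
    · rw [← key, this, h6, h2]
    · calc a * g * b * (a * g * b) = a * g * (b * a) * g * b := by simp only [mul_assoc]
        _ = a * g * b := by rw [h2, mul_assoc a g f, hgf, mul_assoc a g g, hg]
    · simp only [← mul_assoc]; rw [h3]
    · rw [mul_assoc, h6]
    · intro h0; rw [h0] at key; apply hg0; rw [← key]; simp

variable [Finite S]

theorem exists_idempotent_pow (x : S) : ∃ n, 0 < n ∧ x ^ n * x ^ n = x ^ n := by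
  obtain ⟨i, j, hij, h⟩ := Finite.exists_ne_map_eq_of_infinite (fun n : ℕ => x ^ (n + 1))
  wlog hlt : i < j generalizing i j
  · exact this j i hij.symm h.symm (lt_of_le_of_ne (not_lt.1 hlt) hij.symm)
  obtain ⟨d, rfl⟩ := Nat.exists_eq_add_of_lt hlt
  have h1 : ∀ k, i + 1 ≤ k → ∀ t, x ^ (k + t * (d + 1)) = x ^ k := by
    intro k hk t
    induction t with
    | zero => simp
    | succ t ih =>
      obtain ⟨c, rfl⟩ := Nat.exists_eq_add_of_le hk
      rw [show i + 1 + c + (t + 1) * (d + 1) = (i + d + 1 + 1) + (c + t * (d + 1)) by ring,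
        pow_add, ← h, ← pow_add, show i + 1 + (c + t * (d + 1)) = i + 1 + c + t * (d + 1) by ring, ih]
  -- The powers of `x` have period `d + 1` from exponent `i + 1` on. The chosen exponent is a
  -- multiple of the period beyond that point, so doubling it changes nothing.
  refine ⟨(i + 1) * (d + 1), by positivity, ?_⟩
  rw [← pow_add]
  exact h1 _ (Nat.le_mul_of_pos_right _ (by omega)) (i + 1)

/-- Every element of the corner ring of a primitive idempotent of a finite ring is nilpotent or
invertible. -/
theorem IsPrimitiveIdem.isNilpotent_or {e x : S} (he : IsPrimitiveIdem e) (h1 : e * x = x)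
    (h2 : x * e = x) : IsNilpotent x ∨ ∃ y, e * y = y ∧ y * e = y ∧ y * x = e ∧ x * y = e := by
  obtain ⟨n, hn, h⟩ := exists_idempotent_pow x
  by_cases h0 : x ^ n = 0
  · exact Or.inl ⟨n, h0⟩
  right
  obtain ⟨k, rfl⟩ := Nat.exists_eq_add_of_lt hn
  rw [zero_add] at h h0
  have hl : ∀ k, e * x ^ (k + 1) = x ^ (k + 1) := fun k => by rw [pow_succ', ← mul_assoc, h1]
  have hr : ∀ k, x ^ (k + 1) * e = x ^ (k + 1) := fun k => by rw [pow_succ, mul_assoc, h2]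
  have hE := he.eq_of_le _ h (hl k) (hr k) h0
  -- Primitivity gives `x ^ (k + 1) = e`. The obvious inverse `x ^ k` is not in the corner when `k =
  -- 0`; one more period cures this.
  refine ⟨x ^ (2 * k + 1), hl _, hr _, ?_, ?_⟩
  · rw [← pow_succ, show 2 * k + 1 + 1 = (k + 1) + (k + 1) by ring, pow_add, h, hE]
  · rw [← pow_succ', show 2 * k + 1 + 1 = (k + 1) + (k + 1) by ring, pow_add, h, hE]

/-- A one-sided inverse yields `y ^ (k + 1) * x ^ (k + 1) = e` for all `k`, so `x` is not nilpotent
and the dichotomy makes it invertible. -/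
theorem IsPrimitiveIdem.exists_inv {e x y : S} (he : IsPrimitiveIdem e) (h1 : e * x = x)
    (h2 : x * e = x) (h : y * x = e) : ∃ z, e * z = z ∧ z * e = z ∧ z * x = e ∧ x * z = e := by
  refine (he.isNilpotent_or h1 h2).resolve_left ?_
  rintro ⟨n, hn⟩
  have : ∀ k, y ^ (k + 1) * x ^ (k + 1) = e := by
    intro k
    induction k with
    | zero => simpa using h
    | succ k ih =>
      rw [pow_succ y, pow_succ' x (k + 1), mul_assoc, ← mul_assoc y x, h, pow_succ' x,
        ← mul_assoc e, h1, ← pow_succ', ih]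
  apply he.ne_zero
  rw [← this n, pow_succ x, hn]
  simp

/-- The corner ring of `e` is local. The elements `e z x` and `e z y` add up to its unit `e`, so
they commute; if both were nilpotent, `e` would be nilpotent. -/
theorem IsPrimitiveIdem.left_inv_or {e x y z : S} (he : IsPrimitiveIdem e)
    (h2 : x * e = x) (k2 : y * e = y) (h : z * (x + y) = e) :
    (∃ w, w * x = e) ∨ ∃ w, w * y = e := by
  have hx : e * (e * z * x) = e * z * x := by simp only [← mul_assoc, he.idem]
  have hx' : e * z * x * e = e * z * x := by rw [mul_assoc, h2]
  have hxy : e * z * y = e - e * z * x := by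
    have : e * z * (x + y) = e := by rw [mul_assoc, h, he.idem]
    rw [eq_sub_iff_add_eq, add_comm, ← mul_add, this]
  rcases he.isNilpotent_or hx hx' with hN | ⟨w, -, -, hw, -⟩
  · right
    have hy : e * (e * z * y) = e * z * y := by simp only [← mul_assoc, he.idem]
    have hy' : e * z * y * e = e * z * y := by rw [mul_assoc, k2]
    rcases he.isNilpotent_or hy hy' with hN' | ⟨w, -, -, hw, -⟩
    · exfalso
      have hc : Commute (e * z * x) (e * z * y) := by
        rw [hxy]
        change _ * _ = _ * _
        rw [mul_sub, sub_mul, hx, hx']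
      have hs := hc.isNilpotent_add hN hN'
      rw [hxy, add_sub_cancel] at hs
      obtain ⟨n, hn⟩ := hs
      have hp : ∀ k, e ^ (k + 1) = e := fun k => by
        induction k with
        | zero => simp
        | succ k ih => rw [pow_succ, ih, he.idem]
      apply he.ne_zero
      rw [← hp n, pow_succ, hn, zero_mul]
    · exact ⟨w * (e * z), by rw [mul_assoc, hw]⟩
  · exact Or.inl ⟨w * (e * z), by rw [mul_assoc, hw]⟩

theorem IsPrimitiveIdem.exists_left_inv_of_sum {e : S} (he : IsPrimitiveIdem e) {ι : Type*}
    (s : Finset ι) (x : ι → S) (h2 : ∀ i, x i * e = x i)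
    (h : ∃ z, z * ∑ i ∈ s, x i = e) : ∃ i ∈ s, ∃ w, w * x i = e := by
  classical
  induction s using Finset.induction_on with
  | empty => obtain ⟨z, hz⟩ := h; exact absurd (by simpa using hz.symm) he.ne_zero
  | insert i s hi ih =>
    obtain ⟨z, hz⟩ := h
    rw [Finset.sum_insert hi] at hz
    rcases he.left_inv_or (h2 i) (by rw [Finset.sum_mul]; simp only [h2]) hz with hw | hw
    · exact ⟨i, by simp, hw⟩
    · obtain ⟨j, hj, hw⟩ := ih hw
      exact ⟨j, Finset.mem_insert_of_mem hj, hw⟩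

/-- If a primitive idempotent `e` factors through an idempotent `p`, then `e` is isomorphic to an
idempotent below `p`. -/
theorem exists_idemIso_le {S : Type*} [Ring S] {e p w : S} (he : e * e = e) (hp : p * p = p)
    (h : w * (e * p * e) = e) :
    ∃ f, f * f = f ∧ p * f = f ∧ f * p = f ∧ IdemIso e f := by
  -- Once two elements have the idempotent product `a b = e`, cut to this corner, the reversed
  -- product `b a` is idempotent too; here it lies below `p`.
  have hab : e * w * e * p * (p * e) = e := by
    calc e * w * e * p * (p * e) = e * (w * (e * (p * p) * e)) := by simp only [mul_assoc]
      _ = e := by rw [hp, h, he]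
  have hf : p * e * (e * w * e * p) * (p * e * (e * w * e * p)) = p * e * (e * w * e * p) := by
    calc _ = p * e * ((e * w * e * p) * (p * e)) * (e * w * e * p) := by simp only [mul_assoc]
      _ = p * (e * e) * (e * w * e * p) := by rw [hab]; simp only [mul_assoc]
      _ = _ := by rw [he]
  refine ⟨p * e * (e * w * e * p), hf, ?_, ?_, IdemIso.of_mul he hf hab rfl⟩
  · simp only [← mul_assoc, hp]
  · simp only [mul_assoc, hp]

/-- Schur complement. -/
theorem idemIso_of_schur {S : Type*} [Ring S] {e e' i i' u v w : S}
    (he' : e' * e' = e') (hi : i * i = i) (hi' : i' * i' = i')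
    (hie : i * e = 0)
    (hei' : e' * i' = 0) (hie' : i' * e' = 0) (huv : u * v = e + i) (hvu : v * u = e' + i')
    (hu : u * (e' + i') = u) (hv : v * (e + i) = v)
    (hw : w * (e' * v * e) = e) (hw' : e' * v * e * w = e') (hwe : w * e' = w) (hew : e * w = w) :
    IdemIso i i' := by
  have hu1 : u = u * e' + u * i' := by rw [← mul_add, hu]
  have hv1 : v = v * e + v * i := by rw [← mul_add, hv]
  -- The identities `e1` to `e4` are block entries of `u v = e + i` and `v u = e' + i'`, with the
  -- inner index split along `e' + i'` and `e + i`.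
  have e1 : i * u * i' * v * e = - (i * u * e' * v * e) := by
    have : i * (u * v) * e = 0 := by rw [huv, mul_add, hi, hie]; simp [hie]
    rw [hu1] at this
    rw [eq_neg_iff_add_eq_zero, ← this]; noncomm_ring
  have e2 : i * u * i' * v * i = i - i * u * e' * v * i := by
    have : i * (u * v) * i = i := by rw [huv, mul_add, hi, hie]; simp [hi]
    rw [hu1] at this
    rw [eq_sub_iff_add_eq]; refine Eq.trans ?_ this; noncomm_ring
  have e3 : e' * v * i * u * i' = - (e' * v * e * u * i') := by
    have : e' * (v * u) * i' = 0 := by rw [hvu, mul_add, he', hei']; simp [hei']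
    rw [hv1] at this
    rw [eq_neg_iff_add_eq_zero, ← this]; noncomm_ring
  have e4 : i' * v * i * u * i' = i' - i' * v * e * u * i' := by
    have : i' * (v * u) * i' = i' := by rw [hvu, mul_add, hi', hie']; simp [hi']
    rw [hv1] at this
    rw [eq_sub_iff_add_eq]; refine Eq.trans ?_ this; noncomm_ring
  -- View `v` as a `2 × 2` block matrix whose entry `e' v e` has inverse `w`. Its Schur complement
  -- is inverted by the block `i u i'` of the inverse matrix `u`.
  refine IdemIso.of_mul (a := i * u * i') (b := i' * v * i - i' * v * w * v * i) hi hi' ?_ ?_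
  · have h1 : i * u * i' * v * w * v * i = - (i * u * e' * v * i) := by
      calc i * u * i' * v * w * v * i = i * u * i' * v * (e * w) * v * i := by rw [hew]
        _ = (i * u * i' * v * e) * w * v * i := by simp only [mul_assoc]
        _ = - (i * u * (e' * v * e * w) * v * i) := by rw [e1]; noncomm_ring
        _ = _ := by rw [hw']
    calc i * u * i' * (i' * v * i - i' * v * w * v * i)
        = i * u * (i' * i') * v * i - i * u * (i' * i') * v * w * v * i := by noncomm_ring
      _ = i * u * i' * v * i - i * u * i' * v * w * v * i := by rw [hi']
      _ = i := by rw [h1, e2]; noncomm_ring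
  · have h1 : i' * v * w * v * i * u * i' = - (i' * v * e * u * i') := by
      calc i' * v * w * v * i * u * i' = i' * v * (w * e') * v * i * u * i' := by rw [hwe]
        _ = i' * v * w * (e' * v * i * u * i') := by simp only [mul_assoc]
        _ = - (i' * v * (w * (e' * v * e)) * u * i') := by rw [e3]; noncomm_ring
        _ = _ := by rw [hw]
    calc (i' * v * i - i' * v * w * v * i) * (i * u * i')
        = i' * v * (i * i) * u * i' - i' * v * w * v * (i * i) * u * i' := by noncomm_ring
      _ = i' * v * i * u * i' - i' * v * w * v * i * u * i' := by rw [hi]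
      _ = i' := by rw [h1, e4]; noncomm_ring

/-- Cancellation of primitive idempotents. -/
theorem IdemIso.cancel {e e' i i' : S} (he : IsPrimitiveIdem e) (he' : e' * e' = e')
    (hi : i * i = i) (hi' : i' * i' = i') (hie : i * e = 0)
    (hei' : e' * i' = 0) (hie' : i' * e' = 0) (hee : IdemIso e e')
    (h : IdemIso (e + i) (e' + i')) : IdemIso i i' := by
  have hpe' := he.of_idemIso hee he'
  obtain ⟨a, b, h1, h2, h3, h4, h5, h6⟩ := hee
  obtain ⟨u, v, k1, k2, k3, k4, k5, k6⟩ := h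
  have hl : (e + i) * e = e := by rw [add_mul, he.idem, hie, add_zero]
  have hsum : e * u * e' * v * e + e * u * i' * v * e = e := by
    calc _ = e * (u * (e' + i')) * v * e := by noncomm_ring
      _ = e * ((u * v) * e) := by rw [k4]; simp only [mul_assoc]
      _ = e := by rw [k1, hl, he.idem]
  -- Since the corner of `e` is local, one of the two summands of the `(e, e)` entry of `u v` is
  -- invertible. If it is the one through `e'`, then `e' v e` is an isomorphism and the Schur
  -- complement applies directly.
  rcases he.left_inv_or (x := e * u * e' * v * e) (y := e * u * i' * v * e) (z := e)
      (by rw [mul_assoc, he.idem]) (by rw [mul_assoc, he.idem])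
      (by rw [hsum, he.idem]) with ⟨w, hw⟩ | ⟨w, hw⟩
  · obtain ⟨z, z1, z2, z3, z4⟩ := he.exists_inv (by simp only [← mul_assoc, he.idem])
      (by rw [mul_assoc, he.idem]) hw
    have hleft : (z * e * u * e') * (e' * v * e) = e := by
      refine Eq.trans ?_ z3; simp only [mul_assoc]; rw [← mul_assoc e' e', he']
    -- The product is a nonzero idempotent below the primitive `e'`, hence equal to it.
    have hright : e' * v * e * (z * e * u * e') = e' := by
      refine hpe'.eq_of_le _ ?_ ?_ ?_ ?_
      · calc _ = e' * v * e * ((z * e * u * e') * (e' * v * e)) * (z * e * u * e') := by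
              simp only [mul_assoc]
          _ = e' * v * (e * e) * (z * e * u * e') := by rw [hleft]; simp only [mul_assoc]
          _ = _ := by rw [he.idem]
      · simp only [← mul_assoc, he']
      · simp only [mul_assoc, he']
      · intro h0
        apply he.ne_zero
        calc e = (z * e * u * e') * (e' * v * e) * ((z * e * u * e') * (e' * v * e)) := by
              rw [hleft, he.idem]
          _ = (z * e * u * e') * (e' * v * e * (z * e * u * e')) * (e' * v * e) := by
              simp only [mul_assoc]
          _ = 0 := by rw [h0]; simp
    refine idemIso_of_schur he' hi hi' hie hei' hie' k1 k2 k4 k6 hleft hright ?_ ?_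
    · rw [mul_assoc, he']
    · simp only [← mul_assoc, z1]
  · -- after an elementary operation the first diagonal entry of `v` becomes `b`
    let t : S := (b - e' * v * e) * w * e * u * i'
    have hw' : w * e * u * i' * v * e = e := by refine Eq.trans ?_ hw; simp only [mul_assoc]
    have te' : t * e' = 0 := by simp only [t, mul_assoc, hie', mul_zero]
    have ti' : t * i' = t := by simp only [t, mul_assoc, hi']
    have e't : e' * t = t := by
      have : e' * (b - e' * v * e) = b - e' * v * e := by
        rw [mul_sub, h5]; simp only [← mul_assoc, he']
      simp only [t, ← mul_assoc, this]
    have i't : i' * t = 0 := by rw [← e't, ← mul_assoc, hie', zero_mul]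
    -- As `t = e' t i'`, it squares to zero, and `1 + t` is a unit with inverse `1 - t`.
    have tt : t * t = 0 := by nth_rewrite 2 [← e't]; rw [← mul_assoc, te', zero_mul]
    have tve : t * v * e = b - e' * v * e := by
      calc t * v * e = (b - e' * v * e) * (w * e * u * i' * v * e) := by
            simp only [t, mul_assoc]
        _ = _ := by rw [hw', sub_mul, h6, mul_assoc, he.idem]
    have key : e' * ((1 + t) * v) * e = b := by
      calc e' * ((1 + t) * v) * e = e' * v * e + e' * t * v * e := by noncomm_ring
        _ = b := by rw [e't, tve]; abel
    refine idemIso_of_schur (u := u * (1 - t)) (v := (1 + t) * v) (w := a) he' hi hi'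
      hie hei' hie' ?_ ?_ ?_ ?_ ?_ ?_ h4 h3
    · have : (1 - t) * (1 + t) = 1 := by
        calc (1 - t) * (1 + t) = 1 - t * t := by noncomm_ring
          _ = 1 := by rw [tt, sub_zero]
      rw [mul_assoc, ← mul_assoc (1 - t), this, one_mul, k1]
    · calc (1 + t) * v * (u * (1 - t)) = (1 + t) * (v * u) * (1 - t) := by simp only [mul_assoc]
        _ = e' + i' + (t * e' + t * i') - (e' * t + i' * t)
              - (t * e' * t + t * i' * t) := by rw [k2]; noncomm_ring
        _ = e' + i' := by rw [te', ti', e't, i't, tt]; simp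
    · calc u * (1 - t) * (e' + i') = u * (e' + i') - u * (t * e' + t * i') := by noncomm_ring
        _ = u * (1 - t) := by rw [k4, te', ti']; noncomm_ring
    · rw [mul_assoc, k6]
    · rw [key, h1]
    · rw [key, h2]

/-- The elements fixed by `e` form the right ideal `e S`; its order is the measure for the
inductions that split off idempotents. The element `e` witnesses that `f S` is strictly smaller. -/
theorem card_fixed_lt {e f : S} (he : e * e = e) (h1 : e * f = f) (h2 : f * e = f)
    (hne : f ≠ e) : Nat.card {x // f * x = x} < Nat.card {x // e * x = x} := by
  have hss : {x | f * x = x} ⊂ {x | e * x = x} := by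
    refine ⟨fun x hx => ?_, fun h => hne ?_⟩
    · rw [Set.mem_ofPred_eq] at hx ⊢; rw [← hx, ← mul_assoc, h1]
    · have : f * e = e := h he
      rw [← this, h2]
  exact Set.ncard_lt_ncard hss (Set.toFinite _)

theorem exists_isPrimitiveIdem {e : S} (he : e * e = e) (h0 : e ≠ 0) :
    ∃ f, IsPrimitiveIdem f ∧ e * f = f ∧ f * e = f := by
  induction h : Nat.card {x // e * x = x} using Nat.strong_induction_on generalizing e with
  | _ n ih =>
    subst h
    by_cases hp : IsPrimitiveIdem e
    · exact ⟨e, hp, he, he⟩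
    · have : ∃ f, f * f = f ∧ e * f = f ∧ f * e = f ∧ f ≠ 0 ∧ f ≠ e := by
        by_contra hcon
        refine hp ⟨he, h0, fun f k1 k2 k3 k4 => ?_⟩
        by_contra k5
        exact hcon ⟨f, k1, k2, k3, k4, k5⟩
      obtain ⟨f, k1, k2, k3, k4, k5⟩ := this
      obtain ⟨g, g1, g2, g3⟩ := ih _ (card_fixed_lt he k2 k3 k5) k1 k4 rfl
      exact ⟨g, g1, by rw [← g2, ← mul_assoc, k2], by rw [← g3, mul_assoc, k3]⟩

end Idempotents

end CliffordWeil
end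

noncomputable section
namespace CliffordWeil
variable {R M Φ : Type*} [Ring R] [AddCommGroup M] [AddCommGroup Φ]

/-! ### The anti-automorphism `J` -/

namespace FormRing

variable (𝓡 : FormRing R M Φ)

theorem act_left_psi_one (r : R) : 𝓡.act r 1 (𝓡.psi 1) = 𝓡.psi (𝓡.J r) := by simp [J]

theorem psi_eq_act (r : R) : 𝓡.psi r = 𝓡.act 1 r (𝓡.psi 1) := by
  rw [← 𝓡.psi_mul, one_mul]

/-- The actions of `r ⊗ 1` and `1 ⊗ s` commute, and `ψ(1)(r ⊗ 1) = ψ(1)(1 ⊗ r^J)`; moving one factor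
at a time into the second slot reverses the order. -/
theorem J_mul (r s : R) : 𝓡.J (r * s) = 𝓡.J s * 𝓡.J r := by
  apply 𝓡.psi.injective
  rw [← act_left_psi_one, 𝓡.psi_mul, ← act_left_psi_one 𝓡 s, ← 𝓡.act_mul, mul_one, one_mul,
    ← one_mul (1 : R), 𝓡.act_mul, one_mul, act_left_psi_one, psi_eq_act, ← 𝓡.act_mul, mul_one,
    one_mul]

theorem J_add (r s : R) : 𝓡.J (r + s) = 𝓡.J r + 𝓡.J s := by simp [J]

theorem J_zero : 𝓡.J 0 = 0 := by simp [J]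

/-- Both sides come from evaluating `τ(ψ(r^J))`, once with `ψ(r^J) = ψ(1)(r ⊗ 1)` and once with
`ψ(r^J) = ψ(1)(1 ⊗ r^J)`. Thus the square of `J` is conjugation by the unit `ψ⁻¹(τ(ψ(1)))`. -/
theorem J_J_mul (r : R) :
    𝓡.J (𝓡.J r) * 𝓡.psi.symm (𝓡.tau (𝓡.psi 1)) = 𝓡.psi.symm (𝓡.tau (𝓡.psi 1)) * r := by
  set ε := 𝓡.psi.symm (𝓡.tau (𝓡.psi 1)) with hε
  have h0 : 𝓡.tau (𝓡.psi 1) = 𝓡.psi ε := by simp [hε]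
  apply 𝓡.psi.injective
  have h1 : 𝓡.tau (𝓡.psi (𝓡.J r)) = 𝓡.psi (ε * r) := by
    rw [← act_left_psi_one, ← 𝓡.tau_act, h0, ← 𝓡.psi_mul]
  rw [← h1, psi_eq_act 𝓡 (𝓡.J r), ← 𝓡.tau_act, h0, psi_eq_act 𝓡 ε, ← 𝓡.act_mul, one_mul, mul_one,
    𝓡.psi_mul, ← act_left_psi_one, ← 𝓡.act_mul, mul_one, one_mul]

theorem J_injective : Function.Injective 𝓡.J := by
  intro r s h
  refine 𝓡.isUnit_eps.mul_left_cancel ?_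
  rw [← J_J_mul, ← J_J_mul, h]

theorem J_idem {e : R} (he : e * e = e) : 𝓡.J e * 𝓡.J e = 𝓡.J e := by rw [← J_mul, he]

theorem idemIso_J {e f : R} : IdemIso e f → IdemIso (𝓡.J e) (𝓡.J f) := by
  rintro ⟨a, b, h1, h2, h3, h4, h5, h6⟩
  refine ⟨𝓡.J b, 𝓡.J a, ?_, ?_, ?_, ?_, ?_, ?_⟩ <;> rw [← J_mul] <;> congr 1

theorem idemIso_J_J {e : R} (he : e * e = e) : IdemIso (𝓡.J (𝓡.J e)) e := by
  obtain ⟨ε, hε⟩ := 𝓡.isUnit_eps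
  have h := 𝓡.J_J_mul e
  rw [← hε] at h
  refine IdemIso.of_mul (a := ε * e) (b := e * ((ε⁻¹ : Rˣ) : R)) (𝓡.J_idem (𝓡.J_idem he)) he ?_ ?_
  · rw [← mul_assoc, mul_assoc (ε : R), he, ← h, mul_assoc, Units.mul_inv, mul_one]
  · rw [mul_assoc, ← mul_assoc (((ε⁻¹ : Rˣ) : R)), Units.inv_mul, one_mul, he]

theorem isPrimitiveIdem_J [Finite R] {e : R} (he : IsPrimitiveIdem e) :
    IsPrimitiveIdem (𝓡.J e) := by
  refine ⟨𝓡.J_idem he.idem, fun h => he.ne_zero (𝓡.J_injective (by rw [h, J_zero])), ?_⟩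
  intro f h1 h2 h3 h4
  obtain ⟨g, rfl⟩ := (Finite.injective_iff_surjective.1 𝓡.J_injective) f
  simp only [← J_mul] at h1 h2 h3
  rw [he.eq_of_le g (𝓡.J_injective h1) (𝓡.J_injective h3) (𝓡.J_injective h2)
    (by rintro rfl; exact h4 𝓡.J_zero)]

theorem isSymmetricIdempotent_iff {e : R} :
    𝓡.IsSymmetricIdempotent e ↔ e * e = e ∧ IdemIso e (𝓡.J e) := by
  constructor
  · rintro ⟨u, v, h⟩
    exact ⟨h.idem, IdemIso.of_mul h.idem (𝓡.J_idem h.idem) h.u_mul_v h.v_mul_u⟩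
  · rintro ⟨he, a, b, h1, h2, h3, h4, h5, h6⟩
    exact ⟨a, b, he, ⟨a, by rw [h3, h4]⟩, ⟨b, by rw [h5, h6]⟩, h1, h2⟩

theorem matrix_J_apply {m : ℕ} (A : Matrix (Fin m) (Fin m) R) (i j : Fin m) :
    (𝓡.matrix m).J A i j = 𝓡.J (A j i) := by
  have h := (𝓡.matrix m).act_left_psi_one A
  have h' := congrFun (congrFun h i) j
  change 𝓡.matAct m A 1 (𝓡.matPsi m 1) i j = 𝓡.psi ((𝓡.matrix m).J A i j) at h'
  apply 𝓡.psi.injective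
  rw [← h', matAct_apply, Finset.sum_eq_single j, Finset.sum_eq_single j]
  · rw [Matrix.one_apply_eq, matPsi_apply, Matrix.one_apply_eq, act_left_psi_one]
  · intro k _ hk; simp [Matrix.one_apply_ne hk]
  · simp
  · intro k _ hk
    refine Finset.sum_eq_zero fun l _ => ?_
    rcases eq_or_ne l j with rfl | hl
    · simp [matPsi_apply, Matrix.one_apply_ne hk]
    · simp [Matrix.one_apply_ne hl]
  · simp

theorem matrix_J_single {m : ℕ} (i : Fin m) (r : R) :
    (𝓡.matrix m).J (Matrix.single i i r) = Matrix.single i i (𝓡.J r) := by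
  ext k l
  rw [matrix_J_apply]
  by_cases h : i = k ∧ i = l
  · obtain ⟨rfl, rfl⟩ := h; simp
  · rw [Matrix.single_apply_of_ne _ _ _ _ _ h,
      Matrix.single_apply_of_ne _ _ _ _ _ (fun h' => h h'.symm), J_zero]

end FormRing

/-! ### The cardinalities `|ιV|` -/

namespace Rep

variable {𝓡 : FormRing R M Φ} {V : Type*} [AddCommGroup V] [Module R V]

/-- `J` is the adjunction of `β`, because `r ⊗ 1` and `1 ⊗ r^J` act alike on `ψ(1)`. -/
theorem beta_smul_left (ρ : Rep 𝓡 V) (r : R) (x y : V) :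
    ρ.beta (r • x) y = ρ.beta x (𝓡.J r • y) := by
  have h1 := ρ.rhoM_act r 1 (𝓡.psi 1) x y
  have h2 := ρ.rhoM_act 1 (𝓡.J r) (𝓡.psi 1) x y
  rw [𝓡.act_left_psi_one, 𝓡.psi_eq_act, h2] at h1
  simpa [beta] using h1.symm

variable [Fintype V] [DecidableEq V] (ρ : Rep 𝓡 V)

theorem mem_idemImage {ι : R} {x : V} : x ∈ ρ.idemImage ι ↔ ∃ y, ι • y = x := by
  simp [idemImage]

theorem mem_idemImage_iff {ι : R} (h : ι * ι = ι) {x : V} : x ∈ ρ.idemImage ι ↔ ι • x = x := by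
  rw [mem_idemImage]
  refine ⟨?_, fun hx => ⟨x, hx⟩⟩
  rintro ⟨y, rfl⟩
  rw [smul_smul, h]

theorem card_idemImage_eq_of_idemIso {e f : R} (he : e * e = e) (hf : f * f = f)
    (h : IdemIso e f) : (ρ.idemImage e).card = (ρ.idemImage f).card := by
  obtain ⟨a, b, h1, h2, h3, h4, h5, h6⟩ := h
  refine Finset.card_bij' (fun x _ => b • x) (fun x _ => a • x) ?_ ?_ ?_ ?_
  · intro x _; rw [ρ.mem_idemImage_iff hf, smul_smul, h5]
  · intro x _; rw [ρ.mem_idemImage_iff he, smul_smul, h3]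
  · intro x hx; rw [ρ.mem_idemImage_iff he] at hx; simp only [smul_smul]; rw [h1, hx]
  · intro x hx; rw [ρ.mem_idemImage_iff hf] at hx; simp only [smul_smul]; rw [h2, hx]

theorem card_idemImage_add {e f : R} (he : e * e = e) (hf : f * f = f) (hef : e * f = 0)
    (hfe : f * e = 0) :
    (ρ.idemImage (e + f)).card = (ρ.idemImage e).card * (ρ.idemImage f).card := by
  have hs : (e + f) * (e + f) = e + f := by
    rw [add_mul, mul_add, mul_add, he, hf, hef, hfe]; simp
  rw [← Finset.card_product]
  refine Finset.card_bij' (fun x _ => (e • x, f • x)) (fun p _ => p.1 + p.2) ?_ ?_ ?_ ?_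
  · intro x _
    simp only [Finset.mem_product, ρ.mem_idemImage_iff he, ρ.mem_idemImage_iff hf, smul_smul, he,
      hf, and_self]
  · intro p hp
    rw [Finset.mem_product, ρ.mem_idemImage_iff he, ρ.mem_idemImage_iff hf] at hp
    rw [ρ.mem_idemImage_iff hs, ← hp.1, ← hp.2]
    simp only [smul_add, smul_smul, add_mul, he, hf, hef, hfe, add_zero, zero_add]
  · intro x hx
    rw [ρ.mem_idemImage_iff hs, add_smul] at hx
    exact hx
  · intro p hp
    rw [Finset.mem_product, ρ.mem_idemImage_iff he, ρ.mem_idemImage_iff hf] at hp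
    refine Prod.ext ?_ ?_
    · change e • (p.1 + p.2) = p.1
      rw [← hp.2, smul_add, smul_smul, hef, hp.1]; simp
    · change f • (p.1 + p.2) = p.2
      rw [← hp.1, smul_add, smul_smul, hfe, hp.2]; simp

theorem card_idemImage_zero : (ρ.idemImage 0).card = 1 := by
  rw [Finset.card_eq_one]
  exact ⟨0, by ext x; simp [mem_idemImage, eq_comm]⟩

end Rep

/-! ### The character of `ℚ/ℤ` and dual pairings -/

theorem expQZ_coe (q : ℚ) : expQZ (q : QZ) = Complex.exp (2 * Real.pi * Complex.I * (q : ℂ)) := rfl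

theorem expQZ_add (x y : QZ) : expQZ (x + y) = expQZ x * expQZ y := by
  induction x using QuotientAddGroup.induction_on with | H x => ?_
  induction y using QuotientAddGroup.induction_on with | H y => ?_
  change expQZ ((x + y : ℚ) : QZ) = expQZ (x : QZ) * expQZ (y : QZ)
  rw [expQZ_coe, expQZ_coe, expQZ_coe, ← Complex.exp_add]
  congr 1; push_cast; ring

theorem expQZ_zero : expQZ 0 = 1 := by
  have h := expQZ_coe 0
  rwa [Rat.cast_zero, mul_zero, Complex.exp_zero] at h

theorem expQZ_eq_one {x : QZ} : expQZ x = 1 ↔ x = 0 := by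
  refine ⟨?_, fun h => h ▸ expQZ_zero⟩
  induction x using QuotientAddGroup.induction_on with | H q => ?_
  change expQZ (q : QZ) = 1 → (q : QZ) = 0
  rw [expQZ_coe, Complex.exp_eq_one_iff]
  rintro ⟨n, hn⟩
  have h2 : (2 * Real.pi * Complex.I : ℂ) ≠ 0 := Complex.two_pi_I_ne_zero
  have h3 : (q : ℂ) = n := by
    apply mul_left_cancel₀ h2; rw [hn]; ring
  have h4 : q = n := by exact_mod_cast h3
  rw [AddCircle.coe_eq_zero_iff]
  exact ⟨n, by rw [h4]; simp⟩

theorem expQZ_sum {ι : Type*} (s : Finset ι) (f : ι → QZ) :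
    expQZ (∑ i ∈ s, f i) = ∏ i ∈ s, expQZ (f i) := by
  classical
  induction s using Finset.induction_on with
  | empty => simp [expQZ_zero]
  | insert i s hi ih => rw [Finset.sum_insert hi, Finset.prod_insert hi, expQZ_add, ih]

theorem expQZ_zsmul (n : ℤ) (x : QZ) : expQZ (n • x) = expQZ x ^ n := by
  let φ : Multiplicative QZ →* ℂ :=
    { toFun := fun x => expQZ x.toAdd, map_one' := expQZ_zero, map_mul' := fun x y => expQZ_add _ _ }
  have hφ : ∀ k : ℕ, expQZ (k • x) = expQZ x ^ k := fun k => map_pow φ (Multiplicative.ofAdd x) k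
  obtain ⟨k, rfl | rfl⟩ := n.eq_nat_or_neg
  · simpa using hφ k
  · have h : expQZ (-((k : ℤ) • x)) * expQZ ((k : ℤ) • x) = 1 := by
      rw [← expQZ_add, neg_add_cancel, expQZ_zero]
    rw [neg_smul, eq_inv_of_mul_eq_one_left h, zpow_neg, natCast_zsmul, hφ, zpow_natCast]

/-- A left non-degenerate pairing bounds the order of a finite group by that of its partner. -/
theorem card_le_of_pairing {A B : Type*} [AddCommGroup A] [AddCommGroup B] [Finite A] [Finite B]
    (b : A →+ B →+ QZ) (h : ∀ x, (∀ y, b x y = 0) → x = 0) : Nat.card A ≤ Nat.card B := by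
  have := Fintype.ofFinite B
  have hc : Nat.card B = Nat.card (AddChar B ℂ) := by
    rw [Nat.card_eq_fintype_card, Nat.card_eq_fintype_card, AddChar.card_eq]
  rw [hc]
  refine Nat.card_le_card_of_injective (fun x : A =>
    ({ toFun := fun y => expQZ (b x y)
       map_zero_eq_one' := by simp [expQZ_zero]
       map_add_eq_mul' := fun y z => by simp [expQZ_add] } : AddChar B ℂ)) ?_
  intro x x' hx
  rw [← sub_eq_zero]
  refine h _ fun y => ?_
  have h1 : expQZ (b x y) = expQZ (b x' y) := DFunLike.congr_fun hx y
  rw [← expQZ_eq_one, map_sub, AddMonoidHom.sub_apply, sub_eq_add_neg, expQZ_add, h1, ← expQZ_add,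
    add_neg_cancel, expQZ_zero]

namespace Rep

variable {𝓡 : FormRing R M Φ} {V : Type*} [AddCommGroup V] [Module R V]
  [Fintype V] [DecidableEq V] (ρ : Rep 𝓡 V)

theorem card_range_smul (r : R) :
    Nat.card (DistribSMul.toAddMonoidHom V r).range = (ρ.idemImage r).card :=
  Nat.subtype_card _ fun _ => ρ.mem_idemImage

/-- By adjunction `β` restricts to a pairing of `eV` with `e^J V` that is non-degenerate on both
sides, so each group embeds into the character group of the other. -/
theorem card_idemImage_J {e : R} (he : e * e = e) :
    (ρ.idemImage (𝓡.J e)).card = (ρ.idemImage e).card := by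
  let b : (DistribSMul.toAddMonoidHom V e).range →+ (DistribSMul.toAddMonoidHom V (𝓡.J e)).range →+
      QZ := ((AddMonoidHom.compHom'
        (DistribSMul.toAddMonoidHom V (𝓡.J e)).range.subtype).comp ρ.beta).comp
          (DistribSMul.toAddMonoidHom V e).range.subtype
  have hb : ∀ x y, b x y = ρ.beta x y := fun x y => rfl
  rw [← card_range_smul, ← card_range_smul]
  refine le_antisymm (card_le_of_pairing b.flip ?_) (card_le_of_pairing b ?_)
  · rintro ⟨_, y, rfl⟩ h
    refine Subtype.ext (ρ.nondeg_right _ fun z => ?_)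
    have h1 : ρ.beta (e • z) (𝓡.J e • y) = 0 := h ⟨_, z, rfl⟩
    rw [beta_smul_left, smul_smul, 𝓡.J_idem he] at h1
    exact h1
  · rintro ⟨_, x, rfl⟩ h
    refine Subtype.ext (ρ.nondeg_left _ fun z => ?_)
    have h1 : ρ.beta (e • x) (𝓡.J e • z) = 0 := h ⟨_, z, rfl⟩
    rw [← beta_smul_left, smul_smul, he] at h1
    exact h1

variable [Finite R]

/-- Up to squares, `|ιV|` for a symmetric idempotent `ι` is a product of such cardinalities
for primitive symmetric idempotents. -/
theorem exists_card_idemImage_eq {ι : R} (hι : 𝓡.IsSymmetricIdempotent ι) :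
    ∃ (c : ℕ) (L : List R), (∀ e ∈ L, IsPrimitiveIdem e ∧ 𝓡.IsSymmetricIdempotent e) ∧
      (ρ.idemImage ι).card = c ^ 2 * (L.map fun e => (ρ.idemImage e).card).prod := by
  induction h : Nat.card {x // ι * x = x} using Nat.strong_induction_on generalizing ι with
  | _ n ih =>
    subst h
    obtain ⟨hid, hiso⟩ := 𝓡.isSymmetricIdempotent_iff.1 hι
    by_cases h0 : ι = 0
    · exact ⟨1, [], by simp, by simp [h0, card_idemImage_zero]⟩
    obtain ⟨e, he, hιe, heι⟩ := exists_isPrimitiveIdem hid h0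
    have hei : e * (ι - e) = 0 := by rw [mul_sub, heι, he.idem, sub_self]
    have hie : (ι - e) * e = 0 := by rw [sub_mul, hιe, he.idem, sub_self]
    have hi : (ι - e) * (ι - e) = ι - e := by rw [mul_sub _ _ e, hie, sub_mul, hid, heι, sub_zero]
    have hJei : 𝓡.J e * 𝓡.J (ι - e) = 0 := by rw [← 𝓡.J_mul, hie, 𝓡.J_zero]
    have hJie : 𝓡.J (ι - e) * 𝓡.J e = 0 := by rw [← 𝓡.J_mul, hei, 𝓡.J_zero]
    have hsum : e + (ι - e) = ι := add_sub_cancel _ _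
    have hJsum : 𝓡.J e + 𝓡.J (ι - e) = 𝓡.J ι := by rw [← 𝓡.J_add, hsum]
    have hcard := ρ.card_idemImage_add he.idem hi hei hie
    rw [hsum] at hcard
    have hlt : Nat.card {x // (ι - e) * x = x} < Nat.card {x // ι * x = x} := by
      refine card_fixed_lt hid ?_ ?_ ?_
      · rw [mul_sub, hid, hιe]
      · rw [sub_mul, hid, heι]
      · intro h; exact he.ne_zero (by simpa using h)
    -- If `e` is isomorphic to `e^J`, it is itself symmetric, and cancellation makes `ι - e`
    -- symmetric. Otherwise a copy `g` of `e^J` is sought below `ι - e`, and `e + g` is removed.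
    by_cases hee : IdemIso e (𝓡.J e)
    · obtain ⟨c, L, hL, hc⟩ := ih _ hlt (𝓡.isSymmetricIdempotent_iff.2 ⟨hi,
        IdemIso.cancel he (𝓡.J_idem he.idem) hi (𝓡.J_idem hi) hie hJei hJie hee
          (by rwa [hsum, hJsum])⟩) rfl
      refine ⟨c, e :: L, ?_, ?_⟩
      · rintro x hx
        rcases List.mem_cons.1 hx with rfl | hx
        · exact ⟨he, 𝓡.isSymmetricIdempotent_iff.2 ⟨he.idem, hee⟩⟩
        · exact hL x hx
      · rw [hcard, hc, List.map_cons, List.prod_cons]; ring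
    · have hJe := 𝓡.isPrimitiveIdem_J he
      obtain ⟨a, b, h1, h2, h3, h4, h5, h6⟩ := hiso
      -- a copy of `J e` below `ι`
      have hf : IdemIso (𝓡.J e) (a * 𝓡.J e * b) ∧ a * 𝓡.J e * b * (a * 𝓡.J e * b) = a * 𝓡.J e * b := by
        have hlJ : 𝓡.J ι * 𝓡.J e = 𝓡.J e := by rw [← 𝓡.J_mul, heι]
        have hff : a * 𝓡.J e * b * (a * 𝓡.J e * b) = a * 𝓡.J e * b := by
          calc _ = a * 𝓡.J e * ((b * a) * 𝓡.J e) * b := by simp only [mul_assoc]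
            _ = _ := by rw [h2, hlJ, mul_assoc a, 𝓡.J_idem he.idem]
        refine ⟨IdemIso.of_mul (a := 𝓡.J e * b) (b := a * 𝓡.J e) (𝓡.J_idem he.idem) hff ?_ ?_, hff⟩
        · calc 𝓡.J e * b * (a * 𝓡.J e) = 𝓡.J e * ((b * a) * 𝓡.J e) := by simp only [mul_assoc]
            _ = _ := by rw [h2, hlJ, 𝓡.J_idem he.idem]
        · calc a * 𝓡.J e * (𝓡.J e * b) = a * (𝓡.J e * 𝓡.J e) * b := by simp only [mul_assoc]
            _ = _ := by rw [𝓡.J_idem he.idem]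
      obtain ⟨hf, hff⟩ := hf
      set f := a * 𝓡.J e * b with hfdef
      have hιf : ι * f = f := by rw [hfdef, ← mul_assoc, ← mul_assoc, h3]
      have hfι : f * ι = f := by rw [hfdef, mul_assoc, h6]
      have hfp := hJe.of_idemIso hf hff
      have hsplit : f * (f * e * f + f * (ι - e) * f) = f := by
        have : f * e * f + f * (ι - e) * f = f * ι * f := by noncomm_ring
        rw [this, hfι, hff, hff]
      -- By locality `f` factors through `e` or through `ι - e`. In the first case `f` would be
      -- isomorphic to the primitive `e`, against the assumption that `e` and `e^J` are not
      -- isomorphic.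
      have hinv : ∃ w, w * (f * (ι - e) * f) = f := by
        refine (hfp.left_inv_or (by rw [mul_assoc, hff]) (by rw [mul_assoc, hff])
          hsplit).resolve_left ?_
        rintro ⟨w, hw⟩
        obtain ⟨g, g1, g2, g3, g4⟩ := exists_idemIso_le hff he.idem hw
        have hg : g = e := by
          refine he.eq_of_le g g1 g2 g3 ?_
          exact (hfp.of_idemIso g4 g1).ne_zero
        rw [hg] at g4
        exact hee (g4.symm.trans hf.symm)
      obtain ⟨w, hw⟩ := hinv
      obtain ⟨g, g1, g2, g3, g4⟩ := exists_idemIso_le hff hi hw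
      have hgp := hfp.of_idemIso g4 g1
      have hJeg : IdemIso (𝓡.J e) g := hf.trans g4
      have heJg : IdemIso e (𝓡.J g) :=
        (𝓡.idemIso_J_J he.idem).symm.trans (𝓡.idemIso_J hJeg)
      have hgk : g * (ι - e - g) = 0 := by rw [mul_sub, g3, g1, sub_self]
      have hkg : (ι - e - g) * g = 0 := by rw [sub_mul, g2, g1, sub_self]
      have hk : (ι - e - g) * (ι - e - g) = ι - e - g := by
        rw [mul_sub _ _ g, hkg, sub_mul, hi, g3, sub_zero]
      have heg : e * g = 0 := by rw [← g2, ← mul_assoc, hei, zero_mul]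
      have hge : g * e = 0 := by rw [← g3, mul_assoc, hie, mul_zero]
      have hJgk : 𝓡.J g * 𝓡.J (ι - e - g) = 0 := by rw [← 𝓡.J_mul, hkg, 𝓡.J_zero]
      have hJkg : 𝓡.J (ι - e - g) * 𝓡.J g = 0 := by rw [← 𝓡.J_mul, hgk, 𝓡.J_zero]
      have hek : e * (ι - e - g) = 0 := by rw [mul_sub, hei, heg, sub_zero]
      have hke : (ι - e - g) * e = 0 := by rw [sub_mul, hie, hge, sub_zero]
      have hJek : 𝓡.J e * 𝓡.J (ι - e - g) = 0 := by rw [← 𝓡.J_mul, hke, 𝓡.J_zero]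
      have hJke : 𝓡.J (ι - e - g) * 𝓡.J e = 0 := by rw [← 𝓡.J_mul, hek, 𝓡.J_zero]
      have hJeg0 : 𝓡.J e * 𝓡.J g = 0 := by rw [← 𝓡.J_mul, hge, 𝓡.J_zero]
      have hJge0 : 𝓡.J g * 𝓡.J e = 0 := by rw [← 𝓡.J_mul, heg, 𝓡.J_zero]
      have hJk := 𝓡.J_idem hk
      have hs1 : g + (ι - e - g) = ι - e := add_sub_cancel _ _
      -- With `k = ι - e - g` there are decompositions `ι = e + g + k` and `ι^J = g^J + e^J + k^J`.
      -- Cancelling first `e ≅ g^J` and then `g ≅ e^J` leaves `k ≅ k^J`.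
      have c1 : IdemIso (ι - e) (𝓡.J e + 𝓡.J (ι - e - g)) := by
        refine IdemIso.cancel he (𝓡.J_idem g1) hi ?_ hie ?_ ?_ heJg ?_
        · rw [add_mul, mul_add, mul_add, 𝓡.J_idem he.idem, hJk, hJek, hJke]; simp
        · rw [mul_add, hJge0, hJgk, add_zero]
        · rw [add_mul, hJeg0, hJkg, add_zero]
        · have : 𝓡.J g + (𝓡.J e + 𝓡.J (ι - e - g)) = 𝓡.J ι := by
            rw [← 𝓡.J_add, ← 𝓡.J_add]; congr 1; abel
          rw [hsum, this]
          exact ⟨a, b, h1, h2, h3, h4, h5, h6⟩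
      have c2 : IdemIso (ι - e - g) (𝓡.J (ι - e - g)) :=
        IdemIso.cancel hgp (𝓡.J_idem he.idem) hk hJk hkg hJek hJke hJeg.symm (by rwa [hs1])
      have hlt2 : Nat.card {x // (ι - e - g) * x = x} < Nat.card {x // (ι - e) * x = x} := by
        refine card_fixed_lt hi ?_ ?_ ?_
        · rw [mul_sub, hi, g2]
        · rw [sub_mul, hi, g3]
        · intro h; exact hgp.ne_zero (by simpa using h)
      obtain ⟨c, L, hL, hc⟩ := ih _ (hlt2.trans hlt) (𝓡.isSymmetricIdempotent_iff.2 ⟨hk, c2⟩) rfl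
      -- Since `g ≅ e^J`, the orders of `gV`, `e^J V` and `eV` agree, so the pair `e`, `g`
      -- contributes a square.
      refine ⟨(ρ.idemImage e).card * c, L, hL, ?_⟩
      have hcard2 := ρ.card_idemImage_add g1 hk hgk hkg
      rw [hs1, ← ρ.card_idemImage_eq_of_idemIso (𝓡.J_idem he.idem) g1 hJeg,
        ρ.card_idemImage_J he.idem, hc] at hcard2
      rw [hcard, hcard2]; ring

/-- A primitive symmetric idempotent of `Mat_m(R)` comes from one of `R`. -/
theorem exists_card_matrix_idemImage_eq {m : ℕ} {e : Matrix (Fin m) (Fin m) R}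
    (he : IsPrimitiveIdem e) (hs : (𝓡.matrix m).IsSymmetricIdempotent e) :
    ∃ r, 𝓡.IsSymmetricIdempotent r ∧
      ((ρ.matrix m).idemImage e).card = (ρ.idemImage r).card := by
  -- The diagonal matrix units add up to `1`, so by locality `e` factors through one of them. It is
  -- therefore isomorphic to an idempotent `f` with a single diagonal entry `r`.
  obtain ⟨i, -, w, hw⟩ := he.exists_left_inv_of_sum Finset.univ
    (fun i => e * Matrix.single i i 1 * e) (fun i => by rw [mul_assoc, he.idem])
    ⟨e, by
      rw [← Finset.sum_mul, ← Finset.mul_sum]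
      have : ∑ i, Matrix.single i i (1 : R) = (1 : Matrix (Fin m) (Fin m) R) := by
        ext k l
        rw [Matrix.sum_apply, Finset.sum_eq_single k]
        · by_cases h : k = l
          · subst h; simp
          · simp [h, Matrix.one_apply_ne h]
        · intro j _ hj; simp [hj]
        · simp
      rw [this, mul_one, he.idem, he.idem]⟩
  have hp : Matrix.single i i (1 : R) * Matrix.single i i 1 = Matrix.single i i 1 := by simp
  obtain ⟨f, hff, h1, h2, h3⟩ := exists_idemIso_le he.idem hp hw
  have hE : ∀ A : Matrix (Fin m) (Fin m) R, Matrix.single i i (1 : R) * A = A →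
      A * Matrix.single i i (1 : R) = A → A = Matrix.single i i (A i i) := by
    intro A hA hA'
    rw [← hA', ← hA, Matrix.single_mul_mul_single]
    simp
  have hfr := hE f h1 h2
  set r := f i i with hr
  have hrr : r * r = r := by
    have h := congrFun (congrFun hff i) i
    rw [hfr, Matrix.single_mul_single_same] at h
    simpa using h
  have hiso : IdemIso f ((𝓡.matrix m).J f) :=
    (h3.symm.trans ((𝓡.matrix m).isSymmetricIdempotent_iff.1 hs).2).trans
      ((𝓡.matrix m).idemIso_J h3)
  rw [hfr, 𝓡.matrix_J_single] at hiso
  refine ⟨r, 𝓡.isSymmetricIdempotent_iff.2 ⟨hrr, ?_⟩, ?_⟩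
  · obtain ⟨a, b, k1, k2, k3, k4, k5, k6⟩ := hiso
    have hs1 : ∀ s : R, Matrix.single i i (1 : R) * Matrix.single i i s = Matrix.single i i s := by
      intro s; simp
    have hs2 : ∀ s : R, Matrix.single i i s * Matrix.single i i (1 : R) = Matrix.single i i s := by
      intro s; simp
    have ha := hE a (by rw [← k3, ← mul_assoc, hs1]) (by rw [← k4, mul_assoc, hs2])
    have hb := hE b (by rw [← k5, ← mul_assoc, hs1]) (by rw [← k6, mul_assoc, hs2])
    rw [ha, hb, Matrix.single_mul_single_same] at k1 k2
    refine IdemIso.of_mul (a := a i i) (b := b i i) hrr (𝓡.J_idem hrr) ?_ ?_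
    · simpa using congrFun (congrFun k1 i) i
    · simpa using congrFun (congrFun k2 i) i
  · rw [(ρ.matrix m).card_idemImage_eq_of_idemIso he.idem hff h3, hfr]
    have hsm : ∀ y : Fin m → V, Matrix.single i i r • y = Pi.single i (r • y i) := by
      intro y
      funext k
      rw [Matrix.Module.smul_apply, Finset.sum_eq_single i]
      · by_cases hk : i = k
        · subst hk; simp
        · simp [hk]
      · intro j _ hj; simp [Ne.symm hj]
      · simp
    have : (ρ.matrix m).idemImage (Matrix.single i i r) =
        (ρ.idemImage r).map ⟨_, Pi.single_injective (M := fun _ => V) i⟩ := by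
      ext x
      simp only [mem_idemImage, Finset.mem_map, Function.Embedding.coeFn_mk, hsm]
      constructor
      · rintro ⟨y, rfl⟩; exact ⟨_, ⟨y i, rfl⟩, rfl⟩
      · rintro ⟨_, ⟨y, rfl⟩, rfl⟩; exact ⟨Pi.single i y, by simp⟩
    rw [this, Finset.card_map]

/-- This brings the numbers `|ιV^m|` into the reach of the sign condition, which speaks of
idempotents of `R` only. The square is harmless, as its root is an integer. -/
theorem exists_card_matrix_idemImage_eq_sq_mul {m : ℕ} {ι : Matrix (Fin m) (Fin m) R}
    (hι : (𝓡.matrix m).IsSymmetricIdempotent ι) :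
    ∃ (c : ℕ) (L : List R), (∀ e ∈ L, 𝓡.IsSymmetricIdempotent e) ∧
      ((ρ.matrix m).idemImage ι).card = c ^ 2 * (L.map fun e => (ρ.idemImage e).card).prod := by
  obtain ⟨c, L, hL, h⟩ := (ρ.matrix m).exists_card_idemImage_eq hι
  suffices H : ∃ L' : List R, (∀ e ∈ L', 𝓡.IsSymmetricIdempotent e) ∧
      (L.map fun e => ((ρ.matrix m).idemImage e).card).prod =
        (L'.map fun e => (ρ.idemImage e).card).prod by
    obtain ⟨L', h1, h2⟩ := H
    exact ⟨c, L', h1, by rw [h, h2]⟩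
  clear h
  induction L with
  | nil => exact ⟨[], by simp, by simp⟩
  | cons e L ih =>
    obtain ⟨L', h1, h2⟩ := ih fun x hx => hL x (List.mem_cons_of_mem _ hx)
    have he := hL e List.mem_cons_self
    obtain ⟨r, hr, hc⟩ := ρ.exists_card_matrix_idemImage_eq he.1 he.2
    exact ⟨r :: L', List.forall_mem_cons.2 ⟨hr, h1⟩, by
      simp only [List.map_cons, List.prod_cons, hc, h2]⟩

end Rep

end CliffordWeil
end

noncomputable section
namespace CliffordWeil
variable {R M Φ : Type*} [Ring R] [AddCommGroup M] [AddCommGroup Φ]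

/-! ### Extension of cyclotomic conjugations -/

/-- Conjugations of a primitive root of unity extend to the compositum with a linearly disjoint
field. -/
theorem exists_ringAut_of_isPrimitiveRoot {k E : Type*} [Field k] [Field E] [Algebra k E]
    [CharZero k] {F K : IntermediateField k E} [FiniteDimensional k K] {n : ℕ} [NeZero n] {z : K}
    (hz : IsPrimitiveRoot z n) (hsup : IntermediateField.adjoin k {(z : E)} ⊔ F = K)
    (hinf : IntermediateField.adjoin k {(z : E)} ⊓ F = ⊥) {a : ℤ}
    (h : minpoly k (z : E) = minpoly k ((z : E) ^ a)) :
    ∃ σ : RingAut K, (∀ x : K, (x : E) ∈ F → σ x = x) ∧ σ z = z ^ a := by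
  have hFK : F ≤ K := hsup ▸ le_sup_right
  let L := F.restrict hFK
  let D := IntermediateField.adjoin k {z}
  have hD : IntermediateField.lift D = IntermediateField.adjoin k {(z : E)} :=
    IntermediateField.lift_adjoin_simple _ _ _
  have hL : IntermediateField.lift L = F := IntermediateField.lift_restrict hFK
  have h1 : D ⊔ L = ⊤ := by
    rw [← IntermediateField.lift_inj, IntermediateField.lift_sup, IntermediateField.lift_top, hD,
      hL, hsup]
  have h2 : D ⊓ L = ⊥ := by
    rw [← IntermediateField.lift_inj, IntermediateField.lift_inf, IntermediateField.lift_bot, hD,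
      hL, hinf]
  have : IsCyclotomicExtension {n} k D := hz.intermediateField_adjoin_isCyclotomicExtension k
  have : IsGalois k D := IsCyclotomicExtension.isGalois {n} k D
  have : IsGalois L K := IsGalois.sup_right D L h1
  let z' : D := ⟨z, IntermediateField.mem_adjoin_simple_self k _⟩
  have hmin : ∀ x : D, minpoly k x = minpoly k ((x : K) : E) := fun x =>
    (minpoly.algebraMap_eq (algebraMap D K).injective x).symm.trans
      (minpoly.algebraMap_eq (algebraMap K E).injective (algebraMap D K x)).symm
  obtain ⟨τ, hτ⟩ := IsConjRoot.exists_algEquiv (K := k) (x := z' ^ a) (y := z') (by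
    rw [IsConjRoot, hmin, hmin]; exact h.symm)
  -- Because `D ⊓ L = ⊥` and `D` is Galois over `k`, every automorphism of `D` over `k` is the
  -- restriction of one of `K` over `L`.
  obtain ⟨σ, hσ⟩ := IntermediateField.restrictRestrictAlgEquivMapHom_surjective D L h2 τ
  refine ⟨σ.toRingEquiv, fun x hx => ?_, ?_⟩
  · exact σ.commutes ⟨x, (IntermediateField.mem_restrict hFK x).2 hx⟩
  · have h := IntermediateField.restrictRestrictAlgEquivMapHom_apply D L σ z'
    rw [hσ, hτ] at h
    rw [← show ((z' ^ a : D) : K) = z ^ a from rfl, h]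
    rfl

/-! ### The conductor -/

namespace Rep

variable {𝓡 : FormRing R M Φ} {V : Type*} [AddCommGroup V] [Module R V] (ρ : Rep 𝓡 V)

theorem beta_mem_valueGroup (x y : V) : ρ.beta x y ∈ ρ.valueGroup :=
  AddSubgroup.subset_closure (Or.inl ⟨x, y, rfl⟩)

theorem rhoPhi_mem_valueGroup (φ : Φ) (x : V) : ρ.rhoPhi φ x ∈ ρ.valueGroup :=
  AddSubgroup.subset_closure (Or.inr ⟨φ, x, rfl⟩)

/-- As `ψ` is onto, every `ρ_M(n)` has the form `β(·, r ·)`. Consequently the forms of `R^m ⊗ ρ`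
take no values outside the value group of `ρ`. -/
theorem rhoM_mem_valueGroup (n : M) (x y : V) : ρ.rhoM n x y ∈ ρ.valueGroup := by
  obtain ⟨r, rfl⟩ := 𝓡.psi.surjective n
  rw [𝓡.psi_eq_act, ρ.rhoM_act]
  exact ρ.beta_mem_valueGroup _ _

theorem qVec_mem_valueGroup {m : ℕ} (p : 𝓡.matPhi m) (v : Fin m → V) :
    ρ.qVec p v ∈ ρ.valueGroup := by
  refine add_mem (sum_mem fun i _ => ρ.rhoPhi_mem_valueGroup _ _)
    (sum_mem fun i _ => sum_mem fun k _ => ?_)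
  split_ifs
  · exact ρ.rhoM_mem_valueGroup _ _ _
  · exact zero_mem _

theorem matRhoM_mem_valueGroup {m : ℕ} (X : Matrix (Fin m) (Fin m) M) (x y : Fin m → V) :
    ρ.matRhoM m X x y ∈ ρ.valueGroup := by
  rw [matRhoM_apply]
  exact sum_mem fun _ _ => sum_mem fun _ _ => ρ.rhoM_mem_valueGroup _ _ _

theorem rhoPhi_nsmul (φ : Φ) (x : V) (k : ℕ) :
    ρ.rhoPhi φ (k • x) = k • ρ.rhoPhi φ x + (k.choose 2) • ρ.rhoM (𝓡.lam φ) x x := by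
  have h0 : ρ.rhoPhi φ 0 = 0 := by simpa using ρ.rhoM_lam φ 0 0
  induction k with
  | zero => simp [h0]
  | succ k ih =>
    have h := ρ.rhoM_lam φ (k • x) x
    rw [eq_sub_iff_add_eq, eq_sub_iff_add_eq] at h
    rw [succ_nsmul x, ← h, ih, map_nsmul, AddMonoidHom.nsmul_apply, Nat.choose_succ_succ' k 1,
      Nat.choose_one_right, add_smul, add_smul, one_smul]
    abel

theorem conductor_nsmul {z : QZ} (hz : z ∈ ρ.valueGroup) : ρ.conductor • z = 0 := by
  have := card_nsmul_eq_zero' (x := (⟨z, hz⟩ : ρ.valueGroup))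
  exact congrArg Subtype.val this

/-- With `n = |V|`, bilinear values are killed by `n`. Expanding `ρ_Φ(φ)(n x) = 0` shows that `n
ρ_Φ(φ)(x)` is a multiple of a bilinear value, so `n²` kills everything, and the torsion of `ℚ/ℤ` of
given exponent is finite. -/
theorem finite_valueGroup [Finite V] : Finite ρ.valueGroup := by
  set n := Nat.card V
  have hn : 0 < n := Nat.card_pos
  have hV : ∀ x : V, n • x = 0 := fun x => card_nsmul_eq_zero'
  have hM : ∀ m (x y : V), n • ρ.rhoM m x y = 0 := by
    intro m x y
    rw [← map_nsmul, hV, map_zero]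
  have hle : ρ.valueGroup ≤ (DistribSMul.toAddMonoidHom QZ (n * n)).ker := by
    rw [valueGroup, AddSubgroup.closure_le]
    rintro z (⟨x, y, rfl⟩ | ⟨φ, x, rfl⟩)
    · change (n * n) • ρ.rhoM _ x y = 0
      rw [mul_smul, hM, smul_zero]
    · change (n * n) • ρ.rhoPhi φ x = 0
      have h := ρ.rhoPhi_nsmul φ x n
      have h0 : ρ.rhoPhi φ 0 = 0 := by simpa using ρ.rhoM_lam φ 0 0
      rw [hV, h0] at h
      have h2 := congrArg (fun z => n • z) h
      simp only [smul_zero, smul_add] at h2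
      rw [smul_comm n (n.choose 2), hM, smul_zero, add_zero] at h2
      rw [mul_smul, ← h2]
  exact Set.Finite.subset (AddCircle.finite_torsion (1 : ℚ) (mul_pos hn hn)) hle

theorem conductor_pos [Finite V] : 0 < ρ.conductor :=
  have := ρ.finite_valueGroup
  Nat.card_pos

/-! ### The field `K(ρ)` and the conjugations `γ_a` -/

section Field

variable [Fintype V] [DecidableEq V]

omit [DecidableEq V] in
theorem isPrimitiveRoot_zeta : IsPrimitiveRoot ρ.zeta ρ.conductor :=
  Complex.isPrimitiveRoot_exp _ ρ.conductor_pos.ne'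

theorem isPrimitiveRoot_zetaK : IsPrimitiveRoot ρ.zetaK ρ.conductor :=
  IsPrimitiveRoot.of_map_of_injective (f := algebraMap ρ.fieldK ℂ) ρ.isPrimitiveRoot_zeta
    (algebraMap ρ.fieldK ℂ).injective

omit [DecidableEq V] in
/-- The values of the characters `exp (2 π i z)` lie in `K(ρ)`. -/
theorem exists_pow_eq_expQZ {z : QZ} (hz : z ∈ ρ.valueGroup) : ∃ k : ℕ, expQZ z = ρ.zeta ^ k := by
  have : NeZero ρ.conductor := ⟨ρ.conductor_pos.ne'⟩
  obtain ⟨k, -, hk⟩ := ρ.isPrimitiveRoot_zeta.eq_pow_of_pow_eq_one (ξ := expQZ z) (by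
    have := expQZ_zsmul ρ.conductor z
    rw [natCast_zsmul, ρ.conductor_nsmul hz, expQZ_zero, zpow_natCast] at this
    exact this.symm)
  exact ⟨k, hk.symm⟩

omit [DecidableEq V] in
theorem finiteDimensional_cyclotomicField : FiniteDimensional ℚ ρ.cyclotomicField := by
  have : NeZero ρ.conductor := ⟨ρ.conductor_pos.ne'⟩
  exact IntermediateField.adjoin.finiteDimensional
    ((ρ.isPrimitiveRoot_zeta.isIntegral ρ.conductor_pos).tower_top)

theorem sqrtCard_sq (ι : R) : ρ.sqrtCard ι ^ 2 = ((ρ.idemImage ι).card : ℂ) := by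
  rw [sqrtCard, ← Complex.ofReal_pow, Real.sq_sqrt (Nat.cast_nonneg _), Complex.ofReal_natCast]

variable [Finite R]

instance finiteDimensional_fieldK : FiniteDimensional ℚ ρ.fieldK := by
  have h1 := ρ.finiteDimensional_cyclotomicField
  have h2 : FiniteDimensional ℚ ρ.rootField := by
    have : Finite {z | ∃ ι, 𝓡.IsSymmetricIdempotent ι ∧ z = ρ.sqrtCard ι} :=
      Set.Finite.subset (Set.finite_range ρ.sqrtCard) (by rintro z ⟨ι, -, rfl⟩; exact ⟨ι, rfl⟩)
    refine IntermediateField.finiteDimensional_adjoin ?_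
    rintro z ⟨ι, -, rfl⟩
    refine IsIntegral.of_pow (n := 2) (by norm_num) ?_
    rw [sqrtCard_sq]
    exact isIntegral_algebraMap (x := ((ρ.idemImage ι).card : ℚ)) |> fun h => by simpa using h
  exact IntermediateField.finiteDimensional_sup _ _

variable {F : IntermediateField ℚ ℂ}

/-- The complement condition makes `ℚ(ζ_f)` and `F` generate `K(ρ)` and meet in `ℚ`, while `ζ_f` and
`ζ_f ^ a` share the cyclotomic polynomial as minimal polynomial. So the choice in `gal` has a
solution to pick. -/
theorem exists_galGroup_zetaK (hF : ρ.IsComplement F) {a : ℤ}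
    (ha : IsCoprime a (ρ.conductor : ℤ)) :
    ∃ σ : ρ.galGroup F, (σ : RingAut ρ.fieldK) ρ.zetaK = ρ.zetaK ^ a := by
  have : NeZero ρ.conductor := ⟨ρ.conductor_pos.ne'⟩
  have hFr : F ≤ ρ.rootField := by rw [← hF.sup_eq]; exact le_sup_left
  have hFK : F ≤ ρ.fieldK := hFr.trans le_sup_right
  have hinf : ρ.cyclotomicField ⊓ F = ⊥ := by
    rw [← hF.inf_eq, ← inf_assoc, inf_eq_left.2 hFr, inf_comm]
  have hsup : ρ.cyclotomicField ⊔ F = ρ.fieldK := by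
    refine le_antisymm (sup_le le_sup_left hFK) (sup_le le_sup_left ?_)
    rw [← hF.sup_eq]
    exact sup_le le_sup_right (inf_le_right.trans le_sup_left)
  have hζ := ρ.isPrimitiveRoot_zeta
  obtain ⟨σ, h1, h2⟩ := exists_ringAut_of_isPrimitiveRoot ρ.isPrimitiveRoot_zetaK hsup hinf
    (a := a) ((Polynomial.cyclotomic_eq_minpoly_rat hζ ρ.conductor_pos).symm.trans
      (Polynomial.cyclotomic_eq_minpoly_rat
        (hζ.zpow_of_gcd_eq_one a (Int.isCoprime_iff_gcd_eq_one.1 ha)) ρ.conductor_pos))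
  exact ⟨⟨σ, h1⟩, h2⟩

theorem gal_zetaK (hF : ρ.IsComplement F) {a : ℤ} (ha : IsCoprime a (ρ.conductor : ℤ)) :
    (ρ.gal F a : RingAut ρ.fieldK) ρ.zetaK = ρ.zetaK ^ a :=
  Classical.epsilon_spec (ρ.exists_galGroup_zetaK hF ha)

omit [Finite R] in
theorem expQZ_mem_fieldK {z : QZ} (hz : z ∈ ρ.valueGroup) : expQZ z ∈ ρ.fieldK := by
  obtain ⟨k, hk⟩ := ρ.exists_pow_eq_expQZ hz
  rw [hk]
  exact pow_mem ρ.zetaK.2 k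

/-- All these values are powers of `ζ_f`. This is the link between conjugating matrices by `γ_a` and
multiplying the forms of `ρ` by `a`. -/
theorem gal_expQZ (hF : ρ.IsComplement F) {a : ℤ} (ha : IsCoprime a (ρ.conductor : ℤ)) {z : QZ}
    {x : ρ.fieldK} (hz : z ∈ ρ.valueGroup) (hx : (x : ℂ) = expQZ z) :
    (((ρ.gal F a : RingAut ρ.fieldK) x : ρ.fieldK) : ℂ) = expQZ (a • z) := by
  obtain ⟨k, hk⟩ := ρ.exists_pow_eq_expQZ hz
  have : x = ρ.zetaK ^ k := Subtype.ext (by rw [hx, hk]; rfl)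
  rw [this, map_pow, ρ.gal_zetaK hF ha, expQZ_zsmul, hk]
  change (ρ.zeta ^ a) ^ k = (ρ.zeta ^ k) ^ a
  rw [← zpow_natCast, ← zpow_mul, ← zpow_natCast, ← zpow_mul, mul_comm]

omit [Finite R] in
-- `γ_a` fixes the integer `|ιV|`, so it can only change the sign of its root, and the default `-1`
-- in `sign` is correct.
theorem gal_sqrtCardK (ι : R) (hι : 𝓡.IsSymmetricIdempotent ι) (a : ℤ) :
    (ρ.gal F a : RingAut ρ.fieldK) (ρ.sqrtCardK ι hι) =
      (ρ.sign F ι hι a : ρ.fieldK) * ρ.sqrtCardK ι hι := by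
  have hsq : ρ.sqrtCardK ι hι ^ 2 = ((ρ.idemImage ι).card : ρ.fieldK) :=
    Subtype.ext (by push_cast; exact ρ.sqrtCard_sq ι)
  have h : ((ρ.gal F a : RingAut ρ.fieldK) (ρ.sqrtCardK ι hι)) ^ 2 = ρ.sqrtCardK ι hι ^ 2 := by
    rw [← map_pow, hsq, map_natCast]
  unfold sign
  split_ifs with h1
  · rw [h1]; simp
  · rcases sq_eq_sq_iff_eq_or_eq_neg.1 h with h2 | h2
    · exact absurd h2 h1
    · rw [h2]; simp

/-- For symmetric idempotents of `Mat_m(R)`, the numbers `√|ιV^m|` lie in `K(ρ)`, and by the sign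
condition the product of their conjugates is the same as without conjugation. -/
theorem exists_sqrtCard_matrix {N : ℕ} {a : Fin N → ℤ} (hsign : ρ.SignCondition F a) {m : ℕ}
    {ι : Matrix (Fin m) (Fin m) R} (hι : (𝓡.matrix m).IsSymmetricIdempotent ι) :
    ∃ s : ρ.fieldK, (s : ℂ) = (ρ.matrix m).sqrtCard ι ∧
      ∏ i, (ρ.gal F (a i) : RingAut ρ.fieldK) s = s ^ N := by
  obtain ⟨c, L, hL, hc⟩ := ρ.exists_card_matrix_idemImage_eq_sq_mul hι
  have hcs : (ρ.matrix m).sqrtCard ι = c * (L.map ρ.sqrtCard).prod := by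
    rw [sqrtCard, hc]
    push_cast
    rw [Real.sqrt_mul (by positivity), Real.sqrt_sq (by positivity)]
    push_cast
    congr 1
    clear hc hL
    induction L with
    | nil => simp
    | cons e L ih =>
      simp only [List.map_cons, List.prod_cons] at ih ⊢
      rw [Real.sqrt_mul (by positivity), Complex.ofReal_mul, ih]
      rfl
  rw [hcs]
  clear hcs hc
  suffices H : ∃ s : ρ.fieldK, (s : ℂ) = (L.map ρ.sqrtCard).prod ∧
      ∏ i, (ρ.gal F (a i) : RingAut ρ.fieldK) s = s ^ N by
    obtain ⟨s, h1, h2⟩ := H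
    refine ⟨c * s, by push_cast; rw [h1], ?_⟩
    simp only [map_mul, Finset.prod_mul_distrib, map_natCast, h2, mul_pow]
    simp
  induction L with
  | nil => exact ⟨1, by simp, by simp⟩
  | cons e L ih =>
    obtain ⟨s, h1, h2⟩ := ih fun x hx => hL x (List.mem_cons_of_mem _ hx)
    have he := hL e List.mem_cons_self
    refine ⟨ρ.sqrtCardK e he * s, ?_, ?_⟩
    · rw [List.map_cons, List.prod_cons, ← h1]; rfl
    · simp only [map_mul, Finset.prod_mul_distrib, h2, ρ.gal_sqrtCardK, mul_pow]
      rw [← Int.cast_prod, hsign e he]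
      simp

end Field

end Rep

end CliffordWeil
end

noncomputable section
namespace CliffordWeil

/-! ### Conjugate polynomials as images of tensors -/

section Conjugate

variable {K : Type*} [Field K] {Γ : Subgroup (RingAut K)} {X : Type*}

theorem conjMonomial_add (e e' : X × Γ →₀ ℕ) :
    conjMonomial Γ (e + e') = conjMonomial Γ e * conjMonomial Γ e' := by
  classical
  funext k
  exact Finsupp.prod_add_index' (fun _ => pow_zero _) (fun _ _ _ => pow_add _ _ _)

theorem conjMonomial_zero : conjMonomial Γ (0 : X × Γ →₀ ℕ) = 1 := rfl

theorem conjMonomial_single (x : X) (α : Γ) :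
    conjMonomial Γ (Finsupp.single (x, α) 1) = fun k => (α : RingAut K) (k x) := by
  funext k
  simp [conjMonomial]

theorem conjMonomial_sum {ι : Type*} (s : Finset ι) (x : ι → X) (α : ι → Γ) :
    conjMonomial Γ (∑ i ∈ s, Finsupp.single (x i, α i) 1) =
      fun k => ∏ i ∈ s, (α i : RingAut K) (k (x i)) := by
  classical
  induction s using Finset.induction_on with
  | empty => simp [conjMonomial_zero]; rfl
  | insert i s hi ih =>
    rw [Finset.sum_insert hi, conjMonomial_add, ih, conjMonomial_single]
    funext k
    simp [Finset.prod_insert hi]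

/-- The monomials are multiplicative functions. -/
def conjMonomialHom (e : X × Γ →₀ ℕ) : (X → K) →* K where
  toFun := conjMonomial Γ e
  map_one' := by simp [conjMonomial]
  map_mul' k l := by simp [conjMonomial, mul_pow, Finsupp.prod_mul]

theorem finite_ringAut [CharZero K] [FiniteDimensional ℚ K] : Finite (RingAut K) :=
  Finite.of_injective (fun σ : RingAut K => σ.toRingHom.toRatAlgHom) fun _ _ h =>
    RingEquiv.ext fun x => DFunLike.congr_fun h x

/-- A primitive element of `K` over `ℚ` works, since ring automorphisms are `ℚ`-linear. -/
theorem exists_separating [CharZero K] [FiniteDimensional ℚ K] :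
    ∃ x : K, ∀ σ τ : RingAut K, σ x = τ x → σ = τ := by
  refine ⟨(Field.powerBasisOfFiniteOfSeparable ℚ K).gen, fun σ τ h => RingEquiv.ext fun x => ?_⟩
  have := (Field.powerBasisOfFiniteOfSeparable ℚ K).algHom_ext
    (f := σ.toRingHom.toRatAlgHom) (g := τ.toRingHom.toRatAlgHom) h
  exact DFunLike.congr_fun this x

theorem eq_of_prod_X_sub_C_pow_eq {ι : Type*} [Fintype ι] {b : ι → K}
    (hb : Function.Injective b) {n n' : ι → ℕ}
    (h : ∏ i, (Polynomial.X - Polynomial.C (b i)) ^ n i =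
      ∏ i, (Polynomial.X - Polynomial.C (b i)) ^ n' i) : n = n' := by
  classical
  have key : ∀ (n : ι → ℕ) (j : ι),
      (∏ i, (Polynomial.X - Polynomial.C (b i)) ^ n i).roots.count (b j) = n j := by
    intro n j
    rw [Polynomial.roots_prod _ _ (Finset.prod_ne_zero_iff.2 fun i _ =>
      pow_ne_zero _ (Polynomial.X_sub_C_ne_zero _))]
    simp only [Polynomial.roots_pow, Polynomial.roots_X_sub_C]
    rw [Multiset.count_bind]
    change ∑ i, Multiset.count (b j) (n i • {b i}) = n j
    simp [Multiset.count_nsmul, Multiset.count_singleton, hb.eq_iff]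
  funext j
  rw [← key n j, h, key]

/-- Set all variables but `x_w` to `1` and `x_w` to `n + x` with `x` separating. The resulting
products agree for all `n ∈ ℕ`, hence as polynomials in `n`, and the exponents are the
multiplicities of the distinct roots `-α(x)`. -/
theorem conjMonomial_injective [CharZero K] [FiniteDimensional ℚ K] :
    Function.Injective (conjMonomial Γ (X := X)) := by
  classical
  have := finite_ringAut (K := K)
  have := Fintype.ofFinite Γ
  intro e e' h
  obtain ⟨x, hx⟩ := exists_separating (K := K)
  have key : ∀ (e : X × Γ →₀ ℕ) (w : X) (c : K),
      conjMonomial Γ e (Function.update 1 w c) = ∏ α : Γ, ((α : RingAut K) c) ^ e (w, α) := by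
    intro e w c
    rw [conjMonomial, Finsupp.prod_of_support_subset
      (s := e.support ∪ (Finset.univ.image fun α => (w, α))) _ (Finset.subset_union_left) _
      (fun _ _ => pow_zero _), ← Finset.prod_subset (Finset.subset_union_right)]
    · rw [Finset.prod_image (fun _ _ _ _ h => (Prod.mk.inj h).2)]
      simp
    · intro p _ hp
      have : p.1 ≠ w := by
        rintro rfl
        exact hp (by simp)
      simp [Function.update_of_ne this]
  ext ⟨w, α⟩
  have hpoly : ∏ α : Γ, (Polynomial.X - Polynomial.C (-(α : RingAut K) x)) ^ e (w, α) =
      ∏ α : Γ, (Polynomial.X - Polynomial.C (-(α : RingAut K) x)) ^ e' (w, α) := by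
    refine Polynomial.eq_of_infinite_eval_eq _ _ (Set.infinite_of_injective_forall_mem
      (f := fun n : ℕ => (n : K)) Nat.cast_injective fun n => ?_)
    have h1 := congrFun h (Function.update 1 w ((n : K) + x))
    rw [key, key] at h1
    simpa [Polynomial.eval_prod] using h1
  exact congrFun (eq_of_prod_X_sub_C_pow_eq (fun σ τ hst =>
    Subtype.ext (hx _ _ (neg_injective hst))) hpoly) α

variable [Fintype X] {N : ℕ} (g : Fin N → Γ)

/-- The map that sends the basis vector of a word `y ∈ X^N` to the monomial
`∏ i, x_{y i} ∘ g i`. -/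
def conjEval : ((Fin N → X) → K) →ₗ[K] ((X → K) → K) where
  toFun t k := ∑ y, t y * ∏ i, (g i : RingAut K) (k (y i))
  map_add' t t' := by funext k; simp [add_mul, Finset.sum_add_distrib]
  map_smul' c t := by funext k; simp [Finset.mul_sum, mul_assoc]

theorem conjEval_apply (t : (Fin N → X) → K) (k : X → K) :
    conjEval g t k = ∑ y, t y * ∏ i, (g i : RingAut K) (k (y i)) := rfl

/-- The exponent of the monomial of a word. -/
def wordExponent (y : Fin N → X) : X × Γ →₀ ℕ := ∑ i, Finsupp.single (y i, g i) 1

theorem conjEval_eq_sum (t : (Fin N → X) → K) :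
    conjEval g t = ∑ y, t y • conjMonomial Γ (wordExponent g y) := by
  funext k
  rw [conjEval_apply, Finset.sum_apply]
  simp [wordExponent, conjMonomial_sum]

omit [Fintype X] in
theorem wordExponent_apply (y : Fin N → X) (p : X × Γ) :
    wordExponent g y p = Nat.card {i // (y i, g i) = p} := by
  classical
  rw [Nat.card_eq_fintype_card, Fintype.card_subtype, wordExponent, Finsupp.finsetSum_apply,
    Finset.card_filter]
  exact Finset.sum_congr rfl fun i _ => by rw [Finsupp.single_apply]

theorem exists_equiv_of_card_fiber {ι ι' A : Type*} [Finite ι] {f : ι → A} {f' : ι' → A}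
    (h' : ∀ a, Finite {i // f' i = a})
    (h : ∀ a, Nat.card {i // f i = a} = Nat.card {i // f' i = a}) :
    ∃ π : ι ≃ ι', ∀ i, f' (π i) = f i :=
  ⟨Equiv.ofFiberEquiv fun a => (Finite.equivFinOfCardEq (h a)).trans (Finite.equivFin _).symm,
    fun i => Equiv.ofFiberEquiv_map _ i⟩

omit [Fintype X] in
theorem exists_perm_of_wordExponent_eq {y y' : Fin N → X}
    (h : wordExponent g y = wordExponent g y') :
    ∃ π : Equiv.Perm (Fin N), g ∘ π = g ∧ y' ∘ π = y := by
  obtain ⟨π, hπ⟩ := exists_equiv_of_card_fiber (f := fun i => (y i, g i))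
    (f' := fun i => (y' i, g i)) (fun _ => inferInstance) (fun p => by
      rw [← wordExponent_apply, ← wordExponent_apply, h])
  exact ⟨π, funext fun i => congrArg Prod.snd (hπ i), funext fun i => congrArg Prod.fst (hπ i)⟩

/-- `Σ p, Fin (e p)` lists the factors of the monomial. For each `α` there are as many factors
conjugated by `α` as positions with `g i = α`, so factors can be assigned to positions. -/
theorem exists_wordExponent_eq {e : X × Γ →₀ ℕ}
    (he : ∀ α, ∑ x, e (x, α) = Nat.card {i // g i = α}) : ∃ y, wordExponent g y = e := by
  let E : ∀ α : Γ, {s : Σ p : X × Γ, Fin (e p) // s.1.2 = α} ≃ Σ x : X, Fin (e (x, α)) := fun α =>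
    { toFun := fun s => ⟨s.1.1.1, Fin.cast (by obtain ⟨⟨⟨x, β⟩, k⟩, rfl⟩ := s; rfl) s.1.2⟩
      invFun := fun s => ⟨⟨(s.1, α), s.2⟩, rfl⟩
      left_inv := by rintro ⟨⟨⟨x, β⟩, k⟩, rfl⟩; rfl
      right_inv := fun _ => rfl }
  obtain ⟨π, hπ⟩ := exists_equiv_of_card_fiber (f := g)
    (f' := fun s : Σ p : X × Γ, Fin (e p) => s.1.2) (fun α => Finite.of_equiv _ (E α).symm)
    (fun α => by rw [← he, Nat.card_congr (E α), Nat.card_eq_fintype_card]; simp)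
  refine ⟨fun i => (π i).1.1, Finsupp.ext fun p => ?_⟩
  rw [wordExponent_apply]
  have h1 : ∀ i, ((π i).1.1, g i) = p ↔ (π i).1 = p := fun i => by rw [← hπ i]
  rw [Nat.card_congr (Equiv.subtypeEquiv π (q := fun s => s.1 = p) h1),
    Nat.card_congr (Equiv.sigmaSubtype p), Nat.card_eq_fintype_card, Fintype.card_fin]

theorem conjHomogeneous_eq_range :
    conjHomogeneous Γ X (fun α => Nat.card {i // g i = α}) = LinearMap.range (conjEval g) := by
  classical
  apply le_antisymm
  · rw [conjHomogeneous, Submodule.span_le]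
    rintro _ ⟨e, he, rfl⟩
    obtain ⟨y, rfl⟩ := exists_wordExponent_eq g he
    refine ⟨Pi.single y 1, ?_⟩
    rw [conjEval_eq_sum, Finset.sum_eq_single y]
    · simp
    · intro z _ hz; simp [Pi.single_eq_of_ne hz]
    · simp
  · rintro _ ⟨t, rfl⟩
    rw [conjEval_eq_sum]
    refine Submodule.sum_mem _ fun y _ => Submodule.smul_mem _ _ (Submodule.subset_span
      ⟨_, fun α => ?_, rfl⟩)
    change _ = Nat.card {i // g i = α}
    rw [Nat.card_eq_fintype_card, Fintype.card_subtype, wordExponent]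
    simp only [Finsupp.finsetSum_apply, Finsupp.single_apply, Prod.mk.injEq]
    rw [Finset.sum_comm, Finset.card_filter]
    refine Finset.sum_congr rfl fun i _ => ?_
    by_cases h : g i = α <;> simp [h]

theorem conjEval_comp_perm {π : Equiv.Perm (Fin N)} (hπ : g ∘ π = g) (t : (Fin N → X) → K) :
    conjEval g (fun y => t (y ∘ π)) = conjEval g t := by
  classical
  funext k
  rw [conjEval_apply, conjEval_apply]
  refine Fintype.sum_equiv (Equiv.arrowCongr π.symm (Equiv.refl X)) _ _ fun y => ?_
  have h : ∏ i, (g i : RingAut K) (k (y i)) = ∏ i, (g i : RingAut K) (k (y (π i))) := by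
    rw [← Equiv.prod_comp π]
    exact Finset.prod_congr rfl fun i _ => by rw [← congrFun hπ i]; rfl
  rw [h]
  rfl

/-- Words with the same monomial differ by a permutation that fixes `g`, so `t` is constant on them.
By independence of distinct multiplicative maps, each coefficient vanishes, and it is a positive
integer times a value of `t`. -/
theorem eq_zero_of_conjEval_eq_zero [CharZero K] [FiniteDimensional ℚ K] {t : (Fin N → X) → K}
    (hsymm : ∀ π : Equiv.Perm (Fin N), g ∘ π = g → ∀ y, t (y ∘ π) = t y)
    (h : conjEval g t = 0) : t = 0 := by
  classical
  have hli : LinearIndependent K (conjMonomial Γ (X := X)) := by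
    refine (linearIndependent_monoidHom (X → K) K).comp conjMonomialHom fun e e' he => ?_
    exact conjMonomial_injective (congrArg (fun φ : (X → K) →* K => (φ : (X → K) → K)) he)
  rw [conjEval_eq_sum, ← Finset.sum_fiberwise_of_maps_to (g := wordExponent g)
    (t := Finset.univ.image (wordExponent g)) (fun y hy => Finset.mem_image_of_mem _ hy)] at h
  have h2 : ∑ e ∈ Finset.univ.image (wordExponent g),
      (∑ y with wordExponent g y = e, t y) • conjMonomial Γ e = 0 := by
    refine Eq.trans (Finset.sum_congr rfl fun e _ => ?_) h
    rw [Finset.sum_smul]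
    exact Finset.sum_congr rfl fun y hy => by rw [(Finset.mem_filter.1 hy).2]
  funext y
  have h3 := linearIndependent_iff'.1 hli _ _ h2 (wordExponent g y)
    (Finset.mem_image_of_mem _ (Finset.mem_univ y))
  rw [Finset.sum_congr rfl (g := fun _ => t y) (fun z hz => by
    obtain ⟨π, h4, h5⟩ := exists_perm_of_wordExponent_eq g (Finset.mem_filter.1 hz).2
    rw [← h5, hsymm π h4]), Finset.sum_const, nsmul_eq_mul] at h3
  refine (mul_eq_zero.1 h3).resolve_left ?_
  exact Nat.cast_ne_zero.2 (Finset.card_pos.2 ⟨y, by simp⟩).ne'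

/-- The matrix `⨂ i, g_i(A)` on words. -/
def conjTensor (A : Matrix X X K) : Matrix (Fin N → X) (Fin N → X) K :=
  Matrix.of fun w y => ∏ i, (g i : RingAut K) (A (w i) (y i))

omit [Fintype X] in
theorem conjTensor_apply (A : Matrix X X K) (w y : Fin N → X) :
    conjTensor g A w y = ∏ i, (g i : RingAut K) (A (w i) (y i)) := rfl

theorem conjTensor_mulVec_prod (A : Matrix X X K) (k : X → K) :
    (conjTensor g A).mulVec (fun y => ∏ i, (g i : RingAut K) (k (y i))) =
      fun w => ∏ i, (g i : RingAut K) (A.mulVec k (w i)) := by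
  classical
  funext w
  simp only [Matrix.mulVec, dotProduct, conjTensor_apply, map_sum, map_mul]
  rw [Finset.prod_univ_sum, Fintype.piFinset_univ]
  exact Finset.sum_congr rfl fun y _ => Finset.prod_mul_distrib.symm

theorem conjTensor_mul (A B : Matrix X X K) :
    conjTensor g (A * B) = conjTensor g A * conjTensor g B := by
  classical
  ext w y
  rw [Matrix.mul_apply]
  simp only [conjTensor_apply, Matrix.mul_apply, map_sum, map_mul]
  rw [Finset.prod_univ_sum, Fintype.piFinset_univ]
  exact Finset.sum_congr rfl fun y _ => Finset.prod_mul_distrib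

omit [Fintype X] in
theorem conjTensor_one [DecidableEq X] :
    conjTensor g (1 : Matrix X X K) = 1 := by
  ext w y
  rw [conjTensor_apply, Matrix.one_apply]
  split_ifs with h
  · subst h; simp
  · obtain ⟨i, hi⟩ := Function.ne_iff.1 h
    exact Finset.prod_eq_zero (Finset.mem_univ i) (by rw [Matrix.one_apply_ne hi, map_zero])

/-- This turns substitution in functions into a linear action on tensors. -/
theorem conjEval_vecMul (A : Matrix X X K) (t : (Fin N → X) → K) (k : X → K) :
    conjEval g t (Matrix.vecMul k A) = conjEval g ((conjTensor g A).mulVec t) k := by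
  classical
  simp only [conjEval_apply, Matrix.mulVec, dotProduct, Matrix.vecMul, map_sum, map_mul,
    conjTensor_apply]
  simp only [Finset.prod_univ_sum, Fintype.piFinset_univ, Finset.mul_sum, Finset.sum_mul]
  rw [Finset.sum_comm]
  refine Finset.sum_congr rfl fun w _ => Finset.sum_congr rfl fun y _ => ?_
  rw [Finset.prod_mul_distrib]
  ring

theorem conjTensor_mulVec_comp_perm {π : Equiv.Perm (Fin N)} (hπ : g ∘ π = g) (A : Matrix X X K)
    (t : (Fin N → X) → K) (w : Fin N → X) :
    (conjTensor g A).mulVec t (w ∘ π) = (conjTensor g A).mulVec (fun y => t (y ∘ π)) w := by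
  classical
  simp only [Matrix.mulVec, dotProduct, conjTensor_apply]
  refine (Fintype.sum_equiv (Equiv.arrowCongr π.symm (Equiv.refl X)) _ _ fun y => ?_).symm
  congr 1
  rw [← Equiv.prod_comp π]
  exact Finset.prod_congr rfl fun i _ => by rw [← Function.comp_apply (f := g), hπ]; rfl

/-- Every invariant of `G` comes from a tensor that is fixed by all `⨂ i, g_i(A)`, `A ∈ G`. -/
theorem conjInvariants_eq_map [DecidableEq X] [CharZero K] [FiniteDimensional ℚ K]
    (G : Subgroup (GL X K)) (f : (X → K) → K) :
    f ∈ conjInvariants Γ G (fun α => Nat.card {i // g i = α}) ↔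
      ∃ t : (Fin N → X) → K, (∀ A ∈ G, (conjTensor g (A : Matrix X X K)).mulVec t = t) ∧
        conjEval g t = f := by
  classical
  constructor
  · rintro ⟨h1, h2⟩
    rw [conjHomogeneous_eq_range] at h1
    obtain ⟨t, rfl⟩ := h1
    let P : Finset (Equiv.Perm (Fin N)) := Finset.univ.filter fun π => g ∘ π = g
    -- Averaging over the stabilizer of `g` keeps the image and makes the tensor uniquely determined
    -- by it.
    let s : (Fin N → X) → K := (P.card : K)⁻¹ • ∑ π ∈ P, fun y => t (y ∘ π)
    have hP : (P.card : K) ≠ 0 :=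
      Nat.cast_ne_zero.2 (Finset.card_pos.2 ⟨1, by simp [P]⟩).ne'
    have hs : conjEval g s = conjEval g t := by
      rw [map_smul, map_sum, Finset.sum_congr rfl fun π hπ =>
        conjEval_comp_perm g (Finset.mem_filter.1 hπ).2 t, Finset.sum_const, ← Nat.cast_smul_eq_nsmul K,
        smul_smul, inv_mul_cancel₀ hP, one_smul]
    have hsymm : ∀ π : Equiv.Perm (Fin N), g ∘ π = g → ∀ y, s (y ∘ π) = s y := by
      intro π hπ y
      simp only [s, Pi.smul_apply, Finset.sum_apply]
      congr 1
      refine Finset.sum_equiv (Equiv.mulLeft π) (fun σ => ?_) (fun σ _ => rfl)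
      simp only [P, Finset.mem_filter, Finset.mem_univ, true_and, Equiv.coe_mulLeft,
        Equiv.Perm.coe_mul, ← Function.comp_assoc, hπ]
    refine ⟨s, fun A hA => ?_, hs⟩
    rw [← sub_eq_zero]
    -- The difference is again symmetric. Its image is zero by invariance under `A⁻¹`, as the action
    -- on functions involves an inverse.
    refine eq_zero_of_conjEval_eq_zero g (fun π hπ y => ?_) ?_
    · rw [Pi.sub_apply, Pi.sub_apply, conjTensor_mulVec_comp_perm g hπ, hsymm π hπ]
      congr 2
      funext y
      exact hsymm π hπ y
    · rw [map_sub, hs, sub_eq_zero]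
      funext k
      rw [← conjEval_vecMul, hs]
      have := h2 A⁻¹ (inv_mem hA) k
      rwa [inv_inv] at this
  · rintro ⟨t, ht, rfl⟩
    refine ⟨by rw [conjHomogeneous_eq_range]; exact ⟨t, rfl⟩, fun A hA k => ?_⟩
    rw [conjEval_vecMul, ht _ (inv_mem hA)]

end Conjugate

end CliffordWeil
end

noncomputable section
namespace CliffordWeil
variable {R M Φ : Type*} [Ring R] [AddCommGroup M] [AddCommGroup Φ]

/-! ### Codes over matrix rings -/

namespace Rep

section Codes

variable {𝓡 : FormRing R M Φ} {V : Type*} [AddCommGroup V] [Module R V] {m : ℕ}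

theorem matrix_beta (ρ : Rep 𝓡 V) (x y : Fin m → V) :
    (ρ.matrix m).beta x y = ∑ j, ρ.beta (x j) (y j) := ρ.matRhoM_psi_one x y

theorem single_smul_eq (j k : Fin m) (r : R) (x : Fin m → V) :
    Matrix.single j k r • x = Pi.single j (r • x k) := by
  funext l
  rw [Matrix.Module.smul_apply, Finset.sum_eq_single k]
  · by_cases hl : j = l
    · subst hl; simp
    · simp [hl]
  · intro i _ hi; simp [Ne.symm hi]
  · simp

/-- The code `C^m ≤ V^m` over the matrix ring. -/
def powCode (m : ℕ) (C : Submodule R V) : Submodule (Matrix (Fin m) (Fin m) R) (Fin m → V) where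
  carrier := {c | ∀ j, c j ∈ C}
  add_mem' hx hy j := add_mem (hx j) (hy j)
  zero_mem' _ := zero_mem _
  smul_mem' A x hx j := by
    rw [Matrix.Module.smul_apply]
    exact sum_mem fun k _ => C.smul_mem _ (hx k)

theorem mem_powCode {C : Submodule R V} {x : Fin m → V} : x ∈ powCode m C ↔ ∀ j, x j ∈ C :=
  Iff.rfl

theorem isCodeOfType_powCode {ρ : Rep 𝓡 V} {C : Submodule R V} (hC : ρ.IsCodeOfType C) :
    (ρ.matrix m).IsCodeOfType (powCode m C) where
  selfDual x := by
    simp only [matrix_beta, mem_powCode]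
    constructor
    · intro hx c hc
      exact Finset.sum_eq_zero fun j _ => (hC.selfDual _).1 (hx j) _ (hc j)
    · intro h j
      rw [hC.selfDual]
      intro c hc
      have := h (Pi.single j c) fun k => by
        rcases eq_or_ne k j with rfl | hk
        · simpa using hc
        · simp [Pi.single_eq_of_ne hk]
      rwa [Finset.sum_eq_single j (fun k _ hk => by simp [Pi.single_eq_of_ne hk]) (by simp),
        Pi.single_eq_same] at this
  isotropic p c hc := by
    -- The mixed terms of `Φ_m` vanish by self-duality alone, because `ρ_M(n)(x, y) = β(x, r y)` for
    -- some `r`.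
    have hM : ∀ n : M, ∀ x ∈ C, ∀ y ∈ C, ρ.rhoM n x y = 0 := by
      intro n x hx y hy
      obtain ⟨r, rfl⟩ := 𝓡.psi.surjective n
      rw [𝓡.psi_eq_act, ρ.rhoM_act, one_smul]
      exact (hC.selfDual x).1 hx _ (C.smul_mem r hy)
    change ρ.qVec p c = 0
    rw [qVec, Finset.sum_eq_zero fun j _ => hC.isotropic _ _ (hc j), zero_add]
    refine Finset.sum_eq_zero fun i _ => Finset.sum_eq_zero fun k _ => ?_
    split_ifs
    · exact hM _ _ (hc i) _ (hc k)
    · rfl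

/-- Morita equivalence: matrix units move any coordinate to position `o` and back, so a submodule is
determined by its vectors supported there. The hypothesis `1 ≤ m` provides that position. -/
theorem exists_eq_powCode (hm : 1 ≤ m) {ρ : Rep 𝓡 V}
    {D : Submodule (Matrix (Fin m) (Fin m) R) (Fin m → V)} (hD : (ρ.matrix m).IsCodeOfType D) :
    ∃ C : Submodule R V, ρ.IsCodeOfType C ∧ D = powCode m C := by
  let o : Fin m := ⟨0, hm⟩
  let C : Submodule R V :=
    { carrier := {c | Pi.single o c ∈ D}
      add_mem' := fun hx hy => by
        simp only [Set.mem_ofPred_eq, Pi.single_add] at hx hy ⊢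
        exact add_mem hx hy
      zero_mem' := by simp
      smul_mem' := fun r c hc => by
        have := D.smul_mem (Matrix.single o o r) hc
        rwa [single_smul_eq, Pi.single_eq_same] at this }
  have hCmem : ∀ c, c ∈ C ↔ Pi.single o c ∈ D := fun c => Iff.rfl
  have hDC : ∀ x, x ∈ D ↔ ∀ j, x j ∈ C := by
    intro x
    constructor
    · intro hx j
      have := D.smul_mem (Matrix.single o j 1) hx
      rwa [single_smul_eq, one_smul] at this
    · intro h
      have hx : x = ∑ j, Matrix.single j o (1 : R) • Pi.single o (x j) := by
        simp only [single_smul_eq, Pi.single_eq_same, one_smul]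
        exact (Finset.univ_sum_single x).symm
      rw [hx]
      exact sum_mem fun j _ => D.smul_mem _ (h j)
  refine ⟨C, ⟨fun x => ?_, fun φ c hc => ?_⟩, Submodule.ext hDC⟩
  · have hb : ∀ d : Fin m → V, (ρ.matrix m).beta (Pi.single o x) d = ρ.beta x (d o) := by
      intro d
      rw [matrix_beta, Finset.sum_eq_single o (fun k _ hk => by simp [Pi.single_eq_of_ne hk])
        (by simp), Pi.single_eq_same]
    rw [hCmem, hD.selfDual]
    simp only [hb]
    refine ⟨fun h c hc => ?_, fun h d hd => h _ ((hDC d).1 hd o)⟩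
    simpa using h _ hc
  -- Placing `φ` at position `o` forces the matrix part `λ(φ)` there; evaluated on a vector
  -- supported at `o`, this gives `ρ_Φ(φ)`.
  · let p : 𝓡.matPhi m := ⟨(Pi.single o φ, Matrix.single o o (𝓡.lam φ)), fun i => by
      rcases eq_or_ne i o with rfl | hi
      · simp
      · simp [Ne.symm hi], fun i j => by
      change Matrix.single o o (𝓡.lam φ) j i = 𝓡.tau (Matrix.single o o (𝓡.lam φ) i j)
      by_cases h : o = i ∧ o = j
      · obtain ⟨rfl, rfl⟩ := h; simp [𝓡.tau_lam]
      · rw [Matrix.single_apply_of_ne _ _ _ _ _ h,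
          Matrix.single_apply_of_ne _ _ _ _ _ (fun h' => h h'.symm), map_zero]⟩
    have h : ρ.qVec p (Pi.single o c) = 0 := hD.isotropic p _ hc
    rw [qVec, Finset.sum_eq_single o (fun k _ hk => by
      simp only [p, Pi.single_eq_of_ne hk, map_zero]; rfl) (by simp)] at h
    rw [Finset.sum_eq_zero fun i _ => Finset.sum_eq_zero fun k _ => ?_, add_zero] at h
    · simpa [p] using h
    · split_ifs with hik
      · rcases eq_or_ne i o with rfl | hi
        · rw [Pi.single_eq_of_ne hik.ne', map_zero]
        · rw [Pi.single_eq_of_ne hi, map_zero]; rfl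
      · rfl

end Codes

/-! ### Generators of the Clifford-Weil groups -/

section Generators

variable {𝓡 : FormRing R M Φ} {V : Type*} [AddCommGroup V] [Module R V] {m N : ℕ}

theorem smul_column (A : Matrix (Fin m) (Fin m) R) (y : Fin m → Fin N → V) (i : Fin N) :
    A • (fun j => y j i) = fun j => (A • y) j i := by
  funext j
  simp [Matrix.Module.smul_apply]

omit [AddCommGroup V] in
theorem eq_iff_column {x y : Fin m → Fin N → V} :
    x = y ↔ ∀ i, (fun j => x j i) = fun j => y j i :=
  ⟨fun h i => by rw [h], fun h => funext fun j => funext fun i => congrFun (h i) j⟩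

theorem twist_matrix_beta (ρ : Rep 𝓡 V) (a : Fin N → ℤ)
    (ha : ∀ i, IsCoprime (a i) (ρ.conductor : ℤ)) (x y : Fin m → Fin N → V) :
    ((ρ.twist a ha).matrix m).beta x y =
      ∑ i, a i • (ρ.matrix m).beta (fun j => x j i) (fun j => y j i) := by
  simp only [matrix_beta, Finset.smul_sum]
  rw [Finset.sum_comm]
  rfl

theorem twist_matrix_rhoPhi (ρ : Rep 𝓡 V) (a : Fin N → ℤ)
    (ha : ∀ i, IsCoprime (a i) (ρ.conductor : ℤ)) (p : 𝓡.matPhi m) (x : Fin m → Fin N → V) :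
    ((ρ.twist a ha).matrix m).rhoPhi p x =
      ∑ i, a i • (ρ.matrix m).rhoPhi p (fun j => x j i) := by
  change (ρ.twist a ha).qVec p x = ∑ i, a i • ρ.qVec p fun j => x j i
  have h1 : ∀ φ v, (ρ.twist a ha).rhoPhi φ v = ∑ i, a i • ρ.rhoPhi φ (v i) := fun _ _ => rfl
  have h2 : ∀ n v w, (ρ.twist a ha).rhoM n v w = ∑ i, a i • ρ.rhoM n (v i) (w i) :=
    fun _ _ _ => rfl
  have h3 : ∀ (P : Prop) [Decidable P] (f : Fin N → QZ), (if P then ∑ i, f i else 0) =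
      ∑ i, if P then f i else 0 := by
    intro P _ f; split_ifs <;> simp
  simp only [qVec, h1, h2, h3, smul_add, Finset.smul_sum, Finset.sum_add_distrib, smul_ite,
    smul_zero]
  congr 1
  · exact Finset.sum_comm
  · exact (Finset.sum_comm.trans (Finset.sum_congr rfl fun j _ => Finset.sum_comm)).symm

variable [Fintype V] [DecidableEq V]

/-- Only `x = ι y` can contribute to the sum. In this form the entry is a condition and a character
value, both of which split over the columns of `V^(m × N)`. -/
theorem opH_apply (ρ : Rep 𝓡 V) {ι : R} (hι : ι * ι = ι) (v : R) (y w : V) :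
    ρ.opH ι v y w = (ρ.sqrtCard ι)⁻¹ *
      if (1 - ι) • y = (1 - ι) • w then expQZ (ρ.beta (ι • y) (v • w)) else 0 := by
  have h : (1 - ι) * ι = 0 := by rw [sub_mul, one_mul, hι, sub_self]
  have h' : ι * (1 - ι) = 0 := by rw [mul_sub, mul_one, hι, sub_self]
  have h1 : (1 - ι) * (1 - ι) = 1 - ι := by rw [mul_sub, h, mul_one, sub_zero]
  rw [opH, Matrix.of_apply]
  congr 1
  rw [Finset.sum_eq_single (ι • y)]
  · congr 1
    have : y = ι • y + (1 - ι) • y := by rw [← add_smul, add_sub_cancel, one_smul]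
    nth_rewrite 1 [this]
    rw [add_right_inj]
  · intro x hx hxy
    rw [ρ.mem_idemImage_iff hι] at hx
    rw [if_neg]
    rintro rfl
    apply hxy
    rw [smul_add, hx, smul_smul, h', zero_smul, add_zero]
  · intro h; exact absurd (ρ.mem_idemImage.2 ⟨y, rfl⟩) h

theorem sqrtCard_twist_matrix (ρ : Rep 𝓡 V) (a : Fin N → ℤ)
    (ha : ∀ i, IsCoprime (a i) (ρ.conductor : ℤ)) {ι : Matrix (Fin m) (Fin m) R}
    (hι : ι * ι = ι) :
    ((ρ.twist a ha).matrix m).sqrtCard ι = (ρ.matrix m).sqrtCard ι ^ N := by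
  have hc : (((ρ.twist a ha).matrix m).idemImage ι).card = ((ρ.matrix m).idemImage ι).card ^ N := by
    rw [← Fintype.card_piFinset_const]
    refine Finset.card_equiv (Equiv.piComm _) fun x => ?_
    rw [Fintype.mem_piFinset, mem_idemImage_iff _ hι, eq_iff_column]
    refine forall_congr' fun i => ?_
    rw [mem_idemImage_iff _ hι, ← smul_column]
    rfl
  rw [sqrtCard, hc, sqrtCard, Nat.cast_pow, ← Complex.ofReal_pow,
    ← Real.sqrt_sq (pow_nonneg (Real.sqrt_nonneg ((ρ.matrix m).idemImage ι).card) N), ← pow_mul,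
    mul_comm N, pow_mul, Real.sq_sqrt (Nat.cast_nonneg _)]

/-- The operators that generate the Clifford-Weil group. -/
def generators (ρ : Rep 𝓡 V) : Set (Matrix V V ℂ) :=
  {B | (∃ r, B = ρ.opM r) ∨ (∃ φ, B = ρ.opD φ) ∨ ∃ ι u v, 𝓡.IsSymIdem ι u v ∧ B = ρ.opH ι v}

variable (ρ : Rep 𝓡 V) (F : IntermediateField ℚ ℂ) (a : Fin N → ℤ)

/-- The matrix `⨂ i, γ_{a_i}(A)` on `ℂ[V^(m × N)]`. -/
def galTensor (A : Matrix (Fin m → V) (Fin m → V) ρ.fieldK) :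
    Matrix (Fin m → Fin N → V) (Fin m → Fin N → V) ℂ :=
  Matrix.of fun w y => algebraMap ρ.fieldK ℂ
    (conjTensor (fun i => ρ.gal F (a i)) A (fun i j => w j i) (fun i j => y j i))

theorem galTensor_apply (A : Matrix (Fin m → V) (Fin m → V) ρ.fieldK) (w y : Fin m → Fin N → V) :
    ρ.galTensor F a A w y = ∏ i, algebraMap ρ.fieldK ℂ
      ((ρ.gal F (a i) : RingAut ρ.fieldK) (A (fun j => w j i) (fun j => y j i))) := by
  rw [galTensor, Matrix.of_apply, conjTensor_apply, map_prod]

theorem algebraMap_ite {K : IntermediateField ℚ ℂ} (σ : RingAut K) (P : Prop) [Decidable P]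
    (x : K) : algebraMap K ℂ (σ (if P then x else 0)) = if P then algebraMap K ℂ (σ x) else 0 := by
  split_ifs <;> simp

variable [Finite R] {ρ F a} (hF : ρ.IsComplement F)
  (ha : ∀ i, IsCoprime (a i) (ρ.conductor : ℤ))

omit [Finite R] in
-- Here and in the cases of `opD` and `opH`, a single matrix over `K(ρ)` realizes a generator for
-- `R^m ⊗ ρ`, and its conjugate tensor is the generator for `R^m ⊗ ρ^𝐚` with the same parameters.
-- Every generator on either side arises in this way.
theorem exists_galTensor_eq_opM (r : (Matrix (Fin m) (Fin m) R)ˣ) :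
    ∃ A : Matrix (Fin m → V) (Fin m → V) ρ.fieldK, A.map (algebraMap ρ.fieldK ℂ) =
      (ρ.matrix m).opM r ∧ ρ.galTensor F a A = ((ρ.twist a ha).matrix m).opM r := by
  classical
  refine ⟨Matrix.of fun y w => if y = (r : Matrix (Fin m) (Fin m) R) • w then 1 else 0, ?_, ?_⟩
  · ext y w
    simp [opM]
  · ext w y
    rw [galTensor_apply, opM]
    simp only [Matrix.of_apply, algebraMap_ite, map_one]
    rw [Finset.prod_ite_zero]
    simp only [Finset.mem_univ, true_imp_iff, Finset.prod_const_one, smul_column, ← eq_iff_column]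

include hF in
theorem exists_galTensor_eq_opD (p : 𝓡.matPhi m) :
    ∃ A : Matrix (Fin m → V) (Fin m → V) ρ.fieldK, A.map (algebraMap ρ.fieldK ℂ) =
      (ρ.matrix m).opD p ∧ ρ.galTensor F a A = ((ρ.twist a ha).matrix m).opD p := by
  classical
  refine ⟨Matrix.diagonal fun w =>
    ⟨expQZ (ρ.qVec p w), ρ.expQZ_mem_fieldK (ρ.qVec_mem_valueGroup p w)⟩, ?_, ?_⟩
  · rw [Matrix.diagonal_map (map_zero _)]; rfl
  · ext w y
    rw [galTensor_apply, opD]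
    simp only [Matrix.diagonal_apply, algebraMap_ite]
    rw [Finset.prod_ite_zero]
    simp only [Finset.mem_univ, true_imp_iff, ← eq_iff_column]
    congr 1
    rw [twist_matrix_rhoPhi, expQZ_sum]
    refine Finset.prod_congr rfl fun i _ =>
      ρ.gal_expQZ hF (ha i) (ρ.qVec_mem_valueGroup p fun j => w j i) ?_
    rfl

include hF in
theorem exists_galTensor_eq_opH (hsign : ρ.SignCondition F a) {ι u v : Matrix (Fin m) (Fin m) R}
    (hι : (𝓡.matrix m).IsSymIdem ι u v) :
    ∃ A : Matrix (Fin m → V) (Fin m → V) ρ.fieldK, A.map (algebraMap ρ.fieldK ℂ) =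
      (ρ.matrix m).opH ι v ∧ ρ.galTensor F a A = ((ρ.twist a ha).matrix m).opH ι v := by
  classical
  -- The sign condition enters here only: it makes the conjugates of `s` multiply to `s ^ N`, the
  -- normalizing factor on `V^(m × N)`.
  obtain ⟨s, hs, hprod⟩ := ρ.exists_sqrtCard_matrix hsign ⟨u, v, hι⟩
  have hmem : ∀ y w, (ρ.matrix m).beta y w ∈ ρ.valueGroup :=
    fun y w => ρ.matRhoM_mem_valueGroup _ _ _
  refine ⟨Matrix.of fun y w => s⁻¹ * if (1 - ι) • y = (1 - ι) • w then
    ⟨expQZ ((ρ.matrix m).beta (ι • y) (v • w)), ρ.expQZ_mem_fieldK (hmem _ _)⟩ else 0, ?_, ?_⟩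
  · ext y w
    rw [opH_apply _ hι.idem, Matrix.map_apply, Matrix.of_apply, map_mul, map_inv₀, ← hs,
      apply_ite (algebraMap ρ.fieldK ℂ), map_zero]
    rfl
  · ext w y
    rw [galTensor_apply, opH_apply _ hι.idem, sqrtCard_twist_matrix ρ a ha hι.idem, ← hs]
    simp only [Matrix.of_apply, map_mul, map_inv₀, Finset.prod_mul_distrib]
    congr 1
    · rw [Finset.prod_inv_distrib, ← map_prod, hprod, map_pow]; rfl
    · simp only [algebraMap_ite]
      rw [Finset.prod_ite_zero]
      simp only [Finset.mem_univ, true_imp_iff, smul_column, ← eq_iff_column]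
      congr 1
      rw [twist_matrix_beta, expQZ_sum]
      refine Finset.prod_congr rfl fun i _ => ρ.gal_expQZ hF (ha i)
        (hmem (fun j => (ι • w) j i) (fun j => (v • y) j i)) ?_
      rfl

end Generators

end Rep

end CliffordWeil
end

noncomputable section
namespace CliffordWeil
variable {R M Φ : Type*} [Ring R] [AddCommGroup M] [AddCommGroup Φ]

namespace Rep

/-! ### Comparison of the tensors fixed by the two groups -/

section Fixed

variable {𝓡 : FormRing R M Φ} {V : Type*} [AddCommGroup V] [Module R V] {m N : ℕ}
  [Fintype V] [DecidableEq V]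

theorem exists_galTensor_mem_generators [Finite R] {ρ : Rep 𝓡 V} {F : IntermediateField ℚ ℂ}
    (hF : ρ.IsComplement F) {a : Fin N → ℤ} (ha : ∀ i, IsCoprime (a i) (ρ.conductor : ℤ))
    (hsign : ρ.SignCondition F a) {B : Matrix (Fin m → V) (Fin m → V) ℂ}
    (hB : B ∈ (ρ.matrix m).generators) :
    ∃ A : Matrix (Fin m → V) (Fin m → V) ρ.fieldK, A.map (algebraMap ρ.fieldK ℂ) = B ∧
      ρ.galTensor F a A ∈ ((ρ.twist a ha).matrix m).generators := by
  rcases hB with ⟨r, rfl⟩ | ⟨p, rfl⟩ | ⟨ι, u, v, h, rfl⟩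
  · obtain ⟨A, h1, h2⟩ := exists_galTensor_eq_opM (F := F) ha r
    exact ⟨A, h1, Or.inl ⟨r, h2⟩⟩
  · obtain ⟨A, h1, h2⟩ := exists_galTensor_eq_opD hF ha p
    exact ⟨A, h1, Or.inr (Or.inl ⟨p, h2⟩)⟩
  · obtain ⟨A, h1, h2⟩ := exists_galTensor_eq_opH hF ha hsign h
    exact ⟨A, h1, Or.inr (Or.inr ⟨ι, u, v, h, h2⟩)⟩

theorem exists_galTensor_eq_of_mem_generators [Finite R] {ρ : Rep 𝓡 V} {F : IntermediateField ℚ ℂ}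
    (hF : ρ.IsComplement F) {a : Fin N → ℤ} (ha : ∀ i, IsCoprime (a i) (ρ.conductor : ℤ))
    (hsign : ρ.SignCondition F a) {B : Matrix (Fin m → Fin N → V) (Fin m → Fin N → V) ℂ}
    (hB : B ∈ ((ρ.twist a ha).matrix m).generators) :
    ∃ A : Matrix (Fin m → V) (Fin m → V) ρ.fieldK,
      A.map (algebraMap ρ.fieldK ℂ) ∈ (ρ.matrix m).generators ∧ ρ.galTensor F a A = B := by
  rcases hB with ⟨r, rfl⟩ | ⟨p, rfl⟩ | ⟨ι, u, v, h, rfl⟩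
  · obtain ⟨A, h1, h2⟩ := exists_galTensor_eq_opM (F := F) ha r
    exact ⟨A, Or.inl ⟨r, h1⟩, h2⟩
  · obtain ⟨A, h1, h2⟩ := exists_galTensor_eq_opD hF ha p
    exact ⟨A, Or.inr (Or.inl ⟨p, h1⟩), h2⟩
  · obtain ⟨A, h1, h2⟩ := exists_galTensor_eq_opH hF ha hsign h
    exact ⟨A, Or.inr (Or.inr ⟨ι, u, v, h, h1⟩), h2⟩

variable (ρ : Rep 𝓡 V) (F : IntermediateField ℚ ℂ) (a : Fin N → ℤ)

/-- A tensor over `K(ρ)`, seen as a vector of the group algebra `ℂ[V^(m × N)]`. -/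
def toGroupAlgebra (t : (Fin N → Fin m → V) → ρ.fieldK) : (Fin m → Fin N → V) → ℂ :=
  fun y => algebraMap ρ.fieldK ℂ (t fun i j => y j i)

theorem toGroupAlgebra_injective :
    Function.Injective (ρ.toGroupAlgebra (m := m) (N := N)) := by
  intro t t' h
  funext y
  exact (algebraMap ρ.fieldK ℂ).injective (congrFun h fun j i => y i j)

theorem galTensor_mulVec (A : Matrix (Fin m → V) (Fin m → V) ρ.fieldK)
    (t : (Fin N → Fin m → V) → ρ.fieldK) :
    (ρ.galTensor F a A).mulVec (ρ.toGroupAlgebra t) =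
      ρ.toGroupAlgebra ((conjTensor (fun i => ρ.gal F (a i)) A).mulVec t) := by
  funext w
  simp only [toGroupAlgebra, Matrix.mulVec, dotProduct, map_sum, map_mul]
  exact Fintype.sum_equiv (Equiv.piComm _) _ _ fun y => rfl

theorem galTensor_mul (A B : Matrix (Fin m → V) (Fin m → V) ρ.fieldK) :
    ρ.galTensor F a (A * B) = ρ.galTensor F a A * ρ.galTensor F a B := by
  ext w y
  simp only [galTensor, Matrix.of_apply, conjTensor_mul, Matrix.mul_apply, map_sum, map_mul]
  exact (Fintype.sum_equiv (Equiv.piComm _) _ _ fun y => rfl).symm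

theorem galTensor_one :
    ρ.galTensor F a (1 : Matrix (Fin m → V) (Fin m → V) ρ.fieldK) = 1 := by
  ext w y
  simp only [galTensor, Matrix.of_apply, conjTensor_one, Matrix.one_apply]
  have : ((fun i j => w j i) = fun i j => y j i) ↔ w = y :=
    ⟨fun h => funext fun j => funext fun i => congrFun (congrFun h i) j, fun h => by rw [h]⟩
  simp only [this]
  split_ifs <;> simp

/-- If `⨂ i, γ_{a_i}(A)` is invertible, then so is `A`. -/
theorem isUnit_of_galTensor (hN : 0 < N) {A : Matrix (Fin m → V) (Fin m → V) ρ.fieldK}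
    (h : IsUnit (ρ.galTensor F a A)) : IsUnit A := by
  by_contra hA
  have hdet : A.det = 0 := by
    rw [Matrix.isUnit_iff_isUnit_det, isUnit_iff_ne_zero] at hA
    exact not_not.1 hA
  obtain ⟨k, hk0, hk⟩ := Matrix.exists_mulVec_eq_zero_iff.2 hdet
  obtain ⟨x, hx⟩ := Function.ne_iff.1 hk0
  -- The tensor product of the conjugates of a kernel vector `k` is killed by the conjugate tensor
  -- of `A`, yet it is nonzero at the constant word of any `x` with `k x ≠ 0`.
  let t : (Fin N → Fin m → V) → ρ.fieldK := fun y =>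
    ∏ i, (ρ.gal F (a i) : RingAut ρ.fieldK) (k (y i))
  have ht : (conjTensor (fun i => ρ.gal F (a i)) A).mulVec t = 0 := by
    rw [conjTensor_mulVec_prod, hk]
    funext w
    exact Finset.prod_eq_zero (Finset.mem_univ ⟨0, hN⟩) (map_zero _)
  have h0 : (ρ.galTensor F a A).mulVec (ρ.toGroupAlgebra t) = 0 := by
    rw [galTensor_mulVec, ht]
    funext y
    exact map_zero _
  have h1 : ρ.toGroupAlgebra t = 0 :=
    Matrix.mulVec_injective_of_isUnit h (h0.trans (Matrix.mulVec_zero _).symm)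
  have h2 : t (fun _ => x) = 0 := by
    have := congrFun h1 fun j _ => x j
    exact (algebraMap ρ.fieldK ℂ).injective (this.trans (map_zero _).symm)
  obtain ⟨i, -, hi⟩ := Finset.prod_eq_zero_iff.1 h2
  exact hx ((ρ.gal F (a i) : RingAut ρ.fieldK).injective (hi.trans (map_zero _).symm))

variable {ρ F a}

/-- A tensor is fixed by all `⨂ i, γ_{a_i}(A)`, `A ∈ 𝒞_m(ρ)`, if and only if it is fixed by
`𝒞(R^m ⊗ ρ^𝐚)`. -/
theorem forall_conjTensor_mulVec_eq_iff [Finite R] (hF : ρ.IsComplement F)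
    (ha : ∀ i, IsCoprime (a i) (ρ.conductor : ℤ)) (hsign : ρ.SignCondition F a)
    (t : (Fin N → Fin m → V) → ρ.fieldK) :
    (∀ A ∈ (ρ.matrix m).cliffordWeilOver ρ.fieldK, (conjTensor (fun i => ρ.gal F (a i))
        (A : Matrix (Fin m → V) (Fin m → V) ρ.fieldK)).mulVec t = t) ↔
      ∀ g ∈ ((ρ.twist a ha).matrix m).cliffordWeil,
        (g : Matrix (Fin m → Fin N → V) (Fin m → Fin N → V) ℂ).mulVec (ρ.toGroupAlgebra t) =
          ρ.toGroupAlgebra t := by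
  constructor
  · intro h g hg
    induction hg using Subgroup.closure_induction with
    | mem g hg =>
      obtain ⟨A, h1, h2⟩ := exists_galTensor_eq_of_mem_generators hF ha hsign hg
      -- For `N = 0` the tensor says nothing about the invertibility of `A`, but then there is only
      -- one word and the operator is the identity.
      rcases Nat.eq_zero_or_pos N with rfl | hN
      · have : (g : Matrix (Fin m → Fin 0 → V) (Fin m → Fin 0 → V) ℂ) = 1 := by
          rw [← h2]
          ext w y
          have : w = y := Subsingleton.elim _ _
          subst this
          rw [galTensor_apply]
          simp
        rw [this, Matrix.one_mulVec]
      · have hu : IsUnit A := ρ.isUnit_of_galTensor F a hN (h2 ▸ g.isUnit)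
        obtain ⟨A, rfl⟩ := hu
        rw [← h2, galTensor_mulVec, h A (Subgroup.subset_closure h1)]
    | one => exact Matrix.one_mulVec _
    | mul g g' _ _ hg hg' => rw [Units.val_mul, ← Matrix.mulVec_mulVec, hg', hg]
    | inv g _ hg =>
      nth_rewrite 1 [← hg]
      rw [Matrix.mulVec_mulVec, ← Units.val_mul, inv_mul_cancel]
      exact Matrix.one_mulVec _
  · intro h A hA
    -- `cliffordWeilOver` is a preimage and not given by generators over `K(ρ)`. The induction
    -- therefore runs in the complex group and lifts each element to `K(ρ)` along the way.
    have key : ∀ B ∈ (ρ.matrix m).cliffordWeil, ∃ A : GL (Fin m → V) ρ.fieldK,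
        Matrix.GeneralLinearGroup.map (algebraMap ρ.fieldK ℂ) A = B ∧
        (conjTensor (fun i => ρ.gal F (a i))
          (A : Matrix (Fin m → V) (Fin m → V) ρ.fieldK)).mulVec t = t := by
      intro B hB
      induction hB using Subgroup.closure_induction with
      | mem B hB =>
        obtain ⟨A, h1, h2⟩ := exists_galTensor_mem_generators hF ha hsign hB
        have hu : IsUnit A := by
          have hB : IsUnit (B : Matrix (Fin m → V) (Fin m → V) ℂ).det :=
            (Matrix.isUnit_iff_isUnit_det _).1 B.isUnit
          rw [← h1, ← RingHom.mapMatrix_apply, ← RingHom.map_det, isUnit_iff_ne_zero,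
            map_ne_zero] at hB
          rw [Matrix.isUnit_iff_isUnit_det, isUnit_iff_ne_zero]
          exact hB
        obtain ⟨A, rfl⟩ := hu
        refine ⟨A, Units.ext h1, ρ.toGroupAlgebra_injective ?_⟩
        rw [← galTensor_mulVec]
        let g : GL (Fin m → Fin N → V) ℂ :=
          ⟨ρ.galTensor F a A, ρ.galTensor F a (A⁻¹ : GL (Fin m → V) ρ.fieldK).val,
            by rw [← galTensor_mul, ← Units.val_mul, mul_inv_cancel, Units.val_one, galTensor_one],
            by rw [← galTensor_mul, ← Units.val_mul, inv_mul_cancel, Units.val_one, galTensor_one]⟩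
        exact h g (Subgroup.subset_closure h2)
      | one => exact ⟨1, map_one _, by rw [Units.val_one, conjTensor_one, Matrix.one_mulVec]⟩
      | mul B B' _ _ hB hB' =>
        obtain ⟨A, h1, h2⟩ := hB
        obtain ⟨A', h1', h2'⟩ := hB'
        exact ⟨A * A', by rw [map_mul, h1, h1'], by
          rw [Units.val_mul, conjTensor_mul, ← Matrix.mulVec_mulVec, h2', h2]⟩
      | inv B _ hB =>
        obtain ⟨A, h1, h2⟩ := hB
        refine ⟨A⁻¹, by rw [map_inv, h1], ?_⟩
        nth_rewrite 1 [← h2]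
        rw [Matrix.mulVec_mulVec, ← conjTensor_mul, ← Units.val_mul, inv_mul_cancel, Units.val_one,
          conjTensor_one, Matrix.one_mulVec]
    obtain ⟨A', h1, h2⟩ := key _ hA
    have : A' = A := by
      refine Units.ext (Matrix.ext fun x y => (algebraMap ρ.fieldK ℂ).injective ?_)
      exact congrArg (fun B : GL (Fin m → V) ℂ => (B : Matrix (Fin m → V) (Fin m → V) ℂ) x y) h1
    rw [← this, h2]

end Fixed

end Rep

/-! ### Descent of spans from `ℂ` to `K(ρ)` -/

/-- Linear descent: a vector over a subfield that lies in the span of vectors over the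
subfield lies in their span over the subfield. -/
theorem mem_span_of_map_mem_span {K L ι ι' κ : Type*} [Field K] [Field L] [Algebra K L]
    (e : ι' ≃ ι) {v : κ → ι → K} {t : ι → K} (h : (fun i => algebraMap K L (t (e i))) ∈
      Submodule.span L (Set.range fun j => fun i => algebraMap K L (v j (e i)))) :
    t ∈ Submodule.span K (Set.range v) := by
  obtain ⟨π, hπ⟩ := (Algebra.linearMap K L).exists_leftInverse_of_injective
    (LinearMap.ker_eq_bot.2 (algebraMap K L).injective)
  have hπ1 : ∀ x, π (algebraMap K L x) = x := fun x => LinearMap.congr_fun hπ x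
  -- The retraction `π` of `L` onto `K` is only `K`-linear; the free factor `c` absorbs scalars of
  -- `L` in the induction.
  have key : ∀ x ∈ Submodule.span L (Set.range fun j => fun i => algebraMap K L (v j (e i))),
      ∀ c : L, (fun i => π (c * x (e.symm i))) ∈ Submodule.span K (Set.range v) := by
    intro x hx
    induction hx using Submodule.span_induction with
    | mem x hx =>
      obtain ⟨j, rfl⟩ := hx
      intro c
      have : (fun i => π (c * algebraMap K L (v j (e (e.symm i))))) = π c • v j := by
        funext i
        rw [e.apply_symm_apply, mul_comm, ← Algebra.smul_def, map_smul, Pi.smul_apply,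
          smul_eq_mul, smul_eq_mul, mul_comm]
      rw [this]
      exact Submodule.smul_mem _ _ (Submodule.subset_span ⟨j, rfl⟩)
    | zero => intro c; simp only [Pi.zero_apply, mul_zero, map_zero]; exact zero_mem _
    | add x y _ _ hx hy =>
      intro c
      simp only [Pi.add_apply, mul_add, map_add]
      exact add_mem (hx c) (hy c)
    | smul b x _ hx =>
      intro c
      simp only [Pi.smul_apply, smul_eq_mul, ← mul_assoc]
      exact hx (c * b)
  have := key _ h 1
  simpa only [one_mul, hπ1, e.apply_symm_apply] using this

theorem map_mem_span_of_mem_span {K L ι ι' κ : Type*} [Field K] [Field L] [Algebra K L]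
    (e : ι' ≃ ι) {v : κ → ι → K} {t : ι → K} (h : t ∈ Submodule.span K (Set.range v)) :
    (fun i => algebraMap K L (t (e i))) ∈
      Submodule.span L (Set.range fun j => fun i => algebraMap K L (v j (e i))) := by
  induction h using Submodule.span_induction with
  | mem x hx =>
    obtain ⟨j, rfl⟩ := hx
    exact Submodule.subset_span ⟨j, rfl⟩
  | zero => simp only [Pi.zero_apply, map_zero]; exact zero_mem _
  | add x y _ _ hx hy => simp only [Pi.add_apply, map_add]; exact add_mem hx hy
  | smul c x _ hx =>
    simp only [Pi.smul_apply, smul_eq_mul, map_mul]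
    exact Submodule.smul_mem _ (algebraMap K L c) hx

/-! ### Codes as tensors over `K(ρ)` -/

namespace Rep

variable {𝓡 : FormRing R M Φ} {V : Type*} [AddCommGroup V] [Module R V] {m N : ℕ}
  [Fintype V] [DecidableEq V] (ρ : Rep 𝓡 V) (F : IntermediateField ℚ ℂ) (a : Fin N → ℤ)

open Classical in
/-- The indicator of `C^m` as a tensor over `K(ρ)`. -/
def codeTensor (m : ℕ) (C : Submodule R (Fin N → V)) : (Fin N → Fin m → V) → ρ.fieldK :=
  fun y => if ∀ j, (fun i => y i j) ∈ C then 1 else 0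

theorem conjEval_codeTensor (C : Submodule R (Fin N → V)) :
    conjEval (fun i => ρ.gal F (a i)) (ρ.codeTensor m C) = ρ.ccwe F a m C := by
  classical
  funext k
  rw [conjEval_apply, ccwe, Finset.sum_filter]
  refine Fintype.sum_equiv (Equiv.piComm _) _ _ fun y => ?_
  simp only [codeTensor, ite_mul, one_mul, zero_mul]
  rfl

theorem toGroupAlgebra_codeTensor (ha : ∀ i, IsCoprime (a i) (ρ.conductor : ℤ))
    (C : Submodule R (Fin N → V)) :
    ρ.toGroupAlgebra (ρ.codeTensor m C) = ((ρ.twist a ha).matrix m).fwe (powCode m C) := by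
  classical
  funext y
  rw [fwe, Set.indicator_apply, toGroupAlgebra, codeTensor, apply_ite (algebraMap ρ.fieldK ℂ),
    map_one, map_zero]
  exact if_congr Iff.rfl rfl rfl

end Rep

end CliffordWeil

end

theorem mainTheorem3 {R M Φ V : Type*} [Ring R] [Finite R] [AddCommGroup M] [AddCommGroup Φ]
    (𝓡 : CliffordWeil.FormRing R M Φ) [AddCommGroup V] [Module R V] [Fintype V] [DecidableEq V]
    (ρ : CliffordWeil.Rep 𝓡 V) (F : IntermediateField ℚ ℂ) (hF : ρ.IsComplement F)
    {N : ℕ} (a : Fin N → ℤ) (ha : ∀ i, IsCoprime (a i) (ρ.conductor : ℤ))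
    (hsign : ρ.SignCondition F a) (m : ℕ) (hm : 1 ≤ m)
    (hWEC : ((ρ.twist a ha).matrix m).WeightEnumeratorConjecture) :
    CliffordWeil.conjInvariants (ρ.galGroup F)
        ((ρ.matrix m).cliffordWeilOver ρ.fieldK) (ρ.degree F a) =
      Submodule.span ρ.fieldK
        {p | ∃ C : Submodule R (Fin N → V), (ρ.twist a ha).IsCodeOfType C ∧
          p = ρ.ccwe F a m C} := by
  let κ := {C : Submodule R (Fin N → V) // (ρ.twist a ha).IsCodeOfType C}
  have hspan : {x | ∃ D, ((ρ.twist a ha).matrix m).IsCodeOfType D ∧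
      x = ((ρ.twist a ha).matrix m).fwe D} =
      Set.range fun C : κ => ρ.toGroupAlgebra (ρ.codeTensor m C.1) := by
    ext x
    constructor
    · rintro ⟨D, hD, rfl⟩
      obtain ⟨C, hC, rfl⟩ := CliffordWeil.Rep.exists_eq_powCode hm hD
      exact ⟨⟨C, hC⟩, ρ.toGroupAlgebra_codeTensor a ha C⟩
    · rintro ⟨⟨C, hC⟩, rfl⟩
      exact ⟨CliffordWeil.Rep.powCode m C, CliffordWeil.Rep.isCodeOfType_powCode hC,
        ρ.toGroupAlgebra_codeTensor a ha C⟩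
  have hrange : {p | ∃ C : Submodule R (Fin N → V), (ρ.twist a ha).IsCodeOfType C ∧
      p = ρ.ccwe F a m C} =
      CliffordWeil.conjEval (fun i => ρ.gal F (a i)) ''
        Set.range fun C : κ => ρ.codeTensor m C.1 := by
    ext p
    constructor
    · rintro ⟨C, hC, rfl⟩
      exact ⟨_, ⟨⟨C, hC⟩, rfl⟩, ρ.conjEval_codeTensor F a C⟩
    · rintro ⟨_, ⟨⟨C, hC⟩, rfl⟩, rfl⟩
      exact ⟨C, hC, ρ.conjEval_codeTensor F a C⟩
  rw [CliffordWeil.Rep.WeightEnumeratorConjecture, hspan] at hWEC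
  -- The conjecture describes the fixed vectors over `ℂ`; applied to a tensor with entries in
  -- `K(ρ)`, its span descends to `K(ρ)`.
  have hfix : ∀ t : (Fin N → Fin m → V) → ρ.fieldK,
      (∀ A ∈ (ρ.matrix m).cliffordWeilOver ρ.fieldK,
        (CliffordWeil.conjTensor (fun i => ρ.gal F (a i))
          (A : Matrix (Fin m → V) (Fin m → V) ρ.fieldK)).mulVec t = t) ↔
      t ∈ Submodule.span ρ.fieldK (Set.range fun C : κ => ρ.codeTensor m C.1) := by
    intro t
    rw [CliffordWeil.Rep.forall_conjTensor_mulVec_eq_iff hF ha hsign]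
    have h1 := Set.ext_iff.1 hWEC (ρ.toGroupAlgebra t)
    refine h1.trans ⟨fun h => ?_, fun h => ?_⟩
    · exact CliffordWeil.mem_span_of_map_mem_span (Equiv.piComm _) h
    · exact CliffordWeil.map_mem_span_of_mem_span (Equiv.piComm _) h
  ext f
  rw [hrange, ← Submodule.map_span, Submodule.mem_map]
  -- The degree `ρ.degree F a` unfolds to the fibre sizes of `i ↦ γ_{a_i}`, as the criterion for
  -- invariants requires.
  refine (CliffordWeil.conjInvariants_eq_map (fun i => ρ.gal F (a i)) _ f).trans ?_
  exact exists_congr fun t => and_congr_left' (hfix t)
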